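/- **Setting.** Let $\phi:\mathbb R^2\to\mathbb R$ be measurable, with $\phi(a,b)$ convex and three times differentiable in $b$, and put $\phi_k(a,b)=\partial_b^k\phi(a,b)$. For each $n$ let $(X_1,Y_1),\dots,(X_n,Y_n)$ be i.i.d. copies of $(X_0,Y_0)\in\mathbb R^p\times\mathbb R$. The dimension $p=p_n$, the law of $(X_0,Y_0)$ and all quantities derived from it, the loading $\xi$ and the set $J$ below may depend on $n$, and limits are as $n\to\infty$. Let $\bar\beta$ minimize $\beta\mapsto\mathbb E\,\phi(Y_0,X_0^{\mathrm T}\beta)$, suppose $\bar\beta\neq0$, and put $s_0=\|\bar\beta\|_0\ge1$. Write $\Sigma=\mathbb E[X_0X_0^{\mathrm T}]$, $\Omega^*=\Sigma^{-1}$, $H=\mathbb E[\phi_2(Y_0,X_0^{\mathrm T}\bar\beta)X_0X_0^{\mathrm T}]$, $M^*=H^{-1}$. Let $\xi\in\mathbb R^p\setminus\{0\}$, $S_\xi=\{j:\xi_j\ne0\}$ and $V=\mathbb E[(\xi^{\mathrm T}M^*X_0)^2\phi_1^2(Y_0,X_0^{\mathrm T}\bar\beta)]$. Let $s_{1j}=\|M^*_{\cdot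 j}\|_0$, $s_1=\max_js_{1j}$, $s_{1\xi}=(s_{1j})_{j\in S_\xi}$, $\tau_n=\log(p\vee n)/\sqrt n$, $\lambda_n=\sqrt{\log(p\vee n)/n}$. The sub-gaussian norm of a random variable $W$ is $\inf\{t>0:\mathbb E\,e^{W^2/t^2}\le2\}$, and that of a random vector $W$ is the supremum of the norms of $u^{\mathrm T}W$ over unit vectors $u$. Let $\sigma_1,\sigma_2,C_1,C_3,\dots,C_8>0$ and $\rho\in(0,1)$ be constants (not depending on $n$), and let $J\subset\{1,\dots,n\}$ be deterministic with $|J|>\rho n$ and $|J^{\mathrm c}|>\rho n$. **Assumptions.** For all large $n$: (a) $\lambda_{\min}(\Omega^*)$, $\lambda_{\min}(M^*)$ and $\lambda_{\min}(M^*\Sigma M^*)$ are at least $C_3$, and $\lambda_{\max}(M^*)\le C_4$ ($\Sigma$ and $H$ being invertible); (b) $\phi_1(Y_0,X_0^{\mathrm T}\bar\beta)$ is sub-gaussian with norm at most $\sigma_2$, and $\mathbb E[\phi_1^2(Y_0,X_0^{\mathrm T}\bar\beta)\mid X_0]\ge C_5$ almost surely; (c) almost surely, $\phi_2(Y_0,X_0^{\mathrm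 T}\bar\beta)\le C_6$ and $|\phi_3(Y_0,b)|\le C_7$ for all $b\in\mathbb R$; (d) every entry of $M^*X_0$ is sub-gaussian with norm at most $\sigma_1$. There are estimators $\hat\beta$ (a measurable function on the sample space), $\hat\beta'_J$ and $\hat\beta'_{J^{\mathrm c}}$ (measurable functions of $(X_i,Y_i)_{i\in J}$ and of $(X_i,Y_i)_{i\in J^{\mathrm c}}$, respectively) such that, for $(b,A,C)$ equal to each of $(\hat\beta,\{1,\dots,n\},C_1)$, $(\hat\beta'_J,J,C_8)$, $(\hat\beta'_{J^{\mathrm c}},J^{\mathrm c},C_8)$, with probability tending to $1$, $$\|b-\bar\beta\|_1\le C s_0\lambda_n,\qquad \frac1{|A|}\sum_{i\in A}(X_i^{\mathrm T}b-X_i^{\mathrm T}\bar\beta)^2\le C s_0\frac{\log(p\vee n)}n .$$ **Extended two-stage estimator.** For a tuning parameter $\rho_n>0$ let $\hat H_J=|J|^{-1}\sum_{i\in J}\phi_2(Y_i,X_i^{\mathrm T}\hat\beta'_J)X_iX_i^{\mathrm T}$. First let $\hat G$ minimize $$\tfrac12\operatorname{Tr}(G^{\mathrm T}\hat H_JG)-\operatorname{Tr}(G)+\rho_n\sum_{i,j}|G_{ij}|$$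 over $G\in\mathbb R^{p\times p}$; then let $\hat M^J$ minimize $\|\hat G-G\|_1$ (the maximal $\ell_1$-norm of a column) over the symmetric $G\in\mathbb R^{p\times p}$ with $\|\hat H_JG-I\|_{\max}\le\rho_n$. The output is any measurable function of the subsample with this property; its value is arbitrary where no such minimizers exist. Define $\hat M^{J^{\mathrm c}}$ likewise from $J^{\mathrm c}$ and $\hat\beta'_{J^{\mathrm c}}$. Put $$\widehat{\xi^{\mathrm T}\beta}=\xi^{\mathrm T}\hat\beta-\xi^{\mathrm T}\hat M^{J^{\mathrm c}}\frac1n\sum_{i\in J}X_i\phi_1(Y_i,X_i^{\mathrm T}\hat\beta)-\xi^{\mathrm T}\hat M^{J}\frac1n\sum_{i\in J^{\mathrm c}}X_i\phi_1(Y_i,X_i^{\mathrm T}\hat\beta),$$ $$\hat V=\frac1n\sum_{i\in J}(\xi^{\mathrm T}\hat M^{J^{\mathrm c}}X_i)^2\phi_1^2(Y_i,X_i^{\mathrm T}\hat\beta)+\frac1n\sum_{i\in J^{\mathrm c}}(\xi^{\mathrm T}\hat M^{J}X_i)^2\phi_1^2(Y_i,X_i^{\mathrm T}\hat\beta).$$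 **Theorem.** There is $A_{\min}>0$, depending only on $(\sigma_1,C_6,C_7,C_8,\rho)$, such that for every constant $A_0\ge A_{\min}$ and $\rho_n=\sqrt{s_0}A_0\lambda_n$ the two relations $$\frac{\widehat{\xi^{\mathrm T}\beta}-\xi^{\mathrm T}\bar\beta}{\sqrt V}=-\frac1n\sum_{i=1}^n\frac{(\xi^{\mathrm T}M^*X_i)\,\phi_1(Y_i,X_i^{\mathrm T}\bar\beta)}{\sqrt V}+o_p(n^{-1/2}),\qquad \frac{\hat V}{V}=1+o_p(1)\tag{$*$}$$ hold under the assumptions above in each of the following two cases. (i) For all large $n$, the entries of $X_0$ are sub-gaussian with norm at most $\sigma_1$ and $\xi^{\mathrm T}M^*X_0$ is sub-gaussian with norm at most $\sigma_1\|M^*\xi\|_2$, and $$\max\Bigl\{s_0\sqrt{\log n},\ s_1\sqrt{s_0}\,\frac{\|\xi\|_1}{\|\xi\|_2},\ \min\bigl\{\sqrt{\|s_{1\xi}\|_0\,s_1},\,s_1\bigr\}s_0\Bigr\}\tau_n=o(1).$$ (ii) For all large $n$, $X_0$ is a sub-gaussian random vector with norm at most $\sigma_1$, and $$\max\Bigl\{s_0\sqrt{\log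 n},\ \min\bigl\{\sqrt{|S_\xi|\,s_1},\,s_1\bigr\}s_0\Bigr\}\tau_n=o(1).$$ -/

import Mathlib

open MeasureTheory ProbabilityTheory Filter Topology
open scoped ENNReal Matrix

noncomputable section

namespace DebiasedGLM

/-! ### Vectors, matrices, rates -/

/-- One observation `(x, y)`: covariate vector and response. -/
abbrev Obs (p : ℕ) : Type := (Fin p → ℝ) × ℝ

/-- The support of a vector. -/
def supp {p : ℕ} (v : Fin p → ℝ) : Finset (Fin p) := Finset.univ.filter fun j => v j ≠ 0

/-- `‖v‖₀`, the number of nonzero entries. -/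
def l0 {p : ℕ} (v : Fin p → ℝ) : ℕ := (supp v).card

/-- `‖v‖₁`. -/
def l1 {p : ℕ} (v : Fin p → ℝ) : ℝ := ∑ j, |v j|

/-- The Euclidean norm `‖v‖₂`. -/
def l2 {p : ℕ} (v : Fin p → ℝ) : ℝ := Real.sqrt (∑ j, v j ^ 2)

/-- `‖A‖_max`, the largest absolute value of an entry. -/
def maxNorm {p : ℕ} (A : Matrix (Fin p) (Fin p) ℝ) : ℝ :=
  ⨆ ij : Fin p × Fin p, |A ij.1 ij.2|

/-- The matrix norm `‖A‖₁`, the largest `ℓ₁`-norm of a column. -/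
def colNorm {p : ℕ} (A : Matrix (Fin p) (Fin p) ℝ) : ℝ :=
  ⨆ j : Fin p, ∑ i, |A i j|

/-- The entrywise `ℓ₁`-norm of a matrix. -/
def entryNorm {p : ℕ} (A : Matrix (Fin p) (Fin p) ℝ) : ℝ := ∑ i, ∑ j, |A i j|

/-- `log (p ∨ n)`. -/
def logMax (p n : ℕ) : ℝ := Real.log (max (p : ℝ) (n : ℝ))

/-- `λ_n = √(log (p ∨ n) / n)`. -/
def lam (p n : ℕ) : ℝ := Real.sqrt (logMax p n / n)

/-- `τ_n = log (p ∨ n) / √n`. -/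
def tau (p n : ℕ) : ℝ := logMax p n / Real.sqrt n

/-! ### Sub-gaussian norms -/

/-- `‖f‖_{ψ₂} = inf {t > 0 : E exp (f² / t²) ≤ 2}`, equal to `∞` if there is no such `t`. -/
def psi2Norm {α : Type*} [MeasurableSpace α] (P : Measure α) (f : α → ℝ) : ℝ≥0∞ :=
  ⨅ t ∈ {t : ℝ | 0 < t ∧ ∫⁻ x, ENNReal.ofReal (Real.exp (f x ^ 2 / t ^ 2)) ∂P ≤ 2},
    ENNReal.ofReal t

/-- The sub-gaussian norm of a random vector, `sup_{s ≠ 0} ‖⟨s, f⟩ / ‖s‖₂‖_{ψ₂}`. -/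
def vecPsi2Norm {α : Type*} [MeasurableSpace α] {p : ℕ} (P : Measure α)
    (f : α → Fin p → ℝ) : ℝ≥0∞ :=
  ⨆ s ∈ {s : Fin p → ℝ | s ≠ 0}, psi2Norm P (fun x => (s ⬝ᵥ f x) / l2 s)

/-! ### The loss -/

/-- `φ_k (a, b)`, the `k`-th partial derivative of `φ` in its second argument. -/
def dphi (φ : ℝ → ℝ → ℝ) (k : ℕ) (a b : ℝ) : ℝ := iteratedDeriv k (φ a) b

/-- `φ (a, b)` is measurable, and convex and three times differentiable in `b`. -/
structure IsLoss (φ : ℝ → ℝ → ℝ) : Prop where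
  measurable : Measurable (Function.uncurry φ)
  convex : ∀ a, ConvexOn ℝ Set.univ (φ a)
  differentiable : ∀ a, ∀ k < 3, Differentiable ℝ (iteratedDeriv k (φ a))

/-! ### Population quantities; `P` is the law of `(X₀, Y₀)` -/

section Population

variable {p : ℕ} (φ : ℝ → ℝ → ℝ) (P : Measure (Obs p))

/-- `β` minimizes `E φ (Y₀, X₀ᵀ β)`, which is finite at `β`.  (A vector at which the expectation
does not exist in `ℝ` is not a competitor.) -/
def IsTarget (β : Fin p → ℝ) : Prop :=
  Integrable (fun z : Obs p => φ z.2 (z.1 ⬝ᵥ β)) P ∧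
    ∀ b : Fin p → ℝ, Integrable (fun z : Obs p => φ z.2 (z.1 ⬝ᵥ b)) P →
      ∫ z, φ z.2 (z.1 ⬝ᵥ β) ∂P ≤ ∫ z, φ z.2 (z.1 ⬝ᵥ b) ∂P

/-- `Σ = E [X₀ X₀ᵀ]`. -/
def Sig : Matrix (Fin p) (Fin p) ℝ := Matrix.of fun i j => ∫ z, z.1 i * z.1 j ∂P

/-- `Ω* = Σ⁻¹`. -/
def OmegaStar : Matrix (Fin p) (Fin p) ℝ := (Sig P)⁻¹

/-- `H = E [φ₂ (Y₀, X₀ᵀ β) X₀ X₀ᵀ]`. -/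
def Hess (β : Fin p → ℝ) : Matrix (Fin p) (Fin p) ℝ :=
  Matrix.of fun i j => ∫ z, dphi φ 2 z.2 (z.1 ⬝ᵥ β) * (z.1 i * z.1 j) ∂P

/-- `M* = H⁻¹`. -/
def MStar (β : Fin p → ℝ) : Matrix (Fin p) (Fin p) ℝ := (Hess φ P β)⁻¹

/-- `V = E [(ξᵀ M* X₀)² φ₁² (Y₀, X₀ᵀ β)]`. -/
def asympVar (β ξ : Fin p → ℝ) : ℝ :=
  ∫ z, (ξ ⬝ᵥ (MStar φ P β *ᵥ z.1)) ^ 2 * dphi φ 1 z.2 (z.1 ⬝ᵥ β) ^ 2 ∂P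

/-- `s_{1j} = ‖M*_{·j}‖₀`. -/
def s1col (β : Fin p → ℝ) (j : Fin p) : ℕ := l0 (fun i => MStar φ P β i j)

/-- `s₁ = max_j s_{1j}`. -/
def s1max (β : Fin p → ℝ) : ℕ := Finset.univ.sup (s1col φ P β)

/-- `‖s_{1ξ}‖₀` for the vector `s_{1ξ} = (s_{1j} : j ∈ supp ξ)`. -/
def s1xiCount (β ξ : Fin p → ℝ) : ℕ := ((supp ξ).filter fun j => s1col φ P β j ≠ 0).card

/-! ### Assumptions on the population -/

/-- The eigenvalue bounds on `Ω*`, `M*` and `M* Σ M*`.  (The spectrum of a matrix is the set of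
its eigenvalues.  An inverse of a singular matrix is `0` in Mathlib, and `0` violates the lower
bounds when `C₃ > 0`, so invertibility is part of the assumption.) -/
structure EigenvalueAssumption (β : Fin p → ℝ) (C₃ C₄ : ℝ) : Prop where
  omega_lower : ∀ κ ∈ spectrum ℝ (OmegaStar P), C₃ ≤ κ
  M_lower : ∀ κ ∈ spectrum ℝ (MStar φ P β), C₃ ≤ κ
  MSM_lower : ∀ κ ∈ spectrum ℝ (MStar φ P β * Sig P * MStar φ P β), C₃ ≤ κ
  M_upper : ∀ κ ∈ spectrum ℝ (MStar φ P β), κ ≤ C₄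

/-- `φ₁ (Y₀, X₀ᵀ β)` is sub-gaussian, and `E [φ₁² (Y₀, X₀ᵀ β) | X₀] ≥ C₅`. -/
structure ResidualAssumption (β : Fin p → ℝ) (σ₂ C₅ : ℝ) : Prop where
  subgaussian : psi2Norm P (fun z : Obs p => dphi φ 1 z.2 (z.1 ⬝ᵥ β)) ≤ ENNReal.ofReal σ₂
  condExp_lower : ∀ᵐ z ∂P, C₅ ≤
    (P[(fun z : Obs p => dphi φ 1 z.2 (z.1 ⬝ᵥ β) ^ 2) |
      MeasurableSpace.comap (Prod.fst : Obs p → (Fin p → ℝ)) inferInstance]) z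

/-- `φ₂` is bounded by `C₆` at the target, and `φ₃ (Y₀, ·)` is bounded by `C₇`. -/
def DerivativeAssumption (β : Fin p → ℝ) (C₆ C₇ : ℝ) : Prop :=
  ∀ᵐ z ∂P, dphi φ 2 z.2 (z.1 ⬝ᵥ β) ≤ C₆ ∧ ∀ b : ℝ, |dphi φ 3 z.2 b| ≤ C₇

/-- The entries of `M* X₀` are sub-gaussian with norm at most `σ₁`. -/
def MXEntriesAssumption (β : Fin p → ℝ) (σ₁ : ℝ) : Prop :=
  ∀ j, psi2Norm P (fun z : Obs p => (MStar φ P β *ᵥ z.1) j) ≤ ENNReal.ofReal σ₁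

/-- The entries of `X₀`, and `ξᵀ M* X₀` relative to `‖M* ξ‖₂`, are sub-gaussian. -/
structure SubGaussianEntries (β ξ : Fin p → ℝ) (σ₁ : ℝ) : Prop where
  entries : ∀ j, psi2Norm P (fun z : Obs p => z.1 j) ≤ ENNReal.ofReal σ₁
  loading : psi2Norm P (fun z : Obs p => ξ ⬝ᵥ (MStar φ P β *ᵥ z.1)) ≤
    ENNReal.ofReal (σ₁ * l2 (MStar φ P β *ᵥ ξ))

/-- `X₀` is a sub-gaussian vector with norm at most `σ₁`. -/
def SubGaussianVector (σ₁ : ℝ) : Prop :=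
  vecPsi2Norm P (fun z : Obs p => z.1) ≤ ENNReal.ofReal σ₁

end Population

/-! ### The sample -/

section Sample

variable {n p : ℕ} {Ω : Type*} [MeasurableSpace Ω]

/-- `Z₁, …, Z_n` are independent with common law `P`. -/
structure IsSample (μ : Measure Ω) (P : Measure (Obs p)) (Z : Fin n → Ω → Obs p) : Prop where
  measurable : ∀ i, Measurable (Z i)
  law : ∀ i, μ.map (Z i) = P
  indep : iIndepFun Z μ

/-- The σ-algebra generated by the subsample `(Z_i)_{i ∈ J}`. -/
abbrev subsample (Z : Fin n → Ω → Obs p) (J : Finset (Fin n)) : MeasurableSpace Ω :=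
  ⨆ i ∈ J, MeasurableSpace.comap (Z i) inferInstance

/-- `|J| > ρ n` and `|Jᶜ| > ρ n`. -/
def IsSplit (ρ : ℝ) (J : Finset (Fin n)) : Prop :=
  ρ * n < (J.card : ℝ) ∧ ρ * n < (Jᶜ.card : ℝ)

/-- The two error bounds for an estimate `b` of `β` on the subsample `J` of the data `z`:
`‖b - β‖₁ ≤ C s₀ λ_n` and `|J|⁻¹ ∑_{i ∈ J} (x_iᵀ b - x_iᵀ β)² ≤ C s₀ log (p ∨ n) / n`. -/
def GoodEstimate (C : ℝ) (β : Fin p → ℝ) (J : Finset (Fin n)) (z : Fin n → Obs p)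
    (b : Fin p → ℝ) : Prop :=
  l1 (b - β) ≤ C * l0 β * lam p n ∧
    (J.card : ℝ)⁻¹ * ∑ i ∈ J, ((z i).1 ⬝ᵥ b - (z i).1 ⬝ᵥ β) ^ 2 ≤ C * l0 β * (logMax p n / n)

/-! ### The extended two-stage estimator -/

/-- `Ĥ_J = |J|⁻¹ ∑_{i ∈ J} φ₂ (y_i, x_iᵀ b) x_i x_iᵀ`. -/
def empHess (φ : ℝ → ℝ → ℝ) (J : Finset (Fin n)) (z : Fin n → Obs p) (b : Fin p → ℝ) :
    Matrix (Fin p) (Fin p) ℝ :=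
  (J.card : ℝ)⁻¹ • ∑ i ∈ J,
    dphi φ 2 (z i).2 ((z i).1 ⬝ᵥ b) • Matrix.vecMulVec (z i).1 (z i).1

/-- The first-stage objective `½ Tr (Gᵀ H G) - Tr G + r ‖G‖` with the entrywise `ℓ₁`-norm. -/
def stageOneObj (H : Matrix (Fin p) (Fin p) ℝ) (r : ℝ) (G : Matrix (Fin p) (Fin p) ℝ) : ℝ :=
  1 / 2 * (Gᵀ * H * G).trace - G.trace + r * entryNorm G

/-- The second-stage constraints: `G` is symmetric and `‖H G - I‖_max ≤ r`. -/
def stageTwoFeasible (H : Matrix (Fin p) (Fin p) ℝ) (r : ℝ) :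
    Set (Matrix (Fin p) (Fin p) ℝ) :=
  {G | G.IsSymm ∧ maxNorm (H * G - 1) ≤ r}

/-- `M` is an output of the two-stage algorithm: for some first-stage minimizer `G`, it minimizes
`‖G - M‖₁` under the second-stage constraints. -/
def IsTwoStageOutput (H : Matrix (Fin p) (Fin p) ℝ) (r : ℝ)
    (M : Matrix (Fin p) (Fin p) ℝ) : Prop :=
  ∃ G : Matrix (Fin p) (Fin p) ℝ,
    (∀ G₁ : Matrix (Fin p) (Fin p) ℝ, stageOneObj H r G ≤ stageOneObj H r G₁) ∧
    M ∈ stageTwoFeasible H r ∧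
    ∀ M₁ ∈ stageTwoFeasible H r, colNorm (G - M) ≤ colNorm (G - M₁)

/-- The inputs and outputs of the algorithm on the subsample `J`: `b` is the initial estimator and
`M` the matrix estimator with tuning parameter `r`.  Both are measurable functions of the
subsample `J`, and `M` is an output of the algorithm whenever the two minimization problems have
solutions (otherwise the algorithm does not determine a value, and `M` is arbitrary). -/
structure IsTwoStageEstimator (φ : ℝ → ℝ → ℝ) (Z : Fin n → Ω → Obs p) (J : Finset (Fin n))
    (r : ℝ) (b : Ω → Fin p → ℝ) (M : Ω → Matrix (Fin p) (Fin p) ℝ) : Prop where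
  initial_measurable : ∀ j, Measurable[subsample Z J] fun ω => b ω j
  output_measurable : ∀ i j, Measurable[subsample Z J] fun ω => M ω i j
  output : ∀ ω,
    (∃ M₁, IsTwoStageOutput (empHess φ J (fun i => Z i ω) (b ω)) r M₁) →
      IsTwoStageOutput (empHess φ J (fun i => Z i ω) (b ω)) r (M ω)

/-! ### The debiased estimator -/

/-- The cross-fitted debiased estimator of `ξᵀ β`. -/
def debiased (φ : ℝ → ℝ → ℝ) (J : Finset (Fin n)) (z : Fin n → Obs p) (ξ b : Fin p → ℝ)
    (MJ MJc : Matrix (Fin p) (Fin p) ℝ) : ℝ :=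
  ξ ⬝ᵥ b
    - ξ ⬝ᵥ (MJc *ᵥ ((n : ℝ)⁻¹ • ∑ i ∈ J, dphi φ 1 (z i).2 ((z i).1 ⬝ᵥ b) • (z i).1))
    - ξ ⬝ᵥ (MJ *ᵥ ((n : ℝ)⁻¹ • ∑ i ∈ Jᶜ, dphi φ 1 (z i).2 ((z i).1 ⬝ᵥ b) • (z i).1))

/-- The variance estimator `V̂`. -/
def varEst (φ : ℝ → ℝ → ℝ) (J : Finset (Fin n)) (z : Fin n → Obs p) (ξ b : Fin p → ℝ)
    (MJ MJc : Matrix (Fin p) (Fin p) ℝ) : ℝ :=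
  (n : ℝ)⁻¹ * ∑ i ∈ J,
      (ξ ⬝ᵥ (MJc *ᵥ (z i).1)) ^ 2 * dphi φ 1 (z i).2 ((z i).1 ⬝ᵥ b) ^ 2
    + (n : ℝ)⁻¹ * ∑ i ∈ Jᶜ,
      (ξ ⬝ᵥ (MJ *ᵥ (z i).1)) ^ 2 * dphi φ 1 (z i).2 ((z i).1 ⬝ᵥ b) ^ 2

/-- The leading term `- n⁻¹ ∑ (ξᵀ M* x_i) φ₁ (y_i, x_iᵀ β) / √V`. -/
def leadingTerm (φ : ℝ → ℝ → ℝ) (P : Measure (Obs p)) (z : Fin n → Obs p)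
    (β ξ : Fin p → ℝ) : ℝ :=
  -((n : ℝ)⁻¹ * ∑ i, (ξ ⬝ᵥ (MStar φ P β *ᵥ (z i).1)) * dphi φ 1 (z i).2 ((z i).1 ⬝ᵥ β)
      / Real.sqrt (asympVar φ P β ξ))

end Sample

/-! ### Stochastic order -/

/-- `R_n = o_p (a_n)`: `P (|R_n| > ε |a_n|) → 0` for every `ε > 0`. -/
def IsLittleOP {Ω : ℕ → Type*} [∀ n, MeasurableSpace (Ω n)] (μ : ∀ n, Measure (Ω n))
    (R : ∀ n, Ω n → ℝ) (a : ℕ → ℝ) : Prop :=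
  ∀ ε : ℝ, 0 < ε → Tendsto (fun n => μ n {ω | ε * |a n| < |R n ω|}) atTop (𝓝 0)

/-- The events `E_n` hold with probability at least `1 - δ n` for some `δ n → 0`. -/
def HoldsWHP {Ω : ℕ → Type*} [∀ n, MeasurableSpace (Ω n)] (μ : ∀ n, Measure (Ω n))
    (E : ∀ n, Ω n → Prop) : Prop :=
  ∃ δ : ℕ → ℝ, Tendsto δ atTop (𝓝 0) ∧ ∀ n, 1 - δ n ≤ (μ n).real {ω | E n ω}

end DebiasedGLM

end

/-!
# Debiased inference for high-dimensional M-estimation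

The estimator subtracts from `ξᵀ β̂` an estimate of `ξᵀ M* E_n [X φ₁ (Y, Xᵀ β̂)]`.  For a direction
`m`, computed from one half of the sample and applied to the other half `A`, the sum
`n⁻¹ ∑_{i ∈ A} (mᵀ X_i) φ₁ (Y_i, X_iᵀ β̂)` equals its oracle version at `(M* ξ, β)`, plus
`(|A| / n) ξᵀ (β̂ - β)`, plus four errors: the score in the direction `u = m - M* ξ`, the bias
`uᵀ H (β̂ - β)`, the fluctuation `mᵀ (H_n - H) (β̂ - β)` of the Hessian, and a quadratic remainder
(`Regular.correction_expansion`).  The two halves of `ξᵀ (β̂ - β)` cancel the first-order error.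

* The score error is a sum of centred variables once `m` is regarded as fixed, which is legitimate
  because `m` depends on the complementary subsample only (`IsSample.fresh`).  Chebyshev's
  inequality then gives a bound that is small relative to `√n` as soon as the sub-gaussian scale of
  `uᵀ X` is small relative to `‖ξ‖₂`.
* The bias is at most a multiple of `‖u‖₂ ‖β̂ - β‖₂`, and restricted strong convexity turns the
  prediction error of `β̂` into `‖β̂ - β‖₂ ≲ √s₀ λ_n` (`Regular.l2_error_le`).
* The fluctuation is at most a maximum of centred averages, of order `λ_n`, times `‖β̂ - β‖₁`.
* The remainder is at most `max_i |mᵀ X_i|`, of order `√(log n)`, times the prediction error.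

The matrix estimator is analysed deterministically.  If `M*` is feasible for the empirical Hessian
up to half of the tuning parameter and the empirical Hessian is restricted strongly convex, then
both minimization problems have solutions (`exists_isTwoStageOutput`), and every output is
symmetric with columns close to those of `M*`, in `ℓ₁` and in `ℓ₂` (`IsTwoStageOutput.error`).
Symmetry permits to bound `‖(M̂ - M*) ξ‖₂` through the `ℓ₁`-norm of the columns as well as through
the support of `ξ`, which is where the minimum in the rate conditions comes from
(`l2_symm_error_le`).  The feasibility constant involves only the tails of `X` and `M* X`, the
derivative bounds, and the rate of the preliminary estimator, which is why the lower bound on the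
tuning constant depends on nothing else.

Restricted strong convexity is proved for the weights `(φ₂ - η)₊` at the target, which lie below
`φ₂` at the preliminary estimator and keep half of the curvature of `H`.  For sub-gaussian
coordinates, an entrywise comparison with the population gives a tolerance of order `λ_n`
(`Regular.restrictedConvex_entrywise`).  For a sub-gaussian vector, Maurey's empirical method
reduces the claim to sums of `k` signed coordinate vectors; a one-sided tail bound and a union
bound over these, with `k` of order `n / log (p ∨ n)`, give a tolerance of order `log (p ∨ n) / n`
(`Regular.restrictedConvex_sparse`).

The two sets of tail assumptions enter only through the structures `Regular` and
`AsymptoticSetting`; the limit statements are derived once, in `AsymptoticSetting.main`.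
-/

namespace DebiasedGLM

/-! ### Vector and matrix norms -/

section Norms

variable {p : ℕ}

lemma l1_nonneg (v : Fin p → ℝ) : 0 ≤ l1 v := Finset.sum_nonneg fun _ _ => abs_nonneg _

lemma l2_nonneg (v : Fin p → ℝ) : 0 ≤ l2 v := Real.sqrt_nonneg _

lemma l2_sq (v : Fin p → ℝ) : l2 v ^ 2 = ∑ j, v j ^ 2 :=
  Real.sq_sqrt (Finset.sum_nonneg fun _ _ => sq_nonneg _)

lemma l2_sq_eq_dot (v : Fin p → ℝ) : l2 v ^ 2 = v ⬝ᵥ v := by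
  rw [l2_sq]; simp [dotProduct, sq]

lemma l2_pos {v : Fin p → ℝ} (hv : v ≠ 0) : 0 < l2 v := by
  refine Real.sqrt_pos.2 ?_
  obtain ⟨j, hj⟩ := Function.ne_iff.1 hv
  exact lt_of_lt_of_le (by simpa using pow_pos (abs_pos.2 hj) 2)
    (Finset.single_le_sum (f := fun j => v j ^ 2) (fun _ _ => sq_nonneg _) (Finset.mem_univ j))

lemma one_le_l0 {v : Fin p → ℝ} (hv : v ≠ 0) : 1 ≤ l0 v := by
  obtain ⟨j, hj⟩ := Function.ne_iff.1 hv
  exact Finset.card_pos.2 ⟨j, by simpa [supp] using hj⟩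

lemma abs_le_l1 (v : Fin p → ℝ) (j : Fin p) : |v j| ≤ l1 v :=
  Finset.single_le_sum (f := fun j => |v j|) (fun _ _ => abs_nonneg _) (Finset.mem_univ j)

lemma l2_le_l1 (v : Fin p → ℝ) : l2 v ≤ l1 v := by
  refine Real.sqrt_le_iff.2 ⟨l1_nonneg v, ?_⟩
  calc ∑ j, v j ^ 2 = ∑ j, |v j| * |v j| := by simp [sq]
    _ ≤ ∑ j, |v j| * l1 v :=
        Finset.sum_le_sum fun j _ => mul_le_mul_of_nonneg_left (abs_le_l1 v j) (abs_nonneg _)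
    _ = l1 v ^ 2 := by rw [← Finset.sum_mul, sq]; rfl

lemma abs_dot_le_l1 {u : Fin p → ℝ} {c : ℝ} (hu : ∀ j, |u j| ≤ c) (v : Fin p → ℝ) :
    |u ⬝ᵥ v| ≤ c * l1 v := by
  rw [dotProduct, l1, Finset.mul_sum]
  refine (Finset.abs_sum_le_sum_abs _ _).trans (Finset.sum_le_sum fun j _ => ?_)
  rw [abs_mul]
  exact mul_le_mul_of_nonneg_right (hu j) (abs_nonneg _)

lemma col_le_colNorm (A : Matrix (Fin p) (Fin p) ℝ) (j : Fin p) :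
    ∑ i, |A i j| ≤ colNorm A :=
  le_ciSup (f := fun j => ∑ i, |A i j|) (Set.finite_range _).bddAbove j

lemma colNorm_le {A : Matrix (Fin p) (Fin p) ℝ} {c : ℝ} (hc : 0 ≤ c)
    (h : ∀ j, ∑ i, |A i j| ≤ c) : colNorm A ≤ c := Real.iSup_le h hc

lemma abs_le_maxNorm (A : Matrix (Fin p) (Fin p) ℝ) (i j : Fin p) : |A i j| ≤ maxNorm A :=
  le_ciSup (f := fun ij : Fin p × Fin p => |A ij.1 ij.2|) (Set.finite_range _).bddAbove (i, j)

lemma maxNorm_le_iff {A : Matrix (Fin p) (Fin p) ℝ} {c : ℝ} (hc : 0 ≤ c) :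
    maxNorm A ≤ c ↔ ∀ i j, |A i j| ≤ c :=
  ⟨fun h i j => (abs_le_maxNorm A i j).trans h, fun h => Real.iSup_le (fun ij => h ij.1 ij.2) hc⟩

/-- A matrix whose columns have `ℓ₁`-norm at most `c` increases `ℓ₁`-norms by at most the factor
`c`. -/
lemma l1_mulVec_le {D : Matrix (Fin p) (Fin p) ℝ} {c : ℝ} (h : ∀ j, ∑ i, |D i j| ≤ c)
    (v : Fin p → ℝ) : l1 (D *ᵥ v) ≤ c * l1 v := by
  calc l1 (D *ᵥ v) ≤ ∑ i, ∑ j, |D i j| * |v j| := by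
        refine Finset.sum_le_sum fun i _ => ?_
        rw [show (D *ᵥ v) i = ∑ j, D i j * v j from rfl]
        simpa only [abs_mul] using
          Finset.abs_sum_le_sum_abs (fun j => D i j * v j) Finset.univ
    _ = ∑ j, (∑ i, |D i j|) * |v j| := by rw [Finset.sum_comm]; simp [Finset.sum_mul]
    _ ≤ ∑ j, c * |v j| :=
        Finset.sum_le_sum fun j _ => mul_le_mul_of_nonneg_right (h j) (abs_nonneg _)
    _ = c * l1 v := by rw [← Finset.mul_sum]; rfl

/-- Schur's test: the operator norm of a symmetric matrix is at most its largest column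
`ℓ₁`-norm. -/
lemma l2_mulVec_le_of_isSymm {D : Matrix (Fin p) (Fin p) ℝ} (hD : D.IsSymm) {c : ℝ} (hc : 0 ≤ c)
    (h : ∀ j, ∑ i, |D i j| ≤ c) (v : Fin p → ℝ) : l2 (D *ᵥ v) ≤ c * l2 v := by
  refine (sq_le_sq₀ (l2_nonneg _) (mul_nonneg hc (l2_nonneg _))).1 ?_
  rw [mul_pow, l2_sq, l2_sq]
  have row : ∀ i, ∑ j, |D i j| ≤ c := fun i => by
    simpa [hD.apply] using h i
  calc ∑ i, (D *ᵥ v) i ^ 2 ≤ ∑ i, c * ∑ j, |D i j| * v j ^ 2 := by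
        refine Finset.sum_le_sum fun i _ => ?_
        have := Finset.sum_mul_sq_le_sq_mul_sq Finset.univ
          (fun j => Real.sqrt |D i j|) (fun j => Real.sqrt |D i j| * |v j|)
        have e : ((D *ᵥ v) i) ^ 2 ≤ (∑ j, Real.sqrt |D i j| * (Real.sqrt |D i j| * |v j|)) ^ 2 := by
          rw [← sq_abs, show (D *ᵥ v) i = ∑ j, D i j * v j from rfl]
          simp only [← mul_assoc, Real.mul_self_sqrt (abs_nonneg _)]
          refine pow_le_pow_left₀ (abs_nonneg _) ?_ 2
          simpa only [abs_mul] using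
            Finset.abs_sum_le_sum_abs (fun j => D i j * v j) Finset.univ
        refine e.trans (this.trans ?_)
        simp only [mul_pow, Real.sq_sqrt (abs_nonneg _), sq_abs]
        exact mul_le_mul_of_nonneg_right (row i)
          (Finset.sum_nonneg fun j _ => mul_nonneg (abs_nonneg _) (sq_nonneg _))
    _ = c * ∑ j, (∑ i, |D i j|) * v j ^ 2 := by
        rw [← Finset.mul_sum, Finset.sum_comm]; simp [Finset.sum_mul]
    _ ≤ c * ∑ j, c * v j ^ 2 := by
        refine mul_le_mul_of_nonneg_left (Finset.sum_le_sum fun j _ => ?_) hc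
        exact mul_le_mul_of_nonneg_right (h j) (sq_nonneg _)
    _ = c ^ 2 * ∑ j, v j ^ 2 := by rw [← Finset.mul_sum]; ring

/-- Column-wise `ℓ₂`-bounds control the image of a vector through the size of its support. -/
lemma l2_mulVec_le_sqrt_card {D : Matrix (Fin p) (Fin p) ℝ} {c : ℝ} (hc : 0 ≤ c)
    (h : ∀ j, l2 (fun i => D i j) ≤ c) (v : Fin p → ℝ) :
    l2 (D *ᵥ v) ≤ Real.sqrt (supp v).card * c * l2 v := by
  have hr : 0 ≤ Real.sqrt (supp v).card * c * l2 v :=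
    mul_nonneg (mul_nonneg (Real.sqrt_nonneg _) hc) (l2_nonneg _)
  refine (sq_le_sq₀ (l2_nonneg _) hr).1 ?_
  rw [mul_pow, mul_pow, l2_sq, l2_sq, Real.sq_sqrt (Nat.cast_nonneg _)]
  have e : ∀ i, (D *ᵥ v) i = ∑ j ∈ supp v, D i j * v j := fun i => by
    rw [Matrix.mulVec, dotProduct, supp, Finset.sum_filter]
    refine Finset.sum_congr rfl fun j _ => ?_
    split_ifs with hj
    · rfl
    · simp [not_not.1 hj]
  calc ∑ i, (D *ᵥ v) i ^ 2 ≤ ∑ i, (∑ j ∈ supp v, D i j ^ 2) * ∑ j, v j ^ 2 := by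
        refine Finset.sum_le_sum fun i _ => ?_
        rw [e]
        refine (Finset.sum_mul_sq_le_sq_mul_sq _ _ _).trans
          (mul_le_mul_of_nonneg_left ?_ (Finset.sum_nonneg fun _ _ => sq_nonneg _))
        exact Finset.sum_le_sum_of_subset_of_nonneg (Finset.subset_univ _)
          fun _ _ _ => sq_nonneg _
    _ = (∑ j ∈ supp v, ∑ i, D i j ^ 2) * ∑ j, v j ^ 2 := by
        rw [← Finset.sum_mul, Finset.sum_comm]
    _ ≤ (∑ j ∈ supp v, c ^ 2) * ∑ j, v j ^ 2 := by
        refine mul_le_mul_of_nonneg_right (Finset.sum_le_sum fun j _ => ?_)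
          (Finset.sum_nonneg fun _ _ => sq_nonneg _)
        rw [← l2_sq]
        exact pow_le_pow_left₀ (l2_nonneg _) (h j) 2
    _ = _ := by simp

end Norms

/-! ### Quadratic forms -/

section QuadraticForms

variable {p : ℕ}

lemma dot_mulVec_comm {A : Matrix (Fin p) (Fin p) ℝ} (hA : A.IsSymm) (u v : Fin p → ℝ) :
    u ⬝ᵥ (A *ᵥ v) = v ⬝ᵥ (A *ᵥ u) := by
  rw [Matrix.dotProduct_mulVec, ← Matrix.mulVec_transpose, hA.eq, dotProduct_comm]

lemma quad_add {A : Matrix (Fin p) (Fin p) ℝ} (hA : A.IsSymm) (u v : Fin p → ℝ) :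
    (u + v) ⬝ᵥ (A *ᵥ (u + v)) = u ⬝ᵥ (A *ᵥ u) + 2 * (u ⬝ᵥ (A *ᵥ v)) + v ⬝ᵥ (A *ᵥ v) := by
  rw [Matrix.mulVec_add, add_dotProduct, dotProduct_add, dotProduct_add, dot_mulVec_comm hA v u]
  ring

/-- Cauchy–Schwarz for a positive semidefinite form, in terms of an upper bound on the form. -/
lemma abs_dot_mulVec_le {A : Matrix (Fin p) (Fin p) ℝ} (hA : A.IsSymm)
    (h0 : ∀ v, 0 ≤ v ⬝ᵥ (A *ᵥ v)) {C : ℝ} (hC : 0 ≤ C)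
    (h1 : ∀ v, v ⬝ᵥ (A *ᵥ v) ≤ C * l2 v ^ 2) (u v : Fin p → ℝ) :
    |u ⬝ᵥ (A *ᵥ v)| ≤ C * (l2 u * l2 v) := by
  have key : ∀ t : ℝ, 0 ≤ (v ⬝ᵥ (A *ᵥ v)) * (t * t) + (2 * (u ⬝ᵥ (A *ᵥ v))) * t
      + u ⬝ᵥ (A *ᵥ u) := fun t => by
    have := h0 (u + t • v)
    rw [quad_add hA] at this
    simp only [Matrix.mulVec_smul, dotProduct_smul, smul_dotProduct, smul_eq_mul] at this
    linarith
  have hd := discrim_le_zero key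
  rw [discrim] at hd
  refine abs_le_of_sq_le_sq ?_ (mul_nonneg hC (mul_nonneg (l2_nonneg _) (l2_nonneg _)))
  have := mul_le_mul (h1 v) (h1 u) (h0 u) (mul_nonneg hC (sq_nonneg _))
  nlinarith

lemma posSemidef_of_isSymm {A : Matrix (Fin p) (Fin p) ℝ} (hA : A.IsSymm)
    (h : ∀ κ ∈ spectrum ℝ A, 0 ≤ κ) (v : Fin p → ℝ) : 0 ≤ v ⬝ᵥ (A *ᵥ v) := by
  have hp : A.PosSemidef := Matrix.posSemidef_iff_isHermitian_and_spectrum_nonneg.2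
    ⟨by rw [Matrix.IsHermitian, Matrix.conjTranspose_eq_transpose_of_trivial, hA.eq], h⟩
  simpa using hp.dotProduct_mulVec_nonneg v

lemma quad_ge_of_spectrum {A : Matrix (Fin p) (Fin p) ℝ} (hA : A.IsSymm) {c : ℝ}
    (h : ∀ κ ∈ spectrum ℝ A, c ≤ κ) (v : Fin p → ℝ) : c * l2 v ^ 2 ≤ v ⬝ᵥ (A *ᵥ v) := by
  have hs : (A - algebraMap ℝ _ c).IsSymm := by
    rw [Matrix.IsSymm, Matrix.transpose_sub, hA.eq, Matrix.algebraMap_eq_diagonal,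
      Matrix.diagonal_transpose]
  have := posSemidef_of_isSymm hs (fun κ hκ => by
    rw [← spectrum.add_mem_add_iff (s := c), add_sub_cancel] at hκ
    linarith [h _ hκ]) v
  rw [Matrix.sub_mulVec, dotProduct_sub, Algebra.algebraMap_eq_smul_one, Matrix.smul_mulVec,
    Matrix.one_mulVec, dotProduct_smul, ← l2_sq_eq_dot, smul_eq_mul] at this
  linarith

lemma quad_le_of_spectrum {A : Matrix (Fin p) (Fin p) ℝ} (hA : A.IsSymm) {c : ℝ}
    (h : ∀ κ ∈ spectrum ℝ A, κ ≤ c) (v : Fin p → ℝ) : v ⬝ᵥ (A *ᵥ v) ≤ c * l2 v ^ 2 := by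
  have := quad_ge_of_spectrum (A := -A) (c := -c) (by rw [Matrix.IsSymm, Matrix.transpose_neg, hA.eq])
    (fun κ hκ => by
      rw [← spectrum.neg_eq, Set.mem_neg] at hκ
      linarith [h _ hκ]) v
  rw [Matrix.neg_mulVec, dotProduct_neg] at this
  linarith

/-- A matrix whose inverse (in the sense of Mathlib) has only positive eigenvalues is
invertible. -/
lemma isUnit_of_spectrum_inv_pos (hp : 0 < p) {A : Matrix (Fin p) (Fin p) ℝ} {c : ℝ} (hc : 0 < c)
    (h : ∀ κ ∈ spectrum ℝ A⁻¹, c ≤ κ) : IsUnit A := by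
  have : Nonempty (Fin p) := ⟨⟨0, hp⟩⟩
  by_contra hA
  have hA' : A⁻¹ = 0 := Matrix.nonsing_inv_apply_not_isUnit _
    (fun h' => hA ((Matrix.isUnit_iff_isUnit_det _).2 h'))
  have : (0 : ℝ) ∈ spectrum ℝ A⁻¹ := by
    rw [hA', spectrum.zero_mem_iff]
    exact not_isUnit_zero
  linarith [h 0 this]

lemma spectrum_of_inv {A : Matrix (Fin p) (Fin p) ℝ} (hA : IsUnit A) {κ : ℝ}
    (hκ : κ ∈ spectrum ℝ A) : κ ≠ 0 ∧ κ⁻¹ ∈ spectrum ℝ A⁻¹ := by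
  obtain ⟨a, rfl⟩ := hA
  have h0 : κ ≠ 0 := by
    rintro rfl
    exact (spectrum.zero_notMem_iff ℝ).2 a.isUnit hκ
  refine ⟨h0, ?_⟩
  have := (spectrum.inv_mem_iff (r := Units.mk0 κ h0) (a := a)).1 hκ
  simpa [Matrix.coe_units_inv] using this

end QuadraticForms

/-! ### Restricted strong convexity -/

section RestrictedConvexity

variable {p : ℕ}

/-- Restricted strong convexity of the quadratic form of `H`, with curvature `κ` and
`ℓ₁`-tolerance `γ`. -/
def RestrictedConvex (H : Matrix (Fin p) (Fin p) ℝ) (κ γ : ℝ) : Prop :=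
  ∀ v : Fin p → ℝ, κ * l2 v ^ 2 - γ * l1 v ^ 2 ≤ v ⬝ᵥ (H *ᵥ v)

/-- An entrywise perturbation of size `γ` of a form with curvature `κ` is restricted strongly
convex. -/
lemma RestrictedConvex.of_entrywise {A B : Matrix (Fin p) (Fin p) ℝ} {κ γ : ℝ}
    (hB : ∀ v, κ * l2 v ^ 2 ≤ v ⬝ᵥ (B *ᵥ v)) (h : ∀ i j, |A i j - B i j| ≤ γ) :
    RestrictedConvex A κ γ := by
  intro v
  have h1 : ∀ i, |((A - B) *ᵥ v) i| ≤ γ * l1 v := fun i => abs_dot_le_l1 (fun j => h i j) v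
  have h2 := abs_dot_le_l1 h1 v
  rw [dotProduct_comm, Matrix.sub_mulVec, dotProduct_sub] at h2
  nlinarith [(abs_le.1 h2).1, hB v]

/-- Derandomized empirical method: if `v` is an average of the points `a i` with weights `q`, some
sum of `l` of these points does at least as well, for the quadratic form of `B`, as the sum of `l`
independent random points with law `q`. -/
lemma exists_sum_quad_le {ι : Type*} [Fintype ι] {B : Matrix (Fin p) (Fin p) ℝ} (hB : B.IsSymm)
    (a : ι → Fin p → ℝ) (q : ι → ℝ) (hq : ∀ i, 0 ≤ q i) (hq1 : ∑ i, q i = 1) (v : Fin p → ℝ)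
    (hv : ∑ i, q i • a i = v) (l : ℕ) (w : Fin p → ℝ) :
    ∃ t : Fin l → ι, (w + ∑ m, a (t m)) ⬝ᵥ (B *ᵥ (w + ∑ m, a (t m))) ≤
      w ⬝ᵥ (B *ᵥ w) + 2 * l * (w ⬝ᵥ (B *ᵥ v)) + l * (l - 1) * (v ⬝ᵥ (B *ᵥ v))
        + l * ∑ i, q i * (a i ⬝ᵥ (B *ᵥ a i)) := by
  induction l generalizing w with
  | zero => exact ⟨Fin.elim0, by simp⟩
  | succ l ih =>
    set D := ∑ i, q i * (a i ⬝ᵥ (B *ᵥ a i)) with hD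
    set F : (Fin p → ℝ) → ℝ := fun w => w ⬝ᵥ (B *ᵥ w) + 2 * l * (w ⬝ᵥ (B *ᵥ v))
      + l * (l - 1) * (v ⬝ᵥ (B *ᵥ v)) + l * D with hF
    set T := w ⬝ᵥ (B *ᵥ w) + 2 * (l + 1 : ℕ) * (w ⬝ᵥ (B *ᵥ v))
      + (l + 1 : ℕ) * ((l + 1 : ℕ) - 1) * (v ⬝ᵥ (B *ᵥ v)) + (l + 1 : ℕ) * D with hT
    have lin : ∀ x : Fin p → ℝ, ∑ i, q i * (x ⬝ᵥ (B *ᵥ a i)) = x ⬝ᵥ (B *ᵥ v) := fun x => by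
      rw [← hv, Matrix.mulVec_sum, dotProduct_sum]
      simp [Matrix.mulVec_smul, dotProduct_smul]
    have avg : ∑ i, q i * F (w + a i) = T := by
      have e : ∀ i, q i * F (w + a i) = q i * (w ⬝ᵥ (B *ᵥ w) + 2 * l * (w ⬝ᵥ (B *ᵥ v))
          + l * (l - 1) * (v ⬝ᵥ (B *ᵥ v)) + l * D)
          + 2 * (q i * (w ⬝ᵥ (B *ᵥ a i))) + 2 * l * (q i * (v ⬝ᵥ (B *ᵥ a i)))
          + q i * (a i ⬝ᵥ (B *ᵥ a i)) := fun i => by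
        simp only [hF, quad_add hB, add_dotProduct, dot_mulVec_comm hB (a i) v]
        ring
      simp only [e, Finset.sum_add_distrib, ← Finset.sum_mul, ← Finset.mul_sum, lin, hq1, ← hD, hT]
      push_cast
      ring
    obtain ⟨i, hi⟩ : ∃ i, F (w + a i) ≤ T := by
      by_contra! hlt
      have : ∑ i, q i * T < ∑ i, q i * F (w + a i) := by
        obtain ⟨j, hj⟩ : ∃ j, 0 < q j := by
          by_contra! hle
          have : ∑ i, q i ≤ 0 := Finset.sum_nonpos fun i _ => hle i
          linarith
        exact Finset.sum_lt_sum (fun i _ => mul_le_mul_of_nonneg_left (hlt i).le (hq i))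
          ⟨j, Finset.mem_univ _, mul_lt_mul_of_pos_left (hlt j) hj⟩
      rw [← Finset.sum_mul, hq1, one_mul, avg] at this
      exact lt_irrefl _ this
    obtain ⟨t, ht⟩ := ih (w + a i)
    refine ⟨Fin.cons i t, ?_⟩
    rw [Fin.sum_univ_succ]
    simp only [Fin.cons_zero, Fin.cons_succ, ← add_assoc]
    exact ht.trans hi

/-- The sum of signed coordinate vectors described by `t`. -/
noncomputable def signedSum {k : ℕ} (t : Fin k → Fin p × Bool) : Fin p → ℝ :=
  ∑ m, (if (t m).2 then (1 : ℝ) else -1) • Pi.single (t m).1 1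

/-- A quadratic form that is nonnegative at all signed sums of `k` coordinate vectors is
nonnegative everywhere, up to an `ℓ₁`-tolerance of order `1 / k`. -/
lemma quad_ge_of_signedSum {B : Matrix (Fin p) (Fin p) ℝ} (hB : B.IsSymm) {k : ℕ} (hk : 2 ≤ k)
    (h : ∀ t : Fin k → Fin p × Bool, 0 ≤ signedSum t ⬝ᵥ (B *ᵥ signedSum t)) {d : ℝ}
    (hd : ∀ j, B j j ≤ d) (v : Fin p → ℝ) :
    -(d / (k - 1)) * l1 v ^ 2 ≤ v ⬝ᵥ (B *ᵥ v) := by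
  have hk' : (2 : ℝ) ≤ k := by exact_mod_cast hk
  rcases (l1_nonneg v).eq_or_lt with h0 | hR
  · have : v = 0 := by
      ext j
      exact abs_eq_zero.1 (le_antisymm ((abs_le_l1 v j).trans h0.symm.le) (abs_nonneg _))
    subst this
    simp [← h0]
  set R := l1 v with hRdef
  obtain ⟨sg, hsg, hsv⟩ : ∃ sg : Fin p → Bool, (∀ j, (if sg j then (1 : ℝ) else -1) ^ 2 = 1) ∧
      ∀ j, |v j| * (if sg j then (1 : ℝ) else -1) = v j := by
    refine ⟨fun j => decide (0 ≤ v j), fun j => by split_ifs <;> norm_num, fun j => ?_⟩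
    by_cases hj : 0 ≤ v j
    · simp [hj]
    · simp [hj, abs_of_neg (not_le.1 hj)]
  -- `v` is the average of the points `± R e_j` with weights `|v_j| / R`.
  set a : Fin p → Fin p → ℝ := fun j => (R * if sg j then (1 : ℝ) else -1) • Pi.single j 1 with ha
  have hqa : ∑ i, (|v i| / R) • a i = v := by
    ext j
    simp only [ha, Finset.sum_apply, Pi.smul_apply, smul_eq_mul, Pi.single_apply, mul_ite, mul_one,
      mul_zero, Finset.sum_ite_eq, Finset.mem_univ, if_true]
    conv_rhs => rw [← hsv j]
    split_ifs <;> field_simp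
  obtain ⟨t, ht⟩ := exists_sum_quad_le hB a (fun i => |v i| / R)
    (fun i => div_nonneg (abs_nonneg _) hR.le)
    (by rw [← Finset.sum_div]; exact div_self hR.ne') v hqa k 0
  have hsum : ∑ m, a (t m) = R • signedSum (fun m => (t m, sg (t m))) := by
    simp [signedSum, Finset.smul_sum, ha]
  have hD : ∑ i, |v i| / R * (a i ⬝ᵥ (B *ᵥ a i)) ≤ R ^ 2 * d := by
    have e : ∀ i, a i ⬝ᵥ (B *ᵥ a i) = R ^ 2 * B i i := fun i => by
      simp only [ha, Matrix.mulVec_smul, dotProduct_smul, smul_dotProduct, smul_eq_mul,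
        Matrix.mulVec_single_one, single_one_dotProduct, Matrix.col_apply]
      linear_combination R ^ 2 * B i i * hsg i
    calc ∑ i, |v i| / R * (a i ⬝ᵥ (B *ᵥ a i)) ≤ ∑ i, |v i| / R * (R ^ 2 * d) := by
          refine Finset.sum_le_sum fun i _ =>
            mul_le_mul_of_nonneg_left ?_ (div_nonneg (abs_nonneg _) hR.le)
          rw [e]
          exact mul_le_mul_of_nonneg_left (hd i) (sq_nonneg _)
      _ = R ^ 2 * d := by
          rw [← Finset.sum_mul, ← Finset.sum_div, show ∑ i, |v i| = R from rfl, div_self hR.ne',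
            one_mul]
  rw [zero_add, hsum, Matrix.mulVec_smul, dotProduct_smul, smul_dotProduct] at ht
  have h1 := h (fun m => (t m, sg (t m)))
  simp only [zero_dotProduct, mul_zero, zero_add, smul_eq_mul] at ht
  have h2 : 0 ≤ R * (R * (signedSum (fun m => (t m, sg (t m))) ⬝ᵥ
      (B *ᵥ signedSum (fun m => (t m, sg (t m)))))) := by positivity
  have h3 : 0 ≤ (k : ℝ) * ((k - 1) * (v ⬝ᵥ (B *ᵥ v)) + R ^ 2 * d) := by nlinarith
  have h4 := nonneg_of_mul_nonneg_right h3 (by linarith)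
  rw [neg_mul, div_mul_eq_mul_div, ← neg_div, div_le_iff₀ (by linarith)]
  linarith

end RestrictedConvexity

/-! ### The two-stage matrix estimator -/

section TwoStage

variable {p : ℕ}

/-- The contribution of the `j`-th column `g` to the first-stage objective. -/
noncomputable def columnObj (H : Matrix (Fin p) (Fin p) ℝ) (r : ℝ) (j : Fin p) (g : Fin p → ℝ) : ℝ :=
  1 / 2 * (g ⬝ᵥ (H *ᵥ g)) - g j + r * l1 g

lemma stageOneObj_eq_sum (H : Matrix (Fin p) (Fin p) ℝ) (r : ℝ) (G : Matrix (Fin p) (Fin p) ℝ) :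
    stageOneObj H r G = ∑ j, columnObj H r j (fun i => G i j) := by
  have e : entryNorm G = ∑ j, l1 (fun i => G i j) := Finset.sum_comm
  have t : (Gᵀ * H * G).trace = ∑ j, (fun i => G i j) ⬝ᵥ (H *ᵥ fun i => G i j) := by
    rw [Matrix.mul_assoc]; rfl
  simp only [stageOneObj, columnObj, Finset.sum_add_distrib, Finset.sum_sub_distrib,
    ← Finset.mul_sum, e, t]
  rfl

lemma columnObj_le_of_stageOneObj_le {H : Matrix (Fin p) (Fin p) ℝ} {r : ℝ}
    {G : Matrix (Fin p) (Fin p) ℝ} (hG : ∀ G₁, stageOneObj H r G ≤ stageOneObj H r G₁)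
    (j : Fin p) (g : Fin p → ℝ) : columnObj H r j (fun i => G i j) ≤ columnObj H r j g := by
  have h := hG (G.updateCol j g)
  rw [stageOneObj_eq_sum, stageOneObj_eq_sum, ← Finset.add_sum_erase _ _ (Finset.mem_univ j),
    ← Finset.add_sum_erase Finset.univ _ (Finset.mem_univ j)] at h
  have e : ∑ x ∈ Finset.univ.erase j, columnObj H r x (fun i => G.updateCol j g i x)
      = ∑ x ∈ Finset.univ.erase j, columnObj H r x (fun i => G i x) := by
    refine Finset.sum_congr rfl fun x hx => ?_
    simp [Matrix.updateCol_ne (Finset.ne_of_mem_erase hx)]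
  rw [e] at h
  simpa only [Matrix.updateCol_self] using le_of_add_le_add_right h

lemma abs_mulVec_sub_single_le {H M : Matrix (Fin p) (Fin p) ℝ} {r : ℝ}
    (h : ∀ i j, |(H * M - 1) i j| ≤ r) (j i : Fin p) :
    |(H *ᵥ (fun i => M i j) - (Pi.single j 1 : Fin p → ℝ)) i| ≤ r := by
  have := h i j
  rw [Matrix.sub_apply, Matrix.one_apply, Matrix.mul_apply] at this
  simpa [Matrix.mulVec, dotProduct, Pi.single_apply] using this

/-- Strict feasibility of `m` makes the column objective coercive. -/
lemma columnObj_ge {H : Matrix (Fin p) (Fin p) ℝ} (hH : H.IsSymm)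
    (h0 : ∀ v, 0 ≤ v ⬝ᵥ (H *ᵥ v)) {r : ℝ} {j : Fin p} {m : Fin p → ℝ}
    (hm : ∀ i, |(H *ᵥ m - (Pi.single j 1 : Fin p → ℝ)) i| ≤ r / 2) (g : Fin p → ℝ) :
    r / 2 * l1 g - 1 / 2 * (m ⬝ᵥ (H *ᵥ m)) ≤ columnObj H r j g := by
  have h1 := abs_dot_le_l1 hm g
  rw [sub_dotProduct, single_one_dotProduct, dotProduct_comm] at h1
  have h2 := h0 (g + (-1 : ℝ) • m)
  rw [quad_add hH] at h2
  simp only [Matrix.mulVec_smul, dotProduct_smul, smul_dotProduct, smul_eq_mul] at h2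
  rw [columnObj]
  linarith [(abs_le.1 h1).1, (abs_le.1 h1).2]

/-- The oracle inequality for one column of the first stage. -/
lemma l1_sub_le_of_columnObj_le {H : Matrix (Fin p) (Fin p) ℝ} (hH : H.IsSymm)
    {κ γ r : ℝ} (hκ : 0 < κ) (hγ : 0 ≤ γ) (hr : 0 < r) (hRSC : RestrictedConvex H κ γ)
    {j : Fin p} {m g : Fin p → ℝ} (hm : ∀ i, |(H *ᵥ m - (Pi.single j 1 : Fin p → ℝ)) i| ≤ r / 2)
    (hg : columnObj H r j g ≤ columnObj H r j m) (h0 : ∀ v, 0 ≤ v ⬝ᵥ (H *ᵥ v))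
    {s : ℝ} (hs : (l0 m : ℝ) ≤ s) (hγs : 32 * (γ * s) ≤ κ) :
    l1 (g - m) ≤ 24 / κ * (r * s) := by
  set Δ := g - m with hΔ
  have hgm : g = m + Δ := by simp [hΔ]
  -- `a` and `b` are the `ℓ₁`-norms of the error on and off the support of `m`.
  set a := ∑ i ∈ supp m, |Δ i| with ha
  set b := ∑ i ∈ (supp m)ᶜ, |Δ i| with hb
  have hab : l1 Δ = a + b := (Finset.sum_add_sum_compl _ _).symm
  have ha0 : 0 ≤ a := Finset.sum_nonneg fun _ _ => abs_nonneg _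
  have hb0 : 0 ≤ b := Finset.sum_nonneg fun _ _ => abs_nonneg _
  have hl : b - a ≤ l1 g - l1 m := by
    have e : ∀ v : Fin p → ℝ, l1 v = ∑ i ∈ supp m, |v i| + ∑ i ∈ (supp m)ᶜ, |v i| :=
      fun v => (Finset.sum_add_sum_compl _ _).symm
    rw [e g, e m]
    have h1 : ∑ i ∈ supp m, |m i| ≤ ∑ i ∈ supp m, |g i| + a := by
      rw [ha, ← Finset.sum_add_distrib]
      refine Finset.sum_le_sum fun i _ => ?_
      have := abs_sub_abs_le_abs_sub (m i) (g i)
      rw [abs_sub_comm] at this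
      rw [hΔ, Pi.sub_apply]
      linarith
    have h2 : ∑ i ∈ (supp m)ᶜ, |g i| = b := by
      refine Finset.sum_congr rfl fun i hi => ?_
      have : m i = 0 := by simpa [supp] using hi
      simp [hΔ, this]
    have h3 : ∑ i ∈ (supp m)ᶜ, |m i| = 0 :=
      Finset.sum_eq_zero fun i hi => by simpa [supp] using hi
    linarith
  have h1 := abs_dot_le_l1 hm Δ
  rw [sub_dotProduct, single_one_dotProduct, dotProduct_comm, hab] at h1
  set Q := Δ ⬝ᵥ (H *ᵥ Δ) with hQ
  -- The basic inequality: the gradient noise is at most half the penalty.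
  have basic : 1 / 2 * Q + r / 2 * b ≤ 3 / 2 * (r * a) := by
    rw [columnObj, columnObj] at hg
    have e1 : g ⬝ᵥ (H *ᵥ g) = m ⬝ᵥ (H *ᵥ m) + 2 * (m ⬝ᵥ (H *ᵥ Δ)) + Q := by
      rw [hgm, quad_add hH]
    have e2 : g j = m j + Δ j := by rw [hgm]; rfl
    rw [dot_mulVec_comm hH Δ m] at h1
    nlinarith [(abs_le.1 h1).1, mul_le_mul_of_nonneg_left hl hr.le]
  have hQ0 := h0 Δ
  -- Hence the error lies in the usual cone.
  have hb3 : b ≤ 3 * a := by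
    by_contra! hlt
    nlinarith
  have ha2 : a ^ 2 ≤ s * l2 Δ ^ 2 := by
    have := Finset.sum_mul_sq_le_sq_mul_sq (supp m) (fun _ => (1 : ℝ)) (fun i => |Δ i|)
    simp only [one_mul, one_pow, Finset.sum_const, nsmul_eq_mul, mul_one, sq_abs] at this
    refine this.trans (mul_le_mul hs ?_ (Finset.sum_nonneg fun _ _ => sq_nonneg _)
      ((Nat.cast_nonneg _).trans hs))
    rw [l2_sq]
    exact Finset.sum_le_sum_of_subset_of_nonneg (Finset.subset_univ _) fun _ _ _ => sq_nonneg _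
  have hs0 : 0 ≤ s := (Nat.cast_nonneg _).trans hs
  -- On the cone the `ℓ₁`-tolerance is absorbed by half of the curvature.
  have hQl : κ / 2 * l2 Δ ^ 2 ≤ Q := by
    have h2 := hRSC Δ
    have h3 : l1 Δ ^ 2 ≤ 16 * (s * l2 Δ ^ 2) := by rw [hab]; nlinarith
    have h4 : γ * l1 Δ ^ 2 ≤ γ * (16 * (s * l2 Δ ^ 2)) := mul_le_mul_of_nonneg_left h3 hγ
    nlinarith [mul_le_mul_of_nonneg_right hγs (sq_nonneg (l2 Δ))]
  have hl2 : κ * l2 Δ ^ 2 ≤ 6 * (r * a) := by nlinarith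
  have hfin : κ * a ≤ 6 * (r * s) := by
    rcases ha0.eq_or_lt with h | h
    · rw [← h]; have := mul_nonneg hr.le hs0; linarith
    · have : a * (κ * a) ≤ a * (6 * (r * s)) := by
        nlinarith [mul_le_mul_of_nonneg_left hl2 hs0, mul_le_mul_of_nonneg_left ha2 hκ.le]
      exact le_of_mul_le_mul_left this h
  rw [div_mul_eq_mul_div, le_div_iff₀ hκ, hab]
  nlinarith

lemma colNorm_add_le (A B : Matrix (Fin p) (Fin p) ℝ) : colNorm (A + B) ≤ colNorm A + colNorm B := by
  have nn : ∀ C : Matrix (Fin p) (Fin p) ℝ, 0 ≤ colNorm C := fun C =>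
    Real.iSup_nonneg fun j => Finset.sum_nonneg fun _ _ => abs_nonneg _
  refine colNorm_le (add_nonneg (nn A) (nn B)) fun j => ?_
  refine le_trans ?_ (add_le_add (col_le_colNorm A j) (col_le_colNorm B j))
  rw [← Finset.sum_add_distrib]
  exact Finset.sum_le_sum fun i _ => abs_add_le _ _

lemma colNorm_sub_comm (A B : Matrix (Fin p) (Fin p) ℝ) : colNorm (A - B) = colNorm (B - A) := by
  simp only [colNorm, Matrix.sub_apply, abs_sub_comm]

/-- Error bounds for the two-stage estimator, in the column `ℓ₁`- and `ℓ₂`-norms. -/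
theorem IsTwoStageOutput.error {H M M' : Matrix (Fin p) (Fin p) ℝ} (hH : H.IsSymm)
    (h0 : ∀ v, 0 ≤ v ⬝ᵥ (H *ᵥ v)) {κ γ r : ℝ} (hκ : 0 < κ) (hγ : 0 ≤ γ) (hr : 0 < r)
    (hRSC : RestrictedConvex H κ γ) (hM : M.IsSymm) (hHM : ∀ i j, |(H * M - 1) i j| ≤ r / 2)
    {s : ℝ} (hs0 : 0 ≤ s) (hs : ∀ j, (l0 (fun i => M i j) : ℝ) ≤ s) (hγs : 32 * (γ * s) ≤ κ)
    (hM' : IsTwoStageOutput H r M') :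
    (M' - M).IsSymm ∧ (∀ j, ∑ i, |(M' - M) i j| ≤ 48 / κ * (r * s)) ∧
      ∀ j, l2 (fun i => (M' - M) i j) ≤ 12 / κ * (r * Real.sqrt s) := by
  obtain ⟨G, hG, ⟨hM's, hM'f⟩, hmin⟩ := hM'
  have hMfeas : M ∈ stageTwoFeasible H r :=
    ⟨hM, (maxNorm_le_iff hr.le).2 fun i j => (hHM i j).trans (by linarith)⟩
  have hB : 0 ≤ 24 / κ * (r * s) := by positivity
  have hGM : colNorm (G - M) ≤ 24 / κ * (r * s) :=
    colNorm_le hB fun j => l1_sub_le_of_columnObj_le hH hκ hγ hr hRSC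
      (abs_mulVec_sub_single_le hHM j)
      (columnObj_le_of_stageOneObj_le hG j (fun i => M i j)) h0 (hs j) hγs
  -- `M` competes in the second stage, which therefore at most doubles the first-stage error.
  have hD : colNorm (M' - M) ≤ 48 / κ * (r * s) := by
    have h1 := colNorm_add_le (M' - G) (G - M)
    rw [sub_add_sub_cancel, colNorm_sub_comm M' G] at h1
    have := hmin M hMfeas
    calc colNorm (M' - M) ≤ 24 / κ * (r * s) + 24 / κ * (r * s) := by linarith
      _ = 48 / κ * (r * s) := by ring
  have hcol : ∀ j, ∑ i, |(M' - M) i j| ≤ 48 / κ * (r * s) :=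
    fun j => (col_le_colNorm _ j).trans hD
  have hsym : (M' - M).IsSymm := by
    rw [Matrix.IsSymm, Matrix.transpose_sub, hM's.eq, hM.eq]
  refine ⟨hsym, hcol, fun j => ?_⟩
  set d : Fin p → ℝ := fun i => (M' - M) i j with hd
  -- Both `M'` and `M` nearly invert `H`, so the quadratic form is small at their difference.
  have hHd : ∀ i, |(H *ᵥ d) i| ≤ 3 / 2 * r := fun i => by
    have e : (H *ᵥ d) i = (H * M' - 1) i j - (H * M - 1) i j := by
      have : (H *ᵥ d) i = (H * (M' - M)) i j := rfl
      rw [this, Matrix.mul_sub, ← sub_sub_sub_cancel_right (H * M') (H * M) 1]; rfl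
    rw [e]
    have h1 := (abs_le_maxNorm (H * M' - 1) i j).trans hM'f
    have h2 := abs_sub ((H * M' - 1) i j) ((H * M - 1) i j)
    linarith [hHM i j]
  have hquad : d ⬝ᵥ (H *ᵥ d) ≤ 3 / 2 * r * (48 / κ * (r * s)) := by
    rw [dotProduct_comm]
    exact (le_abs_self _).trans ((abs_dot_le_l1 hHd d).trans
      (mul_le_mul_of_nonneg_left (hcol j) (by positivity)))
  have hl1 : l1 d ^ 2 ≤ (48 / κ * (r * s)) ^ 2 := pow_le_pow_left₀ (l1_nonneg _) (hcol j) 2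
  have h2 := hRSC d
  have h3 : κ * l2 d ^ 2 ≤ 144 / κ * (r ^ 2 * s) := by
    have h4 : γ * l1 d ^ 2 ≤ 72 / κ * (r ^ 2 * s) := by
      calc γ * l1 d ^ 2 ≤ γ * (48 / κ * (r * s)) ^ 2 := mul_le_mul_of_nonneg_left hl1 hγ
        _ = (32 * (γ * s)) * (72 / κ ^ 2 * (r ^ 2 * s)) := by ring
        _ ≤ κ * (72 / κ ^ 2 * (r ^ 2 * s)) := mul_le_mul_of_nonneg_right hγs (by positivity)
        _ = 72 / κ * (r ^ 2 * s) := by field_simp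
    have h5 : 3 / 2 * r * (48 / κ * (r * s)) = 72 / κ * (r ^ 2 * s) := by ring
    have h6 : 144 / κ * (r ^ 2 * s) = 72 / κ * (r ^ 2 * s) + 72 / κ * (r ^ 2 * s) := by ring
    linarith
  refine (sq_le_sq₀ (l2_nonneg _) (by positivity)).1 ?_
  rw [mul_pow, mul_pow, Real.sq_sqrt hs0]
  have : l2 d ^ 2 ≤ 144 / κ * (r ^ 2 * s) / κ := by
    rw [le_div_iff₀ hκ]; linarith
  refine this.trans (le_of_eq ?_)
  field_simp
  norm_num
  ring

end TwoStage

section Existence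

lemma exists_forall_le_of_coercive {E : Type*} [NormedAddCommGroup E] [ProperSpace E] {f : E → ℝ}
    (hf : Continuous f) {S : Set E} (hS : IsClosed S) {x₀ : E} (hx₀ : x₀ ∈ S) {a c : ℝ}
    (ha : 0 < a) (h : ∀ x, a * ‖x‖ - c ≤ f x) : ∃ x ∈ S, ∀ y ∈ S, f x ≤ f y := by
  refine ContinuousOn.exists_isMinOn' hf.continuousOn hS hx₀ ?_
  have ht : Tendsto (fun x : E => a * ‖x‖ - c) (cocompact E) atTop :=
    tendsto_atTop_add_const_right _ _ ((tendsto_norm_cocompact_atTop (E := E)).const_mul_atTop ha)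
  filter_upwards [mem_inf_of_left (ht.eventually_ge_atTop (f x₀))] with x hx
  exact hx.trans (h x)

variable {p : ℕ}

lemma norm_le_entryNorm (G : Fin p → Fin p → ℝ) : ‖G‖ ≤ entryNorm (Matrix.of G) := by
  have h0 : ∀ i, 0 ≤ ∑ j, |G i j| := fun i => Finset.sum_nonneg fun _ _ => abs_nonneg _
  have h1 : 0 ≤ entryNorm (Matrix.of G) := Finset.sum_nonneg fun i _ => h0 i
  refine (pi_norm_le_iff_of_nonneg h1).2 fun i => (pi_norm_le_iff_of_nonneg h1).2 fun j => ?_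
  rw [Real.norm_eq_abs]
  exact (Finset.single_le_sum (f := fun j => |G i j|) (fun _ _ => abs_nonneg _)
    (Finset.mem_univ j)).trans
      (Finset.single_le_sum (f := fun i => ∑ j, |G i j|) (fun i _ => h0 i) (Finset.mem_univ i))

/-- Strict feasibility of some symmetric matrix guarantees that both stages have solutions. -/
theorem exists_isTwoStageOutput [NeZero p] {H M : Matrix (Fin p) (Fin p) ℝ} (hH : H.IsSymm)
    (h0 : ∀ v, 0 ≤ v ⬝ᵥ (H *ᵥ v)) {r : ℝ} (hr : 0 < r) (hM : M.IsSymm)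
    (hHM : ∀ i j, |(H * M - 1) i j| ≤ r / 2) : ∃ M', IsTwoStageOutput H r M' := by
  obtain ⟨G, -, hG⟩ : ∃ G ∈ (Set.univ : Set (Fin p → Fin p → ℝ)), ∀ G₁ ∈ Set.univ,
      stageOneObj H r (Matrix.of G) ≤ stageOneObj H r (Matrix.of G₁) := by
    refine exists_forall_le_of_coercive (f := fun G => stageOneObj H r (Matrix.of G)) ?_
      isClosed_univ (Set.mem_univ 0) (half_pos hr) (c := ∑ j, 1 / 2 *
        ((fun i => M i j) ⬝ᵥ (H *ᵥ fun i => M i j))) fun G => ?_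
    · simp only [stageOneObj_eq_sum, columnObj, l1, dotProduct, Matrix.mulVec, Matrix.of_apply]
      fun_prop
    · rw [stageOneObj_eq_sum]
      have h1 : r / 2 * ‖G‖ ≤ ∑ j, r / 2 * l1 (fun i => G i j) := by
        rw [← Finset.mul_sum]
        refine mul_le_mul_of_nonneg_left ((norm_le_entryNorm G).trans ?_) (half_pos hr).le
        exact le_of_eq Finset.sum_comm
      refine (sub_le_sub_right h1 _).trans ?_
      rw [← Finset.sum_sub_distrib]
      exact Finset.sum_le_sum fun j _ => columnObj_ge hH h0 (abs_mulVec_sub_single_le hHM j) _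
  have hMfeas : M ∈ stageTwoFeasible H r :=
    ⟨hM, (maxNorm_le_iff hr.le).2 fun i j => (hHM i j).trans (by linarith)⟩
  obtain ⟨M', hM', hmin⟩ : ∃ M' ∈ {A : Fin p → Fin p → ℝ | Matrix.of A ∈ stageTwoFeasible H r},
      ∀ M₁ ∈ {A : Fin p → Fin p → ℝ | Matrix.of A ∈ stageTwoFeasible H r},
        colNorm (Matrix.of G - Matrix.of M') ≤ colNorm (Matrix.of G - Matrix.of M₁) := by
    refine exists_forall_le_of_coercive (x₀ := M)
      (f := fun A : Fin p → Fin p → ℝ => colNorm (Matrix.of G - Matrix.of A)) ?_ ?_ hMfeas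
      one_pos (c := ‖G‖) fun A => ?_
    · simp only [colNorm, ← Finset.sup'_univ_eq_ciSup]
      refine Continuous.finset_sup'_apply _ fun j _ => ?_
      simp only [Matrix.sub_apply, Matrix.of_apply]
      fun_prop
    · have e : {A : Fin p → Fin p → ℝ | Matrix.of A ∈ stageTwoFeasible H r} =
          {A | ∀ i j, A i j = A j i} ∩
            {A | ∀ i j, |(∑ k, H i k * A k j) - (1 : Matrix (Fin p) (Fin p) ℝ) i j| ≤ r} := by
        ext A
        simp only [stageTwoFeasible, Set.mem_ofPred_eq, maxNorm_le_iff hr.le, Set.mem_inter_iff]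
        refine and_congr ⟨fun h i j => (h.apply i j).symm, fun h => ?_⟩ Iff.rfl
        ext i j
        exact h j i
      rw [e]
      refine IsClosed.inter ?_ ?_
      · simp only [Set.ofPred_forall]
        exact isClosed_iInter fun i => isClosed_iInter fun j =>
          isClosed_eq (by fun_prop) (by fun_prop)
      · simp only [Set.ofPred_forall]
        exact isClosed_iInter fun i => isClosed_iInter fun j =>
          isClosed_le (by fun_prop) (by fun_prop)
    · have hc : ‖G - A‖ ≤ colNorm (Matrix.of G - Matrix.of A) := by
        have hn : 0 ≤ colNorm (Matrix.of G - Matrix.of A) :=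
          Real.iSup_nonneg fun j => Finset.sum_nonneg fun _ _ => abs_nonneg _
        refine (pi_norm_le_iff_of_nonneg hn).2 fun i => (pi_norm_le_iff_of_nonneg hn).2 fun j => ?_
        refine le_trans ?_ (col_le_colNorm _ j)
        exact Finset.single_le_sum (f := fun i => |(Matrix.of G - Matrix.of A) i j|)
          (fun _ _ => abs_nonneg _) (Finset.mem_univ i)
      have := norm_sub_norm_le A G
      rw [norm_sub_rev] at this
      linarith
  exact ⟨Matrix.of M', Matrix.of G, fun G₁ => hG G₁ (Set.mem_univ _), hM',
    fun M₁ hM₁ => hmin M₁ hM₁⟩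

end Existence

/-! ### Sub-gaussian and sub-exponential functions -/

section Tails

variable {α : Type*} [MeasurableSpace α] {P : Measure α}

/-- `f` is sub-gaussian with scale `K`: `E exp (f² / K²) ≤ 2`. -/
def SubGauss (P : Measure α) (f : α → ℝ) (K : ℝ) : Prop :=
  ∫⁻ x, ENNReal.ofReal (Real.exp (f x ^ 2 / K ^ 2)) ∂P ≤ 2

/-- `f` is sub-exponential with scale `K`: `E exp (|f| / K) ≤ 2`. -/
def SubExp (P : Measure α) (f : α → ℝ) (K : ℝ) : Prop :=
  ∫⁻ x, ENNReal.ofReal (Real.exp (|f x| / K)) ∂P ≤ 2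

lemma SubGauss.mono {f : α → ℝ} {K K' : ℝ} (h : SubGauss P f K) (hK : 0 < K) (hKK : K ≤ K') :
    SubGauss P f K' := by
  refine (lintegral_mono fun x => ?_).trans h
  gcongr

/-- The infimum defining the sub-gaussian norm need not be attained, so the scale is required to
exceed the bound on the norm strictly. -/
lemma SubGauss.of_psi2Norm {f : α → ℝ} {σ K : ℝ} (h : psi2Norm P f ≤ ENNReal.ofReal σ)
    (hK : 0 < K) (hσ : σ < K) : SubGauss P f K := by
  have h1 : psi2Norm P f < ENNReal.ofReal K := h.trans_lt ((ENNReal.ofReal_lt_ofReal_iff hK).2 hσ)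
  simp only [psi2Norm, iInf_lt_iff] at h1
  obtain ⟨t, ⟨ht0, ht⟩, htK⟩ := h1
  exact SubGauss.mono (P := P) ht ht0 ((ENNReal.ofReal_lt_ofReal_iff hK).1 htK).le

lemma SubGauss.const_mul {f : α → ℝ} {K c : ℝ} (h : SubGauss P f K) (hc : c ≠ 0) :
    SubGauss P (fun x => c * f x) (|c| * K) := by
  refine le_trans (le_of_eq (lintegral_congr fun x => ?_)) h
  rw [mul_pow, mul_pow, sq_abs, mul_div_mul_left _ _ (pow_ne_zero 2 hc)]

/-- A combination of sub-gaussian coordinates is sub-gaussian, with scale the `ℓ₁`-norm of the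
coefficients. -/
lemma SubGauss.dot_l1 {p : ℕ} {f : α → Fin p → ℝ} {K : ℝ} (hK : 0 < K)
    (hf : ∀ j, Measurable fun x => f x j) (h : ∀ j, SubGauss P (fun x => f x j) K)
    {u : Fin p → ℝ} (hu : 0 < l1 u) : SubGauss P (fun x => u ⬝ᵥ f x) (K * l1 u) := by
  have hw : ∑ j, |u j| / l1 u = 1 := by rw [← Finset.sum_div]; exact div_self hu.ne'
  have pt : ∀ x, Real.exp ((u ⬝ᵥ f x) ^ 2 / (K * l1 u) ^ 2) ≤
      ∑ j, |u j| / l1 u * Real.exp (f x j ^ 2 / K ^ 2) := fun x => by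
    have hcx := convexOn_exp.map_sum_le (t := Finset.univ) (w := fun j => |u j| / l1 u)
      (p := fun j => f x j ^ 2 / K ^ 2) (fun j _ => div_nonneg (abs_nonneg _) hu.le) hw
      (fun _ _ => Set.mem_univ _)
    refine le_trans (Real.exp_le_exp.2 ?_) (by simpa using hcx)
    have hcs := Finset.sum_mul_sq_le_sq_mul_sq Finset.univ (fun j => Real.sqrt |u j|)
      (fun j => Real.sqrt |u j| * |f x j|)
    simp only [← mul_assoc, Real.mul_self_sqrt (abs_nonneg _), mul_pow,
      Real.sq_sqrt (abs_nonneg _), sq_abs] at hcs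
    have h1 : (u ⬝ᵥ f x) ^ 2 ≤ (∑ j, |u j| * |f x j|) ^ 2 := by
      rw [← sq_abs]
      refine pow_le_pow_left₀ (abs_nonneg _) ?_ 2
      refine (Finset.abs_sum_le_sum_abs (fun j => u j * f x j) Finset.univ).trans (le_of_eq ?_)
      simp only [abs_mul]
    have h2 : (u ⬝ᵥ f x) ^ 2 ≤ l1 u * ∑ j, |u j| * f x j ^ 2 := h1.trans hcs
    rw [div_le_iff₀ (by positivity)]
    refine h2.trans (le_of_eq ?_)
    simp only [Finset.sum_mul, Finset.mul_sum]
    refine Finset.sum_congr rfl fun j _ => ?_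
    field_simp
  calc ∫⁻ x, ENNReal.ofReal (Real.exp ((u ⬝ᵥ f x) ^ 2 / (K * l1 u) ^ 2)) ∂P
      ≤ ∫⁻ x, ∑ j, ENNReal.ofReal (|u j| / l1 u) *
          ENNReal.ofReal (Real.exp (f x j ^ 2 / K ^ 2)) ∂P := by
        refine lintegral_mono fun x => (ENNReal.ofReal_le_ofReal (pt x)).trans (le_of_eq ?_)
        rw [ENNReal.ofReal_sum_of_nonneg fun j _ => by positivity]
        exact Finset.sum_congr rfl fun j _ => ENNReal.ofReal_mul (by positivity)
    _ = ∑ j, ENNReal.ofReal (|u j| / l1 u) *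
          ∫⁻ x, ENNReal.ofReal (Real.exp (f x j ^ 2 / K ^ 2)) ∂P := by
        have hm : ∀ j, Measurable fun x => ENNReal.ofReal (Real.exp (f x j ^ 2 / K ^ 2)) :=
          fun j => (((hf j).pow_const 2).div_const _).exp.ennreal_ofReal
        rw [lintegral_finsetSum _ fun j _ => (hm j).const_mul _]
        exact Finset.sum_congr rfl fun j _ => lintegral_const_mul _ (hm j)
    _ ≤ ∑ j, ENNReal.ofReal (|u j| / l1 u) * 2 :=
        Finset.sum_le_sum fun j _ => mul_le_mul_right (h j) _
    _ = 2 := by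
        rw [← Finset.sum_mul, ← ENNReal.ofReal_sum_of_nonneg fun j _ => by positivity, hw]
        simp

lemma SubGauss.mul_subExp {f g : α → ℝ} {K K' : ℝ} (hf : SubGauss P f K) (hg : SubGauss P g K')
    (hK : 0 < K) (hK' : 0 < K') (mf : Measurable f) :
    SubExp P (fun x => f x * g x) (K * K') := by
  have pt : ∀ x, Real.exp (|f x * g x| / (K * K')) ≤
      1 / 2 * Real.exp (f x ^ 2 / K ^ 2) + 1 / 2 * Real.exp (g x ^ 2 / K' ^ 2) := fun x => by
    have hcx := convexOn_exp.2 (Set.mem_univ (f x ^ 2 / K ^ 2)) (Set.mem_univ (g x ^ 2 / K' ^ 2))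
      (by norm_num : (0 : ℝ) ≤ 1 / 2) (by norm_num : (0 : ℝ) ≤ 1 / 2) (by norm_num)
    refine le_trans (Real.exp_le_exp.2 ?_) hcx
    have e : |f x * g x| / (K * K') = (|f x| / K) * (|g x| / K') := by rw [abs_mul]; field_simp
    rw [e, ← div_pow, ← div_pow, ← sq_abs (f x / K), ← sq_abs (g x / K'), abs_div, abs_div,
      abs_of_pos hK, abs_of_pos hK', smul_eq_mul, smul_eq_mul]
    nlinarith [sq_nonneg (|f x| / K - |g x| / K')]
  calc ∫⁻ x, ENNReal.ofReal (Real.exp (|f x * g x| / (K * K'))) ∂P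
      ≤ ∫⁻ x, (ENNReal.ofReal (1 / 2) * ENNReal.ofReal (Real.exp (f x ^ 2 / K ^ 2)) +
        ENNReal.ofReal (1 / 2) * ENNReal.ofReal (Real.exp (g x ^ 2 / K' ^ 2))) ∂P := by
        refine lintegral_mono fun x => (ENNReal.ofReal_le_ofReal (pt x)).trans (le_of_eq ?_)
        rw [ENNReal.ofReal_add (by positivity) (by positivity), ENNReal.ofReal_mul (by norm_num),
          ENNReal.ofReal_mul (by norm_num)]
    _ = ENNReal.ofReal (1 / 2) * ∫⁻ x, ENNReal.ofReal (Real.exp (f x ^ 2 / K ^ 2)) ∂P +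
        ENNReal.ofReal (1 / 2) * ∫⁻ x, ENNReal.ofReal (Real.exp (g x ^ 2 / K' ^ 2)) ∂P := by
        have hm : Measurable fun x => ENNReal.ofReal (Real.exp (f x ^ 2 / K ^ 2)) :=
          ((mf.pow_const 2).div_const _).exp.ennreal_ofReal
        rw [lintegral_add_left (hm.const_mul _), lintegral_const_mul _ hm,
          lintegral_const_mul' _ _ ENNReal.ofReal_ne_top]
    _ ≤ ENNReal.ofReal (1 / 2) * 2 + ENNReal.ofReal (1 / 2) * 2 :=
        add_le_add (mul_le_mul_right hf _) (mul_le_mul_right hg _)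
    _ = 2 := by
        rw [← add_mul, ← ENNReal.ofReal_add (by norm_num) (by norm_num)]
        norm_num

lemma SubExp.of_abs_le {f g : α → ℝ} {K C : ℝ} (h : SubExp P f K) (hK : 0 < K) (hC : 0 < C)
    (hg : ∀ᵐ x ∂P, |g x| ≤ C * |f x|) : SubExp P g (C * K) := by
  refine (lintegral_mono_ae ?_).trans h
  filter_upwards [hg] with x hx
  refine ENNReal.ofReal_le_ofReal (Real.exp_le_exp.2 ?_)
  rw [div_le_div_iff₀ (by positivity) hK]
  nlinarith

lemma integrable_of_lintegral_le {g : α → ℝ} (mg : Measurable g) (h0 : ∀ x, 0 ≤ g x)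
    (h : ∫⁻ x, ENNReal.ofReal (g x) ∂P ≤ 2) : Integrable g P ∧ ∫ x, g x ∂P ≤ 2 := by
  have hi : Integrable g P := by
    refine ⟨mg.aestronglyMeasurable, ?_⟩
    rw [hasFiniteIntegral_iff_ofReal (Eventually.of_forall h0)]
    exact h.trans_lt (by norm_num)
  refine ⟨hi, ?_⟩
  rw [integral_eq_lintegral_of_nonneg_ae (Eventually.of_forall h0) mg.aestronglyMeasurable]
  exact ENNReal.toReal_le_of_le_ofReal (by norm_num) (by simpa using h)

lemma SubGauss.exp_integrable {f : α → ℝ} {K : ℝ} (h : SubGauss P f K) (mf : Measurable f) :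
    Integrable (fun x => Real.exp (f x ^ 2 / K ^ 2)) P ∧
      ∫ x, Real.exp (f x ^ 2 / K ^ 2) ∂P ≤ 2 :=
  integrable_of_lintegral_le ((mf.pow_const 2).div_const _).exp (fun _ => (Real.exp_pos _).le) h

lemma SubExp.exp_integrable {f : α → ℝ} {K : ℝ} (h : SubExp P f K) (mf : Measurable f) :
    Integrable (fun x => Real.exp (|f x| / K)) P ∧ ∫ x, Real.exp (|f x| / K) ∂P ≤ 2 :=
  integrable_of_lintegral_le (mf.abs.div_const _).exp (fun _ => (Real.exp_pos _).le) h

lemma SubExp.integrable {f : α → ℝ} {K : ℝ} (h : SubExp P f K) (mf : Measurable f) (hK : 0 < K) :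
    Integrable f P := by
  refine ((h.exp_integrable mf).1.const_mul K).mono' mf.aestronglyMeasurable
    (Eventually.of_forall fun x => ?_)
  have := Real.add_one_le_exp (|f x| / K)
  rw [Real.norm_eq_abs]
  calc |f x| = K * (|f x| / K) := by field_simp
    _ ≤ K * Real.exp (|f x| / K) := mul_le_mul_of_nonneg_left (by linarith) hK.le

lemma pow_le_factorial_mul_exp {x : ℝ} (hx : 0 ≤ x) (k : ℕ) :
    x ^ k ≤ k.factorial * Real.exp x := by
  have := Real.pow_div_factorial_le_exp x hx k
  rwa [div_le_iff₀ (by positivity), mul_comm] at this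

/-- Even moments of products of two sub-gaussian functions. -/
lemma SubGauss.integral_mul_pow_le {f g : α → ℝ} {K K' : ℝ} (hf : SubGauss P f K)
    (hg : SubGauss P g K') (hK : 0 < K) (hK' : 0 < K') (mf : Measurable f) (mg : Measurable g)
    (k : ℕ) : Integrable (fun x => (f x ^ 2) ^ k * (g x ^ 2) ^ k) P ∧
      ∫ x, (f x ^ 2) ^ k * (g x ^ 2) ^ k ∂P ≤
        2 * (2 * k).factorial * ((K ^ 2) ^ k * (K' ^ 2) ^ k) := by
  have pt : ∀ x, (f x ^ 2) ^ k * (g x ^ 2) ^ k ≤ (K ^ 2) ^ k * (K' ^ 2) ^ k *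
      ((2 * k).factorial * (1 / 2 * Real.exp (f x ^ 2 / K ^ 2) +
        1 / 2 * Real.exp (g x ^ 2 / K' ^ 2))) := fun x => by
    have h1 := pow_le_factorial_mul_exp (x := f x ^ 2 / K ^ 2) (by positivity) (2 * k)
    have h2 := pow_le_factorial_mul_exp (x := g x ^ 2 / K' ^ 2) (by positivity) (2 * k)
    have e : (f x ^ 2) ^ k * (g x ^ 2) ^ k = (K ^ 2) ^ k * (K' ^ 2) ^ k *
        ((f x ^ 2 / K ^ 2) ^ k * (g x ^ 2 / K' ^ 2) ^ k) := by
      rw [div_pow, div_pow]; field_simp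
    rw [e]
    refine mul_le_mul_of_nonneg_left ?_ (by positivity)
    rw [mul_comm 2 k, pow_mul] at h1 h2
    rw [mul_comm 2 k]
    nlinarith [sq_nonneg ((f x ^ 2 / K ^ 2) ^ k - (g x ^ 2 / K' ^ 2) ^ k)]
  have hi := (((hf.exp_integrable mf).1.const_mul (1 / 2)).add
    ((hg.exp_integrable mg).1.const_mul (1 / 2))).const_mul ((2 * k).factorial : ℝ)
      |>.const_mul ((K ^ 2) ^ k * (K' ^ 2) ^ k)
  have hI : Integrable (fun x => (f x ^ 2) ^ k * (g x ^ 2) ^ k) P := by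
    refine hi.mono' (by fun_prop) (Eventually.of_forall fun x => ?_)
    rw [Real.norm_eq_abs, abs_of_nonneg (by positivity)]
    exact pt x
  refine ⟨hI, (integral_mono hI hi pt).trans ?_⟩
  rw [integral_const_mul, integral_const_mul]
  have e : ∫ x, ((fun x => 1 / 2 * Real.exp (f x ^ 2 / K ^ 2)) +
      fun x => 1 / 2 * Real.exp (g x ^ 2 / K' ^ 2)) x ∂P ≤ 2 := by
    rw [integral_add' ((hf.exp_integrable mf).1.const_mul (1 / 2))
      ((hg.exp_integrable mg).1.const_mul (1 / 2)), integral_const_mul, integral_const_mul]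
    linarith [(hf.exp_integrable mf).2, (hg.exp_integrable mg).2]
  calc (K ^ 2) ^ k * (K' ^ 2) ^ k * ((2 * k).factorial * _)
      ≤ (K ^ 2) ^ k * (K' ^ 2) ^ k * ((2 * k).factorial * 2) := by gcongr
    _ = _ := by ring

lemma SubGauss.integral_pow_le {f : α → ℝ} {K : ℝ} (hf : SubGauss P f K) (hK : 0 < K)
    (mf : Measurable f) (k : ℕ) : Integrable (fun x => (f x ^ 2) ^ k) P ∧
      ∫ x, (f x ^ 2) ^ k ∂P ≤ 2 * k.factorial * (K ^ 2) ^ k := by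
  have pt : ∀ x, (f x ^ 2) ^ k ≤ (K ^ 2) ^ k * (k.factorial * Real.exp (f x ^ 2 / K ^ 2)) :=
    fun x => by
      have h1 := pow_le_factorial_mul_exp (x := f x ^ 2 / K ^ 2) (by positivity) k
      rw [div_pow, div_le_iff₀ (by positivity)] at h1
      linarith
  have hi := ((hf.exp_integrable mf).1.const_mul (k.factorial : ℝ)).const_mul ((K ^ 2) ^ k)
  have hI : Integrable (fun x => (f x ^ 2) ^ k) P := by
    refine hi.mono' (by fun_prop) (Eventually.of_forall fun x => ?_)
    rw [Real.norm_eq_abs, abs_of_nonneg (by positivity)]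
    exact pt x
  refine ⟨hI, (integral_mono hI hi pt).trans ?_⟩
  rw [integral_const_mul, integral_const_mul]
  calc (K ^ 2) ^ k * (k.factorial * _) ≤ (K ^ 2) ^ k * (k.factorial * 2) := by
        gcongr; exact (hf.exp_integrable mf).2
    _ = _ := by ring

lemma exp_le_quadratic (y : ℝ) : Real.exp y ≤ 1 + y + y ^ 2 * Real.exp |y| := by
  have h := Complex.norm_exp_sub_sum_le_norm_mul_exp y 2
  simp only [Finset.sum_range_succ, Finset.sum_range_zero, pow_zero, Nat.factorial, Nat.cast_one,
    pow_one, zero_add, div_one, Complex.norm_real, Real.norm_eq_abs, sq_abs, mul_one] at h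
  have e : Complex.exp y - (1 + y) = ((Real.exp y - (1 + y) : ℝ) : ℂ) := by push_cast; rfl
  rw [e, Complex.norm_real, Real.norm_eq_abs] at h
  linarith [le_abs_self (Real.exp y - (1 + y))]

/-- The moment generating function of a centered sub-exponential function near the origin. -/
lemma SubExp.mgf_le [IsProbabilityMeasure P] {f : α → ℝ} {K θ : ℝ} (h : SubExp P f K)
    (mf : Measurable f) (hK : 0 < K) (hθ : |θ| * K ≤ 1 / 2) :
    ∫⁻ x, ENNReal.ofReal (Real.exp (θ * (f x - ∫ y, f y ∂P))) ∂P ≤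
      ENNReal.ofReal (Real.exp (16 * θ ^ 2 * K ^ 2)) := by
  obtain ⟨hi, h2⟩ := h.exp_integrable mf
  have hfi := h.integrable mf hK
  set m := ∫ y, f y ∂P with hm
  have pt : ∀ x, Real.exp (θ * f x) ≤
      1 + θ * f x + 8 * θ ^ 2 * K ^ 2 * Real.exp (|f x| / K) := fun x => by
    refine (exp_le_quadratic _).trans ?_
    set y := |f x| / K with hy
    have hy0 : 0 ≤ y := by positivity
    have hfy : |f x| = K * y := by rw [hy]; field_simp
    have e1 : |θ * f x| ≤ y / 2 := by
      rw [abs_mul, hfy]; nlinarith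
    have e2 : (θ * f x) ^ 2 = θ ^ 2 * K ^ 2 * y ^ 2 := by
      rw [mul_pow, ← sq_abs (f x), hfy]; ring
    have e3 : y ^ 2 ≤ 8 * Real.exp (y / 2) := by
      have := pow_le_factorial_mul_exp (x := y / 2) (by positivity) 2
      norm_num [Nat.factorial] at this
      nlinarith
    have e4 : Real.exp |θ * f x| ≤ Real.exp (y / 2) := Real.exp_le_exp.2 e1
    have e5 : Real.exp (y / 2) * Real.exp (y / 2) = Real.exp y := by rw [← Real.exp_add]; ring_nf
    have e6 : y ^ 2 * Real.exp |θ * f x| ≤ 8 * Real.exp y := by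
      rw [← e5, ← mul_assoc]
      exact mul_le_mul e3 e4 (Real.exp_pos _).le (by positivity)
    rw [e2]
    nlinarith [mul_le_mul_of_nonneg_left e6 (by positivity : 0 ≤ θ ^ 2 * K ^ 2)]
  have hdi : Integrable (fun x => 1 + θ * f x + 8 * θ ^ 2 * K ^ 2 * Real.exp (|f x| / K)) P :=
    ((integrable_const 1).add (hfi.const_mul θ)).add (hi.const_mul _)
  have hei : Integrable (fun x => Real.exp (θ * f x)) P := by
    refine hdi.mono' (by fun_prop) (Eventually.of_forall fun x => ?_)
    rw [Real.norm_eq_abs, abs_of_pos (Real.exp_pos _)]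
    exact pt x
  have hE : ∫ x, Real.exp (θ * f x) ∂P ≤ Real.exp (θ * m + 16 * θ ^ 2 * K ^ 2) := by
    refine (integral_mono hei hdi pt).trans ?_
    have hadd : Integrable (fun x => 1 + θ * f x) P := (integrable_const 1).add (hfi.const_mul θ)
    rw [integral_add hadd (hi.const_mul _), integral_add (integrable_const 1) (hfi.const_mul θ), integral_const_mul, integral_const_mul]
    simp only [integral_const, probReal_univ, one_smul]
    have := Real.add_one_le_exp (θ * m + 16 * θ ^ 2 * K ^ 2)
    nlinarith [mul_le_mul_of_nonneg_left h2 (by positivity : 0 ≤ 8 * θ ^ 2 * K ^ 2)]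
  have e : ∀ x, Real.exp (θ * (f x - m)) = Real.exp (-(θ * m)) * Real.exp (θ * f x) := fun x => by
    rw [← Real.exp_add]; ring_nf
  simp only [e]
  rw [← ofReal_integral_eq_lintegral_ofReal (hei.const_mul _)
    (Eventually.of_forall fun x => by positivity), integral_const_mul]
  refine ENNReal.ofReal_le_ofReal ?_
  calc Real.exp (-(θ * m)) * ∫ x, Real.exp (θ * f x) ∂P
      ≤ Real.exp (-(θ * m)) * Real.exp (θ * m + 16 * θ ^ 2 * K ^ 2) := by gcongr
    _ = Real.exp (16 * θ ^ 2 * K ^ 2) := by rw [← Real.exp_add]; ring_nf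

/-- The moment generating function of a truncated fourth power, in the range where the exponent
stays below `f² / (2 K²)`. -/
lemma SubGauss.mgf_trunc_pow_four_le [IsProbabilityMeasure P] {f : α → ℝ} {K θ : ℝ}
    (h : SubGauss P f K) (mf : Measurable f) (hK : 0 < K) (hθ : 0 < θ) (hθ1 : θ ≤ 1) :
    ∫⁻ x, ENNReal.ofReal (Real.exp (θ * if f x ^ 2 / K ^ 2 ≤ 1 / (2 * θ)
      then (f x ^ 2 / K ^ 2) ^ 2 else 0)) ∂P ≤ ENNReal.ofReal (Real.exp (772 * θ)) := by
  obtain ⟨hi, h2⟩ := h.exp_integrable mf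
  set y : α → ℝ := fun x => f x ^ 2 / K ^ 2 with hy
  have pt : ∀ x, Real.exp (θ * if y x ≤ 1 / (2 * θ) then y x ^ 2 else 0) ≤
      1 + (2 * θ + 384 * θ ^ 2) * Real.exp (y x) := fun x => by
    have hy0 : 0 ≤ y x := by positivity
    split_ifs with hle
    · refine (exp_le_quadratic _).trans ?_
      rw [abs_of_nonneg (by positivity)]
      have e1 : θ * y x ^ 2 ≤ y x / 2 := by
        rw [le_div_iff₀ (by positivity)] at hle
        nlinarith
      have e2 := pow_le_factorial_mul_exp (x := y x) hy0 2
      have e3 := pow_le_factorial_mul_exp (x := y x / 2) (by positivity) 4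
      norm_num [Nat.factorial] at e2 e3
      have e4 : Real.exp (θ * y x ^ 2) ≤ Real.exp (y x / 2) := Real.exp_le_exp.2 e1
      have e5 : Real.exp (y x / 2) * Real.exp (y x / 2) = Real.exp (y x) := by
        rw [← Real.exp_add]; ring_nf
      have e6 : y x ^ 4 * Real.exp (θ * y x ^ 2) ≤ 384 * Real.exp (y x) := by
        rw [← e5, ← mul_assoc]
        exact mul_le_mul (by nlinarith) e4 (Real.exp_pos _).le (by positivity)
      nlinarith [mul_le_mul_of_nonneg_left e6 (by positivity : 0 ≤ θ ^ 2),
        mul_le_mul_of_nonneg_left e2 hθ.le]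
    · simp only [mul_zero, Real.exp_zero]
      have : 0 ≤ (2 * θ + 384 * θ ^ 2) * Real.exp (y x) := by positivity
      linarith
  have hdi : Integrable (fun x => 1 + (2 * θ + 384 * θ ^ 2) * Real.exp (y x)) P :=
    (integrable_const 1).add (hi.const_mul _)
  calc ∫⁻ x, ENNReal.ofReal (Real.exp (θ * if y x ≤ 1 / (2 * θ) then y x ^ 2 else 0)) ∂P
      ≤ ∫⁻ x, ENNReal.ofReal (1 + (2 * θ + 384 * θ ^ 2) * Real.exp (y x)) ∂P :=
        lintegral_mono fun x => ENNReal.ofReal_le_ofReal (pt x)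
    _ = ENNReal.ofReal (∫ x, 1 + (2 * θ + 384 * θ ^ 2) * Real.exp (y x) ∂P) :=
        (ofReal_integral_eq_lintegral_ofReal hdi
          (Eventually.of_forall fun x => by positivity)).symm
    _ ≤ ENNReal.ofReal (Real.exp (772 * θ)) := by
        refine ENNReal.ofReal_le_ofReal ?_
        rw [integral_add (integrable_const 1) (hi.const_mul _), integral_const_mul]
        simp only [integral_const, probReal_univ, one_smul]
        have := Real.add_one_le_exp (772 * θ)
        nlinarith [mul_le_mul_of_nonneg_left h2 (by positivity : 0 ≤ 2 * θ + 384 * θ ^ 2)]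

/-- The Laplace transform of a nonnegative function, bounded through its first two moments. -/
lemma laplace_le [IsProbabilityMeasure P] {f : α → ℝ} {θ a b : ℝ}
    (h0 : ∀ᵐ x ∂P, 0 ≤ f x) (hθ : 0 ≤ θ) (hi : Integrable f P)
    (hi2 : Integrable (fun x => f x ^ 2) P)
    (ha : a ≤ ∫ x, f x ∂P) (hb : ∫ x, f x ^ 2 ∂P ≤ b) :
    ∫⁻ x, ENNReal.ofReal (Real.exp (-(θ * f x))) ∂P ≤
      ENNReal.ofReal (Real.exp (-(θ * a) + θ ^ 2 / 2 * b)) := by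
  have pt : ∀ᵐ x ∂P, Real.exp (-(θ * f x)) ≤ 1 + -θ * f x + θ ^ 2 / 2 * f x ^ 2 := by
    filter_upwards [h0] with x hx
    have := Real.quadratic_le_exp_of_nonneg (x := θ * f x) (by positivity)
    rw [Real.exp_neg, inv_le_comm₀ (Real.exp_pos _) (by nlinarith [sq_nonneg (θ * f x - 1)])]
    refine le_trans ?_ this
    rw [inv_le_iff_one_le_mul₀ (by nlinarith [sq_nonneg (θ * f x - 1)])]
    nlinarith [sq_nonneg (θ * f x), sq_nonneg ((θ * f x) ^ 2)]
  have hdi : Integrable (fun x => 1 + -θ * f x + θ ^ 2 / 2 * f x ^ 2) P :=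
    ((integrable_const 1).add (hi.const_mul _)).add (hi2.const_mul _)
  have hd0 : 0 ≤ᵐ[P] fun x => 1 + -θ * f x + θ ^ 2 / 2 * f x ^ 2 := by
    filter_upwards [pt] with x hx using (Real.exp_pos _).le.trans hx
  refine (lintegral_mono_ae (pt.mono fun x hx => ENNReal.ofReal_le_ofReal hx)).trans ?_
  rw [← ofReal_integral_eq_lintegral_ofReal hdi hd0]
  refine ENNReal.ofReal_le_ofReal ?_
  have hadd : Integrable (fun x => 1 + -θ * f x) P := (integrable_const 1).add (hi.const_mul _)
  rw [integral_add hadd (hi2.const_mul _), integral_add (integrable_const 1) (hi.const_mul _), integral_const_mul, integral_const_mul]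
  simp only [integral_const, probReal_univ, one_smul]
  have := Real.add_one_le_exp (-(θ * a) + θ ^ 2 / 2 * b)
  nlinarith [mul_le_mul_of_nonneg_left ha hθ,
    mul_le_mul_of_nonneg_left hb (by positivity : 0 ≤ θ ^ 2 / 2)]

end Tails

/-! ### Concentration for independent observations -/

section Concentration

variable {n p : ℕ} {Ω : Type*} [MeasurableSpace Ω] {μ : Measure Ω} {P : Measure (Obs p)}
  {Z : Fin n → Ω → Obs p}

lemma IsSample.lintegral_comp (hS : IsSample μ P Z) (i : Fin n) {f : Obs p → ℝ≥0∞}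
    (hf : Measurable f) : ∫⁻ ω, f (Z i ω) ∂μ = ∫⁻ z, f z ∂P := by
  rw [← hS.law i, lintegral_map hf (hS.measurable i)]

lemma IsSample.ae_all (hS : IsSample μ P Z) {q : Obs p → Prop} (h : ∀ᵐ z ∂P, q z) :
    ∀ᵐ ω ∂μ, ∀ i, q (Z i ω) := by
  refine ae_all_iff.2 fun i => ?_
  rw [← hS.law i] at h
  exact ae_of_ae_map (hS.measurable i).aemeasurable h

/-- Chernoff's bound. -/
lemma IsSample.chernoff (hS : IsSample μ P Z) (A : Finset (Fin n)) {f : Obs p → ℝ}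
    (hf : Measurable f) {b : ℝ}
    (hb : ∫⁻ z, ENNReal.ofReal (Real.exp (f z)) ∂P ≤ ENNReal.ofReal (Real.exp b)) (s : ℝ) :
    μ {ω | s ≤ ∑ i ∈ A, f (Z i ω)} ≤ ENNReal.ofReal (Real.exp (A.card * b - s)) := by
  have hm : Measurable fun z : Obs p => ENNReal.ofReal (Real.exp (f z)) := hf.exp.ennreal_ofReal
  have hprod : ∫⁻ ω, ∏ i ∈ A, ENNReal.ofReal (Real.exp (f (Z i ω))) ∂μ ≤
      ENNReal.ofReal (Real.exp b) ^ A.card := by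
    rw [lintegral_prod_eq_prod_lintegral_of_indepFun A
      (fun i ω => ENNReal.ofReal (Real.exp (f (Z i ω))))
      (hS.indep.comp (fun _ z => ENNReal.ofReal (Real.exp (f z))) fun _ => hm)
      fun i => hm.comp (hS.measurable i)]
    refine Finset.prod_le_pow_card _ _ _ fun i _ => ?_
    exact (le_of_eq (hS.lintegral_comp i hm)).trans hb
  have hmk := mul_meas_ge_le_lintegral₀ (μ := μ)
    (f := fun ω => ∏ i ∈ A, ENNReal.ofReal (Real.exp (f (Z i ω))))
    (Finset.aemeasurable_fun_prod _ fun i _ => (hm.comp (hS.measurable i)).aemeasurable)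
    (ENNReal.ofReal (Real.exp s))
  have hsub : {ω | s ≤ ∑ i ∈ A, f (Z i ω)} ⊆ {ω | ENNReal.ofReal (Real.exp s) ≤
      ∏ i ∈ A, ENNReal.ofReal (Real.exp (f (Z i ω)))} := fun ω hω => by
    rw [Set.mem_ofPred_eq] at hω ⊢
    rw [← ENNReal.ofReal_prod_of_nonneg fun _ _ => (Real.exp_pos _).le, ← Real.exp_sum]
    exact ENNReal.ofReal_le_ofReal (Real.exp_le_exp.2 hω)
  have h1 : ENNReal.ofReal (Real.exp s) * μ {ω | s ≤ ∑ i ∈ A, f (Z i ω)} ≤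
      ENNReal.ofReal (Real.exp b) ^ A.card :=
    (mul_le_mul_right (measure_mono hsub) _).trans (hmk.trans hprod)
  have h2 : ENNReal.ofReal (Real.exp (-s)) * ENNReal.ofReal (Real.exp s) = 1 := by
    rw [← ENNReal.ofReal_mul (Real.exp_pos _).le, ← Real.exp_add]; simp
  calc μ {ω | s ≤ ∑ i ∈ A, f (Z i ω)}
      = ENNReal.ofReal (Real.exp (-s)) *
          (ENNReal.ofReal (Real.exp s) * μ {ω | s ≤ ∑ i ∈ A, f (Z i ω)}) := by
        rw [← mul_assoc, h2, one_mul]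
    _ ≤ ENNReal.ofReal (Real.exp (-s)) * ENNReal.ofReal (Real.exp b) ^ A.card :=
        mul_le_mul_right h1 _
    _ = _ := by
        rw [← ENNReal.ofReal_pow (Real.exp_pos _).le, ← ENNReal.ofReal_mul (Real.exp_pos _).le,
          ← Real.exp_nat_mul, ← Real.exp_add]
        ring_nf

/-- Bernstein's inequality in the sub-gaussian range. -/
lemma IsSample.bernstein [IsProbabilityMeasure P] (hS : IsSample μ P Z) (A : Finset (Fin n))
    {f : Obs p → ℝ} (hf : Measurable f) {K x : ℝ} (hK : 0 < K) (h : SubExp P f K) (hx0 : 0 ≤ x)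
    (hx : x ≤ 16) :
    μ {ω | A.card * (K * x) ≤ |∑ i ∈ A, f (Z i ω) - A.card * ∫ z, f z ∂P|} ≤
      ENNReal.ofReal (2 * Real.exp (-(A.card * x ^ 2 / 64))) := by
  set m := ∫ z, f z ∂P
  have side : ∀ ε : ℝ, |ε| = 1 →
      μ {ω | A.card * (K * x) ≤ ε * (∑ i ∈ A, f (Z i ω) - A.card * m)} ≤
        ENNReal.ofReal (Real.exp (-(A.card * x ^ 2 / 64))) := fun ε hε => by
    set θ := x / (32 * K) with hθ
    have hθ0 : 0 ≤ θ := by positivity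
    have hb := h.mgf_le hf hK (θ := ε * θ) (by
      rw [abs_mul, hε, one_mul, abs_of_nonneg hθ0, hθ]
      field_simp
      linarith)
    have hc := hS.chernoff A (f := fun z => ε * θ * (f z - m)) (by fun_prop) hb
      (θ * (A.card * (K * x)))
    refine (measure_mono fun ω hω => ?_).trans (hc.trans (ENNReal.ofReal_le_ofReal ?_))
    · rw [Set.mem_ofPred_eq] at hω ⊢
      rw [← Finset.mul_sum, Finset.sum_sub_distrib, Finset.sum_const, nsmul_eq_mul, mul_comm ε θ,
        mul_assoc]
      exact mul_le_mul_of_nonneg_left hω hθ0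
    · refine Real.exp_le_exp.2 (le_of_eq ?_)
      have : ε ^ 2 = 1 := by rw [← sq_abs, hε, one_pow]
      rw [mul_pow, this, hθ]
      field_simp
      ring
  have hsub : {ω | A.card * (K * x) ≤ |∑ i ∈ A, f (Z i ω) - A.card * m|} ⊆
      {ω | A.card * (K * x) ≤ 1 * (∑ i ∈ A, f (Z i ω) - A.card * m)} ∪
      {ω | A.card * (K * x) ≤ -1 * (∑ i ∈ A, f (Z i ω) - A.card * m)} := fun ω hω => by
    rw [Set.mem_ofPred_eq] at hω
    rcases le_abs.1 hω with h | h
    · left; simpa using h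
    · right; simpa using h
  refine (measure_mono hsub).trans ((measure_union_le _ _).trans ?_)
  refine (add_le_add (side 1 (by simp)) (side (-1) (by simp))).trans (le_of_eq ?_)
  rw [← ENNReal.ofReal_add (Real.exp_pos _).le (Real.exp_pos _).le, two_mul]

/-- Union bound over a finite family with a common bound. -/
lemma measure_exists_le {ι : Type*} [Fintype ι] {q : ι → Ω → Prop} {c : ℝ}
    (h : ∀ i, μ {ω | q i ω} ≤ ENNReal.ofReal c) :
    μ {ω | ∃ i, q i ω} ≤ ENNReal.ofReal (Fintype.card ι * c) := by
  have e : {ω | ∃ i, q i ω} = ⋃ i, {ω | q i ω} := by ext; simp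
  rw [e]
  refine (measure_iUnion_fintype_le μ _).trans ((Finset.sum_le_sum fun i _ => h i).trans ?_)
  rw [Finset.sum_const, nsmul_eq_mul, ENNReal.ofReal_mul (Nat.cast_nonneg _),
    ENNReal.ofReal_natCast]
  rfl

/-- Chebyshev's inequality. -/
lemma IsSample.chebyshev [IsProbabilityMeasure μ] [IsProbabilityMeasure P] (hS : IsSample μ P Z)
    (A : Finset (Fin n)) {f : Obs p → ℝ} (hf : Measurable f)
    (hi : Integrable (fun z => f z ^ 2) P) {t : ℝ} (ht : 0 < t) :
    μ {ω | t ≤ |∑ i ∈ A, f (Z i ω) - A.card * ∫ z, f z ∂P|} ≤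
      ENNReal.ofReal (A.card * (∫ z, f z ^ 2 ∂P) / t ^ 2) := by
  have hL : MemLp f 2 P := (memLp_two_iff_integrable_sq hf.aestronglyMeasurable).2 hi
  have hLi : ∀ i, MemLp (fun ω => f (Z i ω)) 2 μ := fun i => by
    have : MemLp f 2 (μ.map (Z i)) := by rwa [hS.law i]
    exact this.comp_of_map (hS.measurable i).aemeasurable
  have hE : ∀ i, ∫ ω, f (Z i ω) ∂μ = ∫ z, f z ∂P := fun i => by
    rw [← hS.law i, integral_map (hS.measurable i).aemeasurable hf.aestronglyMeasurable]
  have hV : ∀ i, Var[fun ω => f (Z i ω); μ] ≤ ∫ z, f z ^ 2 ∂P := fun i => by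
    refine (variance_le_expectation_sq (hLi i).aestronglyMeasurable).trans (le_of_eq ?_)
    rw [← hS.law i, integral_map (hS.measurable i).aemeasurable (by fun_prop)]
    rfl
  have hsum : MemLp (fun ω => ∑ i ∈ A, f (Z i ω)) 2 μ := memLp_finsetSum A fun i _ => hLi i
  have hEs : ∫ ω, ∑ i ∈ A, f (Z i ω) ∂μ = A.card * ∫ z, f z ∂P := by
    rw [integral_finsetSum A fun i _ => (hLi i).integrable (by norm_num)]
    simp [hE]
  have hVs : Var[fun ω => ∑ i ∈ A, f (Z i ω); μ] ≤ A.card * ∫ z, f z ^ 2 ∂P := by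
    have := IndepFun.variance_sum (s := A) (X := fun i ω => f (Z i ω)) (fun i _ => hLi i)
      (fun i _ j _ hij => (hS.indep.indepFun hij).comp hf hf)
    have e : (∑ i ∈ A, fun ω => f (Z i ω)) = fun ω => ∑ i ∈ A, f (Z i ω) := by
      ext ω; simp
    rw [e] at this
    rw [this]
    refine (Finset.sum_le_sum fun i _ => hV i).trans ?_
    simp
  have h := meas_ge_le_variance_div_sq hsum ht
  rw [hEs] at h
  exact h.trans (ENNReal.ofReal_le_ofReal (by gcongr))

/-- Markov's inequality for a sum of nonnegative functions of the observations. -/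
lemma IsSample.markov (hS : IsSample μ P Z) (A : Finset (Fin n))
    {f : Obs p → ℝ} (hf : Measurable f) (h0 : ∀ z, 0 ≤ f z) (hi : Integrable f P) {t : ℝ}
    (ht : 0 < t) :
    μ {ω | t ≤ ∑ i ∈ A, f (Z i ω)} ≤ ENNReal.ofReal (A.card * (∫ z, f z ∂P) / t) := by
  have hm : ∀ i, Measurable fun ω => ENNReal.ofReal (f (Z i ω)) := fun i =>
    (hf.comp (hS.measurable i)).ennreal_ofReal
  have hmk := meas_ge_le_lintegral_div (μ := μ)
    (f := fun ω => ∑ i ∈ A, ENNReal.ofReal (f (Z i ω)))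
    (Finset.aemeasurable_fun_sum _ fun i _ => (hm i).aemeasurable)
    (ε := ENNReal.ofReal t) (by simpa using ht) ENNReal.ofReal_ne_top
  have hsub : {ω | t ≤ ∑ i ∈ A, f (Z i ω)} ⊆ {ω | ENNReal.ofReal t ≤
      ∑ i ∈ A, ENNReal.ofReal (f (Z i ω))} := fun ω hω => by
    rw [Set.mem_ofPred_eq] at hω ⊢
    rw [← ENNReal.ofReal_sum_of_nonneg fun i _ => h0 _]
    exact ENNReal.ofReal_le_ofReal hω
  refine (measure_mono hsub).trans (hmk.trans (le_of_eq ?_))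
  rw [lintegral_finsetSum _ fun i _ => hm i, ENNReal.ofReal_div_of_pos ht,
    ENNReal.ofReal_mul (Nat.cast_nonneg _), ENNReal.ofReal_natCast]
  congr 1
  have : ∀ i, ∫⁻ ω, ENNReal.ofReal (f (Z i ω)) ∂μ = ENNReal.ofReal (∫ z, f z ∂P) := fun i => by
    rw [hS.lintegral_comp i hf.ennreal_ofReal,
      ofReal_integral_eq_lintegral_ofReal hi (Eventually.of_forall h0)]
  simp [this]

/-- Tail bound for one observation. -/
lemma IsSample.tail (hS : IsSample μ P Z) (i : Fin n) {f : Obs p → ℝ} (hf : Measurable f)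
    {K x : ℝ} (h : SubGauss P f K) :
    μ {ω | x < f (Z i ω) ^ 2 / K ^ 2} ≤ ENNReal.ofReal (2 * Real.exp (-x)) := by
  have hc := hS.chernoff {i} (f := fun z => f z ^ 2 / K ^ 2) (by fun_prop) (b := Real.log 2)
    (by rw [Real.exp_log (by norm_num), ENNReal.ofReal_ofNat]; exact h) x
  refine (measure_mono fun ω hω => ?_).trans (hc.trans (le_of_eq ?_))
  · simpa using le_of_lt hω
  · simp [Real.exp_sub, Real.exp_neg, Real.exp_log, div_eq_mul_inv]

/-- Fourth moments of the sample stay bounded, even uniformly over families whose logarithmic size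
is of smaller order than the square root of the sample size: outside the event that the truncation
is active, a Chernoff bound with exponent of order `1 / x` applies. -/
lemma IsSample.sum_pow_four [IsProbabilityMeasure P] (hS : IsSample μ P Z) (A : Finset (Fin n))
    {f : Obs p → ℝ} (hf : Measurable f) {K x : ℝ} (hK : 0 < K) (h : SubGauss P f K) (hx : 1 ≤ x) :
    μ {ω | (∀ i ∈ A, f (Z i ω) ^ 2 / K ^ 2 ≤ x) ∧
        A.card * (773 * K ^ 4) ≤ ∑ i ∈ A, f (Z i ω) ^ 4} ≤
      ENNReal.ofReal (Real.exp (-(A.card / (2 * x)))) := by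
  set θ := 1 / (2 * x) with hθ
  have hθ0 : 0 < θ := by positivity
  have hxθ : 1 / (2 * θ) = x := by rw [hθ]; field_simp
  have hb := h.mgf_trunc_pow_four_le hf hK hθ0 (by
    rw [hθ, div_le_one (by positivity)]; linarith)
  rw [hxθ] at hb
  have hmeas : Measurable fun z => θ * if f z ^ 2 / K ^ 2 ≤ x then (f z ^ 2 / K ^ 2) ^ 2 else 0 :=
    (Measurable.ite (measurableSet_le (by fun_prop) (by fun_prop)) (by fun_prop)
      (by fun_prop)).const_mul _
  refine (measure_mono fun ω hω => ?_).trans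
    ((hS.chernoff A hmeas hb (θ * (773 * A.card))).trans (ENNReal.ofReal_le_ofReal
      (Real.exp_le_exp.2 (le_of_eq ?_))))
  · obtain ⟨h1, h2⟩ := hω
    rw [Set.mem_ofPred_eq]
    rw [← Finset.mul_sum]
    refine mul_le_mul_of_nonneg_left ?_ hθ0.le
    rw [Finset.sum_congr rfl fun i hi => if_pos (h1 i hi)]
    have e : ∑ i ∈ A, (f (Z i ω) ^ 2 / K ^ 2) ^ 2 = (∑ i ∈ A, f (Z i ω) ^ 4) / K ^ 4 := by
      rw [Finset.sum_div]
      exact Finset.sum_congr rfl fun i _ => by rw [div_pow]; ring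
    rw [e, le_div_iff₀ (by positivity)]
    linarith
  · rw [hθ]; ring

/-- A bound that holds for every fixed value of a parameter carries over to a random parameter
computed from the complementary subsample. -/
lemma IsSample.fresh [IsProbabilityMeasure μ] (hS : IsSample μ P Z) (A : Finset (Fin n))
    {u : Ω → Fin p → ℝ} (hu : ∀ j, Measurable[subsample Z Aᶜ] fun ω => u ω j)
    {G : Set (Fin p → ℝ)} (hG : MeasurableSet G)
    {S : Set ((Fin p → ℝ) × (Fin n → Obs p))} (hSm : MeasurableSet S)
    (hdep : ∀ v z z', (∀ i ∈ A, z i = z' i) → (v, z) ∈ S → (v, z') ∈ S) {δ : ℝ≥0∞}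
    (h : ∀ v ∈ G, μ {ω | (v, fun i => Z i ω) ∈ S} ≤ δ) :
    μ {ω | u ω ∈ G ∧ (u ω, fun i => Z i ω) ∈ S} ≤ δ := by
  rcases isEmpty_or_nonempty Ω with hΩ | ⟨⟨ω₀⟩⟩
  · rw [Set.eq_empty_of_isEmpty {ω | u ω ∈ G ∧ (u ω, fun i => Z i ω) ∈ S}]; simp
  -- the subsample `A`, completed by constants
  set W : Ω → Fin n → Obs p := fun ω i => if i ∈ A then Z i ω else Z i ω₀ with hW
  have hWS : ∀ v ω, (v, fun i => Z i ω) ∈ S ↔ (v, W ω) ∈ S := fun v ω =>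
    ⟨hdep v _ _ fun i hi => by simp [hW, hi], hdep v _ _ fun i hi => by simp [hW, hi]⟩
  have hle : ∀ B : Finset (Fin n), subsample Z B ≤ ‹MeasurableSpace Ω› := fun B =>
    iSup₂_le fun i _ => (hS.measurable i).comap_le
  have huM : Measurable[subsample Z Aᶜ] u := (@measurable_pi_iff _ _ _ (subsample Z Aᶜ) _ _).2 hu
  have hWM : Measurable[subsample Z A] W := by
    refine (@measurable_pi_iff _ _ _ (subsample Z A) _ _).2 fun i => ?_
    by_cases hi : i ∈ A
    · simp only [hW, hi, if_true]
      exact (comap_measurable (Z i)).mono (le_iSup₂_of_le i hi le_rfl) le_rfl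
    · simp only [hW, hi, if_false]
      exact measurable_const
  have hind : IndepFun u W μ := by
    have hI : Indep (subsample Z Aᶜ) (subsample Z A) μ :=
      (indep_iSup_of_disjoint (S := (↑Aᶜ : Set (Fin n))) (T := (↑A : Set (Fin n)))
        (fun i => (hS.measurable i).comap_le) hS.indep (by
          simpa using (disjoint_compl_left : Disjoint (↑A : Set (Fin n))ᶜ ↑A)))
    exact indep_of_indep_of_le_left (indep_of_indep_of_le_right hI hWM.comap_le) huM.comap_le
  have huM' : Measurable u := huM.mono (hle _) le_rfl
  have hWM' : Measurable W := hWM.mono (hle _) le_rfl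
  have hset : MeasurableSet ((G ×ˢ Set.univ) ∩ S) := (hG.prod MeasurableSet.univ).inter hSm
  have e : {ω | u ω ∈ G ∧ (u ω, fun i => Z i ω) ∈ S} =
      (fun ω => (u ω, W ω)) ⁻¹' ((G ×ˢ Set.univ) ∩ S) := by
    ext ω
    simp [hWS]
  rw [e, ← Measure.map_apply (huM'.prodMk hWM') hset,
    hind.map_prod_eq_prod_map_map huM'.aemeasurable hWM'.aemeasurable,
    Measure.prod_apply hset]
  have := Measure.isProbabilityMeasure_map (μ := μ) huM'.aemeasurable
  -- By independence the probability is an integral over the law of `u` of the probabilities at fixed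
  -- parameters.
  refine (lintegral_mono (g := fun _ => δ) fun v => ?_).trans (by simp)
  rw [Measure.map_apply hWM' (measurable_prodMk_left hset)]
  by_cases hv : v ∈ G
  · refine (measure_mono fun ω hω => ?_).trans (h v hv)
    exact (hWS v ω).2 hω.2
  · have : W ⁻¹' (Prod.mk v ⁻¹' ((G ×ˢ Set.univ) ∩ S)) = ∅ := by
      ext ω; simp [hv]
    rw [this]; simp

end Concentration

/-! ### The loss and its derivatives -/

section Loss

variable {φ : ℝ → ℝ → ℝ}

lemma IsLoss.hasDerivAt (h : IsLoss φ) {k : ℕ} (hk : k < 3) (a b : ℝ) :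
    HasDerivAt (dphi φ k a) (dphi φ (k + 1) a b) b := by
  have := (h.differentiable a k hk b).hasDerivAt
  rwa [← iteratedDeriv_succ] at this

lemma IsLoss.measurable_dphi (h : IsLoss φ) {k : ℕ} (hk : k ≤ 3) :
    Measurable (Function.uncurry (dphi φ k)) := by
  induction k with
  | zero =>
    have h0 : dphi φ 0 = φ := by funext a b; simp [dphi, iteratedDeriv_zero]
    rw [h0]
    exact h.measurable
  | succ k ih =>
    have ihm := ih (by omega)
    refine measurable_of_tendsto_metrizable (f := fun (m : ℕ) (x : ℝ × ℝ) =>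
      ((m : ℝ) + 1) * (dphi φ k x.1 (x.2 + 1 / ((m : ℝ) + 1)) - dphi φ k x.1 x.2)) (fun m => ?_) ?_
    · have h1 : Measurable fun x : ℝ × ℝ => dphi φ k x.1 (x.2 + 1 / ((m : ℝ) + 1)) :=
        ihm.comp (measurable_fst.prodMk (measurable_snd.add_const _))
      exact (h1.sub ihm).const_mul _
    · refine tendsto_pi_nhds.2 fun x => ?_
      have hd := (h.hasDerivAt (by omega : k < 3) x.1 x.2).tendsto_slope_zero
      have ht : Tendsto (fun m : ℕ => 1 / ((m : ℝ) + 1)) atTop (𝓝[≠] 0) :=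
        tendsto_nhdsWithin_of_tendsto_nhds_of_eventually_within _
          tendsto_one_div_add_atTop_nhds_zero_nat
          (Eventually.of_forall fun m => by
            simp only [Set.mem_compl_iff, Set.mem_singleton_iff]; positivity)
      refine (hd.comp ht).congr fun m => ?_
      simp [Function.comp]

lemma IsLoss.dphi_two_nonneg (h : IsLoss φ) (a b : ℝ) : 0 ≤ dphi φ 2 a b := by
  have hm : Monotone (dphi φ 1 a) := by
    have h1 : dphi φ 1 a = deriv (φ a) := by funext x; simp [dphi, iteratedDeriv_one]
    rw [h1]
    have := (h.convex a).monotoneOn_deriv (fun x _ => by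
      have := h.differentiable a 0 (by norm_num) x
      rwa [iteratedDeriv_zero] at this)
    exact monotoneOn_univ.1 this
  rw [← (h.hasDerivAt (by norm_num : 1 < 3) a b).deriv]
  exact hm.deriv_nonneg

lemma abs_sub_sub_mul_le {g g' : ℝ → ℝ} (hg : ∀ x, HasDerivAt g (g' x) x) {b δ c M : ℝ}
    (hM : ∀ x, |x - b| ≤ |δ| → |g' x - c| ≤ M) : |g (b + δ) - g b - c * δ| ≤ M * |δ| := by
  have hd : ∀ x ∈ Set.uIcc b (b + δ), HasDerivWithinAt (fun x => g x - c * x) (g' x - c)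
      (Set.uIcc b (b + δ)) x := fun x _ => by
    have := (hg x).sub ((hasDerivAt_id x).const_mul c)
    simp only [mul_one] at this
    exact this.hasDerivWithinAt
  have := (convex_uIcc b (b + δ)).norm_image_sub_le_of_norm_hasDerivWithin_le hd
    (fun x hx => by
      have h1 := Set.abs_sub_left_of_mem_uIcc hx
      rw [add_sub_cancel_left] at h1
      exact hM x h1) Set.left_mem_uIcc Set.right_mem_uIcc
  rw [add_sub_cancel_left, Real.norm_eq_abs, Real.norm_eq_abs] at this
  refine le_trans (le_of_eq ?_) this
  congr 1; ring

variable {a C : ℝ}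

lemma IsLoss.abs_dphi_two_sub_le (h : IsLoss φ) (hC : ∀ b, |dphi φ 3 a b| ≤ C) (b δ : ℝ) :
    |dphi φ 2 a (b + δ) - dphi φ 2 a b| ≤ C * |δ| := by
  simpa using abs_sub_sub_mul_le (g := dphi φ 2 a) (c := 0)
    (fun x => h.hasDerivAt (by norm_num) a x) (b := b) (δ := δ) fun x _ => by simpa using hC x

lemma IsLoss.abs_dphi_one_sub_sub_le (h : IsLoss φ) (hC : ∀ b, |dphi φ 3 a b| ≤ C) (b δ : ℝ) :
    |dphi φ 1 a (b + δ) - dphi φ 1 a b - dphi φ 2 a b * δ| ≤ C * δ ^ 2 := by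
  have hC0 : 0 ≤ C := (abs_nonneg _).trans (hC b)
  have := abs_sub_sub_mul_le (g := dphi φ 1 a) (c := dphi φ 2 a b) (M := C * |δ|)
    (fun x => h.hasDerivAt (by norm_num) a x) (b := b) (δ := δ) fun x hx => by
      have := h.abs_dphi_two_sub_le hC b (x - b)
      rw [add_sub_cancel] at this
      exact this.trans (mul_le_mul_of_nonneg_left hx hC0)
  rwa [mul_assoc, ← sq, sq_abs] at this

lemma IsLoss.abs_dphi_one_sub_le (h : IsLoss φ) (hC : ∀ b, |dphi φ 3 a b| ≤ C) {b C' : ℝ}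
    (hC' : dphi φ 2 a b ≤ C') (δ : ℝ) :
    |dphi φ 1 a (b + δ) - dphi φ 1 a b| ≤ (C' + C * |δ|) * |δ| := by
  have h1 := h.abs_dphi_one_sub_sub_le hC b δ
  have h2 : |dphi φ 2 a b * δ| ≤ C' * |δ| := by
    rw [abs_mul, abs_of_nonneg (h.dphi_two_nonneg a b)]
    exact mul_le_mul_of_nonneg_right hC' (abs_nonneg _)
  have h3 := abs_add_le (dphi φ 1 a (b + δ) - dphi φ 1 a b - dphi φ 2 a b * δ) (dphi φ 2 a b * δ)
  rw [sub_add_cancel] at h3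
  rw [← sq_abs] at h1
  linarith

lemma IsLoss.abs_sub_sub_le (h : IsLoss φ) (hC : ∀ b, |dphi φ 3 a b| ≤ C) {b C' : ℝ}
    (hC' : dphi φ 2 a b ≤ C') (δ : ℝ) :
    |φ a (b + δ) - φ a b - dphi φ 1 a b * δ| ≤ (C' + C * |δ|) * δ ^ 2 := by
  have hC0 : 0 ≤ C := (abs_nonneg _).trans (hC b)
  have hC'0 : 0 ≤ C' := (h.dphi_two_nonneg a b).trans hC'
  have := abs_sub_sub_mul_le (g := dphi φ 0 a) (c := dphi φ 1 a b) (M := (C' + C * |δ|) * |δ|)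
    (fun x => h.hasDerivAt (by norm_num) a x) (b := b) (δ := δ) fun x hx => by
      have := h.abs_dphi_one_sub_le hC hC' (x - b)
      rw [add_sub_cancel] at this
      refine this.trans ?_
      gcongr
  rw [mul_assoc, ← sq, sq_abs] at this
  simpa [dphi, iteratedDeriv_zero] using this

end Loss

/-! ### Population quantities -/

section Population

variable {p : ℕ} {φ : ℝ → ℝ → ℝ} {P : Measure (Obs p)} {β ξ : Fin p → ℝ}

lemma measurable_dot (u : Fin p → ℝ) : Measurable fun z : Obs p => u ⬝ᵥ z.1 := by
  unfold dotProduct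
  fun_prop

lemma measurable_coord (j : Fin p) : Measurable fun z : Obs p => z.1 j := by fun_prop

lemma measurable_mulVec (A : Matrix (Fin p) (Fin p) ℝ) (j : Fin p) :
    Measurable fun z : Obs p => (A *ᵥ z.1) j := measurable_dot _

lemma IsLoss.measurable_dphi_comp (h : IsLoss φ) {k : ℕ} (hk : k ≤ 3) (b : Fin p → ℝ) :
    Measurable fun z : Obs p => dphi φ k z.2 (z.1 ⬝ᵥ b) := by
  have h1 : Measurable fun z : Obs p => z.1 ⬝ᵥ b := by
    simpa only [dotProduct_comm] using measurable_dot b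
  exact (h.measurable_dphi hk).comp (measurable_snd.prodMk h1)

lemma hess_isSymm : (Hess φ P β).IsSymm := by
  ext i j
  simp only [Hess, Matrix.transpose_apply, Matrix.of_apply]
  exact integral_congr_ae (Eventually.of_forall fun z => by ring)

lemma sig_isSymm : (Sig P).IsSymm := by
  ext i j
  simp only [Sig, Matrix.transpose_apply, Matrix.of_apply]
  exact integral_congr_ae (Eventually.of_forall fun z => by ring)

lemma mStar_isSymm : (MStar φ P β).IsSymm := by
  rw [Matrix.IsSymm, MStar, Matrix.transpose_nonsing_inv, hess_isSymm.eq]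

lemma loading_eq (z : Fin p → ℝ) : ξ ⬝ᵥ (MStar φ P β *ᵥ z) = (MStar φ P β *ᵥ ξ) ⬝ᵥ z := by
  rw [dot_mulVec_comm mStar_isSymm, dotProduct_comm]

section Eigenvalues

variable {C₃ C₄ : ℝ}

lemma EigenvalueAssumption.isUnit_hess (h : EigenvalueAssumption φ P β C₃ C₄) (hp : 0 < p)
    (h3 : 0 < C₃) : IsUnit (Hess φ P β) := isUnit_of_spectrum_inv_pos hp h3 h.M_lower

lemma EigenvalueAssumption.hess_mul (h : EigenvalueAssumption φ P β C₃ C₄) (hp : 0 < p)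
    (h3 : 0 < C₃) : Hess φ P β * MStar φ P β = 1 :=
  Matrix.mul_nonsing_inv _ ((Matrix.isUnit_iff_isUnit_det _).1 (h.isUnit_hess hp h3))

lemma EigenvalueAssumption.hess_bounds (h : EigenvalueAssumption φ P β C₃ C₄) (hp : 0 < p)
    (h3 : 0 < C₃) (v : Fin p → ℝ) :
    1 / C₄ * l2 v ^ 2 ≤ v ⬝ᵥ (Hess φ P β *ᵥ v) ∧
      v ⬝ᵥ (Hess φ P β *ᵥ v) ≤ 1 / C₃ * l2 v ^ 2 := by
  have hu := h.isUnit_hess hp h3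
  refine ⟨quad_ge_of_spectrum hess_isSymm (fun κ hκ => ?_) v,
    quad_le_of_spectrum hess_isSymm (fun κ hκ => ?_) v⟩
  all_goals
    obtain ⟨h0, h1⟩ := spectrum_of_inv hu hκ
    have hl := h.M_lower _ h1
    have hU := h.M_upper _ h1
    have hκ0 : 0 < κ := inv_pos.1 (h3.trans_le hl)
  · rw [one_div, inv_le_comm₀ (h3.trans_le (hl.trans hU)) hκ0]
    exact hU
  · rw [one_div, le_inv_comm₀ hκ0 h3]
    exact hl

lemma EigenvalueAssumption.sig_le (h : EigenvalueAssumption φ P β C₃ C₄) (hp : 0 < p)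
    (h3 : 0 < C₃) (v : Fin p → ℝ) : v ⬝ᵥ (Sig P *ᵥ v) ≤ 1 / C₃ * l2 v ^ 2 := by
  have hu : IsUnit (Sig P) := isUnit_of_spectrum_inv_pos hp h3 h.omega_lower
  refine quad_le_of_spectrum sig_isSymm (fun κ hκ => ?_) v
  obtain ⟨h0, h1⟩ := spectrum_of_inv hu hκ
  have hl := h.omega_lower _ h1
  have hκ0 : 0 < κ := inv_pos.1 (h3.trans_le hl)
  rw [one_div, le_inv_comm₀ hκ0 h3]
  exact hl

lemma EigenvalueAssumption.l2_mStar_le (h : EigenvalueAssumption φ P β C₃ C₄)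
    (h3 : 0 < C₃) (h4 : 0 < C₄) (v : Fin p → ℝ) :
    l2 (MStar φ P β *ᵥ v) ≤ C₄ * l2 v := by
  set M := MStar φ P β
  have h0 : ∀ v, 0 ≤ v ⬝ᵥ (M *ᵥ v) :=
    posSemidef_of_isSymm mStar_isSymm fun κ hκ => h3.le.trans (h.M_lower κ hκ)
  have h1 := abs_dot_mulVec_le mStar_isSymm h0 h4.le
    (quad_le_of_spectrum mStar_isSymm h.M_upper) (M *ᵥ v) v
  rw [← l2_sq_eq_dot, abs_of_nonneg (sq_nonneg _)] at h1
  rcases (l2_nonneg (M *ᵥ v)).eq_or_lt with h2 | h2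
  · rw [← h2]; exact mul_nonneg h4.le (l2_nonneg _)
  · refine le_of_mul_le_mul_left ?_ h2
    nlinarith

lemma EigenvalueAssumption.sandwich_ge (h : EigenvalueAssumption φ P β C₃ C₄) (v : Fin p → ℝ) :
    C₃ * l2 v ^ 2 ≤ (MStar φ P β *ᵥ v) ⬝ᵥ (Sig P *ᵥ (MStar φ P β *ᵥ v)) := by
  have hs : (MStar φ P β * Sig P * MStar φ P β).IsSymm := by
    rw [Matrix.IsSymm, Matrix.transpose_mul, Matrix.transpose_mul, mStar_isSymm.eq, sig_isSymm.eq,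
      Matrix.mul_assoc]
  have := quad_ge_of_spectrum hs h.MSM_lower v
  rwa [← Matrix.mulVec_mulVec, ← Matrix.mulVec_mulVec, dot_mulVec_comm mStar_isSymm,
    dotProduct_comm] at this

end Eigenvalues

variable {K σ C₆ C₇ : ℝ}

lemma SubGauss.integrable_mul {f g : Obs p → ℝ} {K K' : ℝ} (hf : SubGauss P f K)
    (hg : SubGauss P g K') (hK : 0 < K) (hK' : 0 < K') (mf : Measurable f) (mg : Measurable g) :
    Integrable (fun x => f x * g x) P :=
  (hf.mul_subExp hg hK hK' mf).integrable (mf.mul mg) (mul_pos hK hK')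

/-- The expectation of a weighted quadratic form in the covariates. -/
lemma integral_weighted_quad {w : Obs p → ℝ} (hi : ∀ i j, Integrable
    (fun z => w z * (z.1 i * z.1 j)) P) (u v : Fin p → ℝ) :
    Integrable (fun z => w z * ((u ⬝ᵥ z.1) * (v ⬝ᵥ z.1))) P ∧
    ∫ z, w z * ((u ⬝ᵥ z.1) * (v ⬝ᵥ z.1)) ∂P =
      u ⬝ᵥ (Matrix.of (fun i j => ∫ z, w z * (z.1 i * z.1 j) ∂P) *ᵥ v) := by
  have e : ∀ z : Obs p, w z * ((u ⬝ᵥ z.1) * (v ⬝ᵥ z.1)) =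
      ∑ i, ∑ j, u i * (w z * (z.1 i * z.1 j) * v j) := fun z => by
    rw [dotProduct, dotProduct, Finset.sum_mul_sum, Finset.mul_sum]
    refine Finset.sum_congr rfl fun i _ => ?_
    rw [Finset.mul_sum]
    exact Finset.sum_congr rfl fun j _ => by ring
  have hij : ∀ i j, Integrable (fun z => u i * (w z * (z.1 i * z.1 j) * v j)) P := fun i j =>
    ((hi i j).mul_const _).const_mul _
  simp only [e]
  refine ⟨integrable_finsetSum _ fun i _ => integrable_finsetSum _ fun j _ => hij i j, ?_⟩
  rw [integral_finsetSum _ fun i _ => integrable_finsetSum _ fun j _ => hij i j]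
  simp only [dotProduct, Matrix.mulVec, Matrix.of_apply, Finset.mul_sum]
  refine Finset.sum_congr rfl fun i _ => ?_
  rw [integral_finsetSum _ fun j _ => hij i j]
  exact Finset.sum_congr rfl fun j _ => by rw [integral_const_mul, integral_mul_const]

/-- The first-order condition at the target. -/
lemma IsTarget.integral_score_eq_zero [IsProbabilityMeasure P] (hT : IsTarget φ P β)
    (hφ : IsLoss φ) (hD : DerivativeAssumption φ P β C₆ C₇) {u : Fin p → ℝ} (hK : 0 < K)
    (hσ : 0 < σ) (hu : SubGauss P (fun z : Obs p => u ⬝ᵥ z.1) K)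
    (hs : SubGauss P (fun z : Obs p => dphi φ 1 z.2 (z.1 ⬝ᵥ β)) σ) :
    ∫ z, (u ⬝ᵥ z.1) * dphi φ 1 z.2 (z.1 ⬝ᵥ β) ∂P = 0 := by
  have mu := measurable_dot u
  have ms := hφ.measurable_dphi_comp (by norm_num : 1 ≤ 3) β
  set g : Obs p → ℝ := fun z => (u ⬝ᵥ z.1) * dphi φ 1 z.2 (z.1 ⬝ᵥ β) with hg
  have hgi : Integrable g P := hu.integrable_mul hs hK hσ mu ms
  -- an integrable bound for the second-order remainder
  set R : Obs p → ℝ := fun z => C₆ * (u ⬝ᵥ z.1) ^ 2 +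
    C₇ * ((u ⬝ᵥ z.1) ^ 2 + ((u ⬝ᵥ z.1) ^ 2) ^ 2) with hR
  have i1 : Integrable (fun z : Obs p => (u ⬝ᵥ z.1) ^ 2) P := by
    simpa using (hu.integral_pow_le hK mu 1).1
  have hRi : Integrable R P :=
    (i1.const_mul _).add ((i1.add (hu.integral_pow_le hK mu 2).1).const_mul _)
  have key : ∀ t : ℝ, |t| ≤ 1 → 0 ≤ t * ∫ z, g z ∂P + t ^ 2 * ∫ z, R z ∂P := fun t ht => by
    have dot : ∀ z : Obs p, z.1 ⬝ᵥ (β + t • u) = z.1 ⬝ᵥ β + t * (u ⬝ᵥ z.1) := fun z => by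
      rw [dotProduct_add, dotProduct_smul, dotProduct_comm z.1 u, smul_eq_mul]
    have tay : ∀ᵐ z ∂P, |φ z.2 (z.1 ⬝ᵥ (β + t • u)) - φ z.2 (z.1 ⬝ᵥ β) - t * g z| ≤
        t ^ 2 * R z := by
      filter_upwards [hD] with z hz
      have h1 := hφ.abs_sub_sub_le hz.2 hz.1 (t * (u ⬝ᵥ z.1))
      rw [dot, show t * g z = dphi φ 1 z.2 (z.1 ⬝ᵥ β) * (t * (u ⬝ᵥ z.1)) by simp only [hg]; ring]
      refine h1.trans ?_
      have hC7 : 0 ≤ C₇ := (abs_nonneg _).trans (hz.2 0)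
      set x := u ⬝ᵥ z.1
      have e : (C₆ + C₇ * |t * x|) * (t * x) ^ 2 = t ^ 2 * (C₆ * x ^ 2 + C₇ * (|t * x| * x ^ 2)) := by
        ring
      rw [e]
      refine mul_le_mul_of_nonneg_left ?_ (sq_nonneg t)
      refine add_le_add_right (mul_le_mul_of_nonneg_left ?_ hC7) _
      have h2 : |t * x| ≤ |x| := by
        rw [abs_mul]; exact mul_le_of_le_one_left (abs_nonneg _) ht
      have h3 : |x| ≤ 1 + x ^ 2 := by nlinarith [sq_abs x, sq_nonneg (|x| - 1), abs_nonneg x]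
      nlinarith [sq_nonneg x]
    have mφ : ∀ b : Fin p → ℝ, Measurable fun z : Obs p => φ z.2 (z.1 ⬝ᵥ b) := fun b => by
      simpa [dphi, iteratedDeriv_zero] using hφ.measurable_dphi_comp (k := 0) (by norm_num) b
    have hdi : Integrable (fun z : Obs p =>
        φ z.2 (z.1 ⬝ᵥ (β + t • u)) - φ z.2 (z.1 ⬝ᵥ β) - t * g z) P :=
      (hRi.const_mul (t ^ 2)).mono' ((((mφ _).sub (mφ _)).sub
        ((mu.mul ms).const_mul t)).aestronglyMeasurable) tay
    have hbi : Integrable (fun z : Obs p => φ z.2 (z.1 ⬝ᵥ (β + t • u))) P := by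
      refine ((hdi.add (hgi.const_mul t)).add hT.1).congr (Eventually.of_forall fun z => ?_)
      simp
    have hmin := hT.2 _ hbi
    have h1 : ∫ z, (φ z.2 (z.1 ⬝ᵥ (β + t • u)) - φ z.2 (z.1 ⬝ᵥ β) - t * g z) ∂P ≤
        ∫ z, t ^ 2 * R z ∂P :=
      integral_mono_ae hdi (hRi.const_mul _) (tay.mono fun z hz => (le_abs_self _).trans hz)
    have hsub : Integrable (fun z : Obs p =>
        φ z.2 (z.1 ⬝ᵥ (β + t • u)) - φ z.2 (z.1 ⬝ᵥ β)) P := hbi.sub hT.1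
    rw [integral_sub hsub (hgi.const_mul t), integral_sub hbi hT.1, integral_const_mul,
      integral_const_mul] at h1
    linarith
  set m := ∫ z, g z ∂P with hm
  set r := ∫ z, R z ∂P with hr
  by_contra hne
  -- test the inequality at a small step against the sign of `m`
  have hpos : 0 < |m| + |r| + 1 := by positivity
  have ht : |-(m / (|m| + |r| + 1) / 1)| ≤ 1 := by
    rw [div_one, abs_neg, abs_div, abs_of_pos hpos, div_le_one hpos]
    linarith [abs_nonneg r]
  have h1 := key _ ht
  have h2 : 0 < m ^ 2 := by positivity
  have e : -(m / (|m| + |r| + 1) / 1) * m + (-(m / (|m| + |r| + 1) / 1)) ^ 2 * r =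
      m ^ 2 / (|m| + |r| + 1) ^ 2 * (r - (|m| + |r| + 1)) := by
    field_simp
    ring
  rw [e] at h1
  have h3 : r - (|m| + |r| + 1) < 0 := by linarith [le_abs_self r, abs_nonneg m]
  have h4 : 0 < m ^ 2 / (|m| + |r| + 1) ^ 2 := by positivity
  nlinarith

/-- The conditional second moment of the score bounds the asymptotic variance from below. -/
lemma integral_sq_mul_score_ge [IsProbabilityMeasure P] (hφ : IsLoss φ) {σ₂ C₅ : ℝ}
    (hR : ResidualAssumption φ P β σ₂ C₅) {u : Fin p → ℝ} (hK : 0 < K) (hσ : 0 < σ)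
    (hu : SubGauss P (fun z : Obs p => u ⬝ᵥ z.1) K)
    (hs : SubGauss P (fun z : Obs p => dphi φ 1 z.2 (z.1 ⬝ᵥ β)) σ) :
    C₅ * ∫ z, (u ⬝ᵥ z.1) ^ 2 ∂P ≤ ∫ z, (u ⬝ᵥ z.1) ^ 2 * dphi φ 1 z.2 (z.1 ⬝ᵥ β) ^ 2 ∂P := by
  have mu := measurable_dot u
  have ms := hφ.measurable_dphi_comp (by norm_num : 1 ≤ 3) β
  have i1 : Integrable (fun z : Obs p => (u ⬝ᵥ z.1) ^ 2) P := by
    simpa using (hu.integral_pow_le hK mu 1).1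
  have i2 : Integrable (fun z : Obs p => dphi φ 1 z.2 (z.1 ⬝ᵥ β) ^ 2) P := by
    simpa using (hs.integral_pow_le hσ ms 1).1
  have i3 : Integrable (fun z : Obs p => (u ⬝ᵥ z.1) ^ 2 * dphi φ 1 z.2 (z.1 ⬝ᵥ β) ^ 2) P := by
    simpa using (hu.integral_mul_pow_le hs hK hσ mu ms 1).1
  set m : MeasurableSpace (Obs p) :=
    MeasurableSpace.comap (Prod.fst : Obs p → (Fin p → ℝ)) inferInstance with hmdef
  have hm : m ≤ Prod.instMeasurableSpace := measurable_fst.comap_le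
  have hsm : StronglyMeasurable[m] fun z : Obs p => (u ⬝ᵥ z.1) ^ 2 := by
    have h1 : Measurable fun x : Fin p → ℝ => (u ⬝ᵥ x) ^ 2 := by
      unfold dotProduct; fun_prop
    exact (h1.comp (comap_measurable Prod.fst)).stronglyMeasurable
  have hpull := condExp_mul_of_stronglyMeasurable_left (μ := P) (m := m) hsm i3 i2
  have h1 : ∫ z, (u ⬝ᵥ z.1) ^ 2 * dphi φ 1 z.2 (z.1 ⬝ᵥ β) ^ 2 ∂P =
      ∫ z, (u ⬝ᵥ z.1) ^ 2 * (P[fun z : Obs p => dphi φ 1 z.2 (z.1 ⬝ᵥ β) ^ 2 | m]) z ∂P := by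
    have := integral_condExp hm (μ := P)
      (f := (fun z : Obs p => (u ⬝ᵥ z.1) ^ 2) * fun z : Obs p => dphi φ 1 z.2 (z.1 ⬝ᵥ β) ^ 2)
    rw [integral_congr_ae hpull] at this
    exact this.symm
  rw [h1, ← integral_const_mul]
  have hint : Integrable (fun z : Obs p =>
      (u ⬝ᵥ z.1) ^ 2 * (P[fun z : Obs p => dphi φ 1 z.2 (z.1 ⬝ᵥ β) ^ 2 | m]) z) P :=
    (integrable_condExp (μ := P) (m := m)).congr hpull
  refine integral_mono_ae (i1.const_mul C₅) hint ?_
  filter_upwards [hR.condExp_lower] with z hz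
  rw [mul_comm C₅]
  exact mul_le_mul_of_nonneg_left hz (sq_nonneg _)

end Population

/-! ### Regular populations -/

section Regular

variable {p : ℕ} {φ : ℝ → ℝ → ℝ} {P : Measure (Obs p)} {β ξ : Fin p → ℝ}

/-- The consequences of the assumptions on the population that the analysis uses.  Both sets of
tail assumptions on the covariates lead to this structure; they differ in the function `N`, which
bounds the sub-gaussian scale of `uᵀ X₀` (a multiple of `‖u‖₁` or of `‖u‖₂`).  The constants are
the scale `K` of the coordinates of `X₀` and `M* X₀`, the bounds `C₆`, `C₇` on derivatives, the
scale `σ` of the score, the curvature `κ` of `H`, the upper bound `Λ` on `H` and `Σ`, the relative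
scale `K'` of `ξᵀ M* X₀`, and the relative lower bound `v` on `V`. -/
structure Regular (φ : ℝ → ℝ → ℝ) (P : Measure (Obs p)) (β ξ : Fin p → ℝ)
    (N : (Fin p → ℝ) → ℝ) (K C₆ C₇ σ κ Λ K' v : ℝ) : Prop where
  loss : IsLoss φ
  K_pos : 0 < K
  C₆_pos : 0 < C₆
  C₇_pos : 0 < C₇
  σ_pos : 0 < σ
  κ_pos : 0 < κ
  Λ_pos : 0 < Λ
  K'_pos : 0 < K'
  v_pos : 0 < v
  ξ_pos : 0 < l2 ξ
  coord : ∀ j, SubGauss P (fun z : Obs p => z.1 j) K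
  mcoord : ∀ j, SubGauss P (fun z : Obs p => (MStar φ P β *ᵥ z.1) j) K
  score : SubGauss P (fun z : Obs p => dphi φ 1 z.2 (z.1 ⬝ᵥ β)) σ
  deriv : DerivativeAssumption φ P β C₆ C₇
  hess_lower : ∀ u, κ * l2 u ^ 2 ≤ u ⬝ᵥ (Hess φ P β *ᵥ u)
  hess_upper : ∀ u, u ⬝ᵥ (Hess φ P β *ᵥ u) ≤ Λ * l2 u ^ 2
  sig_upper : ∀ u, u ⬝ᵥ (Sig P *ᵥ u) ≤ Λ * l2 u ^ 2
  hess_mul : Hess φ P β * MStar φ P β = 1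
  loading : SubGauss P (fun z : Obs p => (MStar φ P β *ᵥ ξ) ⬝ᵥ z.1) (K' * l2 ξ)
  score_mean : ∀ u : Fin p → ℝ, ∫ z, (u ⬝ᵥ z.1) * dphi φ 1 z.2 (z.1 ⬝ᵥ β) ∂P = 0
  var_lower : v * l2 ξ ^ 2 ≤ asympVar φ P β ξ
  N_measurable : Measurable N
  N_sub : ∀ u c, 0 < c → N u ≤ c → SubGauss P (fun z : Obs p => u ⬝ᵥ z.1) c

variable [IsProbabilityMeasure P] {K σ₁ σ₂ C₃ C₄ C₅ C₆ C₇ : ℝ}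

lemma SubGauss.zero (K : ℝ) : SubGauss P (fun _ => (0 : ℝ)) K := by
  simp [SubGauss]

lemma Regular.of_assumptions (hφ : IsLoss φ) (hσ₂ : 0 < σ₂) (hσ₁ : 0 < σ₁) (h3 : 0 < C₃)
    (h4 : 0 < C₄) (h5 : 0 < C₅) (h6 : 0 < C₆) (h7 : 0 < C₇) (hT : IsTarget φ P β) (hξ : ξ ≠ 0)
    (hE : EigenvalueAssumption φ P β C₃ C₄) (hR : ResidualAssumption φ P β σ₂ C₅)
    (hD : DerivativeAssumption φ P β C₆ C₇) (hM : MXEntriesAssumption φ P β σ₁)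
    {N : (Fin p → ℝ) → ℝ} (hNm : Measurable N)
    (hN : ∀ u c, 0 < c → N u ≤ c → SubGauss P (fun z : Obs p => u ⬝ᵥ z.1) c)
    (hcoord : ∀ j, SubGauss P (fun z : Obs p => z.1 j) (2 * σ₁))
    (hload : SubGauss P (fun z : Obs p => (MStar φ P β *ᵥ ξ) ⬝ᵥ z.1) (2 * σ₁ * C₄ * l2 ξ)) :
    Regular φ P β ξ N (2 * σ₁) C₆ C₇ (2 * σ₂) (1 / C₄) (1 / C₃) (2 * σ₁ * C₄) (C₅ * C₃) := by
  have hp : 0 < p := by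
    obtain ⟨j, -⟩ := Function.ne_iff.1 hξ
    exact j.pos
  have hξ2 := l2_pos hξ
  have hK' : 0 < 2 * σ₁ * C₄ * l2 ξ := by positivity
  have hs : SubGauss P (fun z : Obs p => dphi φ 1 z.2 (z.1 ⬝ᵥ β)) (2 * σ₂) :=
    SubGauss.of_psi2Norm hR.subgaussian (by positivity) (by linarith)
  refine ⟨hφ, by positivity, h6, h7, by positivity, by positivity, by positivity, by positivity,
    by positivity, hξ2, hcoord, fun j => SubGauss.of_psi2Norm (hM j) (by positivity) (by linarith),
    hs, hD, fun u => (hE.hess_bounds hp h3 u).1, fun u => (hE.hess_bounds hp h3 u).2,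
    hE.sig_le hp h3, hE.hess_mul hp h3, hload, fun u => ?_, ?_, hNm, hN⟩
  · have hc : 0 < max (N u) 1 := lt_max_of_lt_right one_pos
    exact hT.integral_score_eq_zero hφ hD hc (by positivity) (hN u _ hc (le_max_left _ _)) hs
  · have h1 := integral_sq_mul_score_ge hφ hR hK' (by positivity) hload hs
    have hint : ∀ i j, Integrable (fun z : Obs p => 1 * (z.1 i * z.1 j)) P := fun i j => by
      simp only [one_mul]
      exact (hcoord i).integrable_mul (hcoord j) (by positivity) (by positivity)
        (measurable_coord i) (measurable_coord j)
    have h2 := (integral_weighted_quad (w := fun _ => 1) hint (MStar φ P β *ᵥ ξ)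
      (MStar φ P β *ᵥ ξ)).2
    simp only [one_mul] at h2
    have h3' := hE.sandwich_ge ξ
    have h4' : ∫ z : Obs p, ((MStar φ P β *ᵥ ξ) ⬝ᵥ z.1) ^ 2 ∂P =
        (MStar φ P β *ᵥ ξ) ⬝ᵥ (Sig P *ᵥ (MStar φ P β *ᵥ ξ)) := by
      simp only [sq]; exact h2
    rw [h4'] at h1
    unfold asympVar
    simp only [loading_eq]
    refine le_trans ?_ h1
    rw [mul_assoc]
    exact mul_le_mul_of_nonneg_left h3' h5.le

lemma measurable_l1 : Measurable (l1 : (Fin p → ℝ) → ℝ) := by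
  unfold l1
  exact Finset.measurable_fun_sum _ fun j _ => (measurable_pi_apply j).abs

lemma measurable_l2 : Measurable (l2 : (Fin p → ℝ) → ℝ) := by
  unfold l2
  fun_prop

lemma Regular.of_entries (hφ : IsLoss φ) (hσ₂ : 0 < σ₂) (hσ₁ : 0 < σ₁) (h3 : 0 < C₃)
    (h4 : 0 < C₄) (h5 : 0 < C₅) (h6 : 0 < C₆) (h7 : 0 < C₇) (hT : IsTarget φ P β) (hξ : ξ ≠ 0)
    (hE : EigenvalueAssumption φ P β C₃ C₄) (hR : ResidualAssumption φ P β σ₂ C₅)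
    (hD : DerivativeAssumption φ P β C₆ C₇) (hM : MXEntriesAssumption φ P β σ₁)
    (hX : SubGaussianEntries φ P β ξ σ₁) :
    Regular φ P β ξ (fun u => 2 * σ₁ * l1 u) (2 * σ₁) C₆ C₇ (2 * σ₂) (1 / C₄) (1 / C₃)
      (2 * σ₁ * C₄) (C₅ * C₃) := by
  have hξ2 := l2_pos hξ
  have hcoord : ∀ j, SubGauss P (fun z : Obs p => z.1 j) (2 * σ₁) := fun j =>
    SubGauss.of_psi2Norm (hX.entries j) (by positivity) (by linarith)
  refine Regular.of_assumptions hφ hσ₂ hσ₁ h3 h4 h5 h6 h7 hT hξ hE hR hD hM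
    (measurable_l1.const_mul _) (fun u c hc hu => ?_) hcoord ?_
  · rcases (l1_nonneg u).eq_or_lt with h0 | h0
    · have : u = 0 := by
        ext j
        exact abs_eq_zero.1 (le_antisymm ((abs_le_l1 u j).trans h0.symm.le) (abs_nonneg _))
      subst this
      simpa using SubGauss.zero (P := P) c
    · exact (SubGauss.dot_l1 (f := fun z : Obs p => z.1) (by positivity) measurable_coord hcoord
        h0).mono (by positivity) hu
  · have h := hX.loading
    simp only [loading_eq] at h
    refine SubGauss.of_psi2Norm h (by positivity) ?_
    have := hE.l2_mStar_le h3 h4 ξ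
    nlinarith [mul_le_mul_of_nonneg_left this hσ₁.le, mul_pos (mul_pos hσ₁ h4) hξ2]

lemma Regular.of_vector (hφ : IsLoss φ) (hσ₂ : 0 < σ₂) (hσ₁ : 0 < σ₁) (h3 : 0 < C₃)
    (h4 : 0 < C₄) (h5 : 0 < C₅) (h6 : 0 < C₆) (h7 : 0 < C₇) (hT : IsTarget φ P β) (hξ : ξ ≠ 0)
    (hE : EigenvalueAssumption φ P β C₃ C₄) (hR : ResidualAssumption φ P β σ₂ C₅)
    (hD : DerivativeAssumption φ P β C₆ C₇) (hM : MXEntriesAssumption φ P β σ₁)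
    (hX : SubGaussianVector P σ₁) :
    Regular φ P β ξ (fun u => 2 * σ₁ * l2 u) (2 * σ₁) C₆ C₇ (2 * σ₂) (1 / C₄) (1 / C₃)
      (2 * σ₁ * C₄) (C₅ * C₃) := by
  have hξ2 := l2_pos hξ
  have hsub : ∀ u c, 0 < c → 2 * σ₁ * l2 u ≤ c → SubGauss P (fun z : Obs p => u ⬝ᵥ z.1) c :=
    fun u c hc hu => by
      by_cases h0 : u = 0
      · subst h0
        simpa using SubGauss.zero (P := P) c
      · have hl := l2_pos h0
        have h1 : psi2Norm P (fun z : Obs p => (u ⬝ᵥ z.1) / l2 u) ≤ ENNReal.ofReal σ₁ :=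
          (le_iSup₂ (f := fun (s : Fin p → ℝ) (_ : s ∈ {s : Fin p → ℝ | s ≠ 0}) =>
            psi2Norm P (fun z : Obs p => (s ⬝ᵥ z.1) / l2 s)) u h0).trans hX
        have h2 := (SubGauss.of_psi2Norm h1 (K := 2 * σ₁) (by positivity)
          (by linarith)).const_mul hl.ne'
        simp only [mul_div_cancel₀ _ hl.ne'] at h2
        rw [abs_of_pos hl, mul_comm] at h2
        exact h2.mono (by positivity) hu
  refine Regular.of_assumptions hφ hσ₂ hσ₁ h3 h4 h5 h6 h7 hT hξ hE hR hD hM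
    (measurable_l2.const_mul _) hsub (fun j => ?_) (hsub _ _ (by positivity) ?_)
  · have := hsub (Pi.single j 1) (2 * σ₁) (by positivity) (by
      have : l2 (Pi.single j (1 : ℝ) : Fin p → ℝ) = 1 := by
        simp [l2, Pi.single_apply]
      rw [this, mul_one])
    simpa only [single_one_dotProduct] using this
  · rw [mul_assoc (2 * σ₁)]
    exact mul_le_mul_of_nonneg_left (hE.l2_mStar_le h3 h4 ξ) (by positivity)

end Regular

/-! ### Uniform concentration over coordinates -/

section Uniform

variable {n p : ℕ} {Ω : Type*} [MeasurableSpace Ω] {μ : Measure Ω} {P : Measure (Obs p)}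
  {Z : Fin n → Ω → Obs p}

lemma natCast_le_exp_logMax (hn : 0 < n) :
    (p : ℝ) ≤ Real.exp (logMax p n) ∧ (n : ℝ) ≤ Real.exp (logMax p n) := by
  have : (0 : ℝ) < n := by exact_mod_cast hn
  rw [logMax, Real.exp_log (lt_max_of_lt_right this)]
  exact ⟨le_max_left _ _, le_max_right _ _⟩

lemma logMax_nonneg (hn : 0 < n) : 0 ≤ logMax p n := by
  refine Real.log_nonneg (le_max_of_le_right ?_)
  exact_mod_cast hn

lemma lam_sq (hn : 0 < n) : lam p n ^ 2 = logMax p n / n :=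
  Real.sq_sqrt (div_nonneg (logMax_nonneg hn) (Nat.cast_nonneg _))

lemma lam_nonneg : 0 ≤ lam p n := Real.sqrt_nonneg _

/-- Simultaneous Bernstein bounds at the rate `λ_n`. The deviation `16 λ_n / √ρ` makes each
exponent at most `-4 L`, and the union over the index set costs `2 L`. -/
lemma IsSample.bernstein_max [IsProbabilityMeasure P] (hS : IsSample μ P Z) {A : Finset (Fin n)}
    (hn : 0 < n) {ρ : ℝ} (hρ : 0 < ρ) (hA : ρ * n ≤ A.card) (hlam : logMax p n / n ≤ ρ)
    {ι : Type*} [Fintype ι] (hι : (Fintype.card ι : ℝ) ≤ Real.exp (2 * logMax p n))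
    {f : ι → Obs p → ℝ} (hf : ∀ i, Measurable (f i)) {K : ℝ} (hK : 0 < K)
    (h : ∀ i, SubExp P (f i) K) :
    μ {ω | ¬ ∀ i, |(A.card : ℝ)⁻¹ * ∑ k ∈ A, f i (Z k ω) - ∫ z, f i z ∂P| ≤
      K * (16 / Real.sqrt ρ) * lam p n} ≤ ENNReal.ofReal (2 * Real.exp (-(2 * logMax p n))) := by
  set L := logMax p n with hL
  have hn' : (0 : ℝ) < n := by exact_mod_cast hn
  have hA0 : (0 : ℝ) < A.card := (mul_pos hρ hn').trans_le hA
  have hsρ := Real.sqrt_pos.2 hρ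
  set x := 16 / Real.sqrt ρ * lam p n with hx
  have hx0 : 0 ≤ x := mul_nonneg (by positivity) lam_nonneg
  have hx16 : x ≤ 16 := by
    have : lam p n ≤ Real.sqrt ρ := Real.sqrt_le_sqrt hlam
    rw [hx, div_mul_eq_mul_div, div_le_iff₀ hsρ]
    linarith
  have hx2 : 4 * L ≤ A.card * x ^ 2 / 64 := by
    have e : x ^ 2 = 256 / ρ * (L / n) := by
      rw [hx, mul_pow, lam_sq hn, ← hL, div_pow, Real.sq_sqrt hρ.le]; norm_num
    have h1 : 0 ≤ L / n := div_nonneg (logMax_nonneg hn) hn'.le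
    have h2 := mul_le_mul_of_nonneg_right hA (by positivity : 0 ≤ 256 / ρ * (L / n))
    rw [e]
    have h3 : ρ * n * (256 / ρ * (L / n)) = 256 * L := by field_simp
    linarith
  have one : ∀ i, μ {ω | A.card * (K * x) ≤
      |∑ k ∈ A, f i (Z k ω) - A.card * ∫ z, f i z ∂P|} ≤
        ENNReal.ofReal (2 * Real.exp (-(4 * L))) := fun i =>
    (hS.bernstein A (hf i) hK (h i) hx0 hx16).trans
      (ENNReal.ofReal_le_ofReal (by gcongr))
  refine (measure_mono fun ω hω => ?_).trans ((measure_exists_le one).trans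
    (ENNReal.ofReal_le_ofReal ?_))
  · rw [Set.mem_ofPred_eq] at hω ⊢
    push Not at hω
    obtain ⟨i, hi⟩ := hω
    refine ⟨i, ?_⟩
    have e : ∑ k ∈ A, f i (Z k ω) - A.card * ∫ z, f i z ∂P =
        A.card * ((A.card : ℝ)⁻¹ * ∑ k ∈ A, f i (Z k ω) - ∫ z, f i z ∂P) := by
      field_simp
    rw [e, abs_mul, abs_of_pos hA0]
    rw [mul_assoc, ← hx] at hi
    exact mul_le_mul_of_nonneg_left hi.le hA0.le
  · calc Fintype.card ι * (2 * Real.exp (-(4 * L)))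
        ≤ Real.exp (2 * L) * (2 * Real.exp (-(4 * L))) := by gcongr
      _ = 2 * Real.exp (-(2 * L)) := by
        rw [mul_left_comm, ← Real.exp_add]; ring_nf

lemma card_mul_exp_le {ι : Type*} [Fintype ι] {a b : ℝ}
    (hι : (Fintype.card ι : ℝ) ≤ Real.exp a) {c : ℝ} (hc : 0 ≤ c) :
    Fintype.card ι * (c * Real.exp (-b)) ≤ c * Real.exp (-(b - a)) := by
  calc Fintype.card ι * (c * Real.exp (-b)) ≤ Real.exp a * (c * Real.exp (-b)) := by gcongr
    _ = c * Real.exp (-(b - a)) := by rw [mul_left_comm, ← Real.exp_add]; ring_nf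

/-- All entries of the sample are of order `√L`. -/
lemma IsSample.tail_max (hS : IsSample μ P Z) (hn : 0 < n) {f : Fin p → Obs p → ℝ}
    (hf : ∀ j, Measurable (f j)) {K : ℝ} (h : ∀ j, SubGauss P (f j) K) :
    μ {ω | ¬ ∀ i j, f j (Z i ω) ^ 2 / K ^ 2 ≤ 4 * logMax p n} ≤
      ENNReal.ofReal (2 * Real.exp (-(2 * logMax p n))) := by
  have hcard : (Fintype.card (Fin n × Fin p) : ℝ) ≤ Real.exp (2 * logMax p n) := by
    obtain ⟨h1, h2⟩ := natCast_le_exp_logMax (p := p) hn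
    rw [Fintype.card_prod, Fintype.card_fin, Fintype.card_fin, Nat.cast_mul, two_mul, Real.exp_add]
    exact mul_le_mul h2 h1 (Nat.cast_nonneg _) (Real.exp_pos _).le
  have := measure_exists_le (μ := μ) (ι := Fin n × Fin p)
    (fun ij => hS.tail (x := 4 * logMax p n) ij.1 (hf ij.2) (h ij.2))
  refine (measure_mono fun ω hω => ?_).trans (this.trans (ENNReal.ofReal_le_ofReal ?_))
  · rw [Set.mem_ofPred_eq] at hω ⊢
    push Not at hω
    obtain ⟨i, j, hij⟩ := hω
    exact ⟨(i, j), hij⟩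
  · refine (card_mul_exp_le hcard (by norm_num)).trans (le_of_eq ?_)
    ring_nf

/-- The empirical fourth moments of all coordinates are bounded. -/
lemma IsSample.fourth_max [IsProbabilityMeasure P] (hS : IsSample μ P Z) {A : Finset (Fin n)}
    (hn : 0 < n) {ρ : ℝ} (hA : ρ * n ≤ A.card) (hL1 : 1 ≤ logMax p n)
    (hL2 : 24 * logMax p n ^ 2 ≤ ρ * n)
    {f : Fin p → Obs p → ℝ} (hf : ∀ j, Measurable (f j)) {K : ℝ} (hK : 0 < K)
    (h : ∀ j, SubGauss P (f j) K) :
    μ {ω | ¬ ∀ j, ∑ i ∈ A, f j (Z i ω) ^ 4 ≤ A.card * (773 * K ^ 4)} ≤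
      ENNReal.ofReal (3 * Real.exp (-(2 * logMax p n))) := by
  set L := logMax p n with hL
  have hcard : (Fintype.card (Fin p) : ℝ) ≤ Real.exp L := by
    rw [Fintype.card_fin]; exact (natCast_le_exp_logMax hn).1
  have h1 := hS.tail_max hn hf h
  have h2 := measure_exists_le (μ := μ) (ι := Fin p) (c := 1 * Real.exp (-(3 * L)))
    (fun j => (hS.sum_pow_four A (hf j) hK (h j) (x := 4 * L) (by linarith)).trans
      (ENNReal.ofReal_le_ofReal (by
        rw [one_mul]
        refine Real.exp_le_exp.2 (neg_le_neg ?_)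
        rw [le_div_iff₀ (by positivity)]
        nlinarith)))
  have h2' := h2.trans (ENNReal.ofReal_le_ofReal (card_mul_exp_le hcard zero_le_one))
  refine (measure_mono fun ω hω => ?_).trans ((measure_union_le _ _).trans
    ((add_le_add h1 h2').trans ?_))
  · by_cases hb : ∀ i j, f j (Z i ω) ^ 2 / K ^ 2 ≤ 4 * L
    · right
      rw [Set.mem_ofPred_eq] at hω ⊢
      push Not at hω
      obtain ⟨j, hj⟩ := hω
      exact ⟨j, fun i _ => hb i j, hj.le⟩
    · left; exact hb
  · rw [← ENNReal.ofReal_add (by positivity) (by positivity)]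
    refine ENNReal.ofReal_le_ofReal (le_of_eq ?_)
    rw [← hL]
    ring_nf

end Uniform

/-! ### Restricted strong convexity of truncated Hessians -/

section Gram

variable {n p : ℕ}

/-- The weighted Gram matrix `|A|⁻¹ ∑_{i ∈ A} w_i x_i x_iᵀ`. -/
noncomputable def weightedGram (A : Finset (Fin n)) (z : Fin n → Obs p) (w : Fin n → ℝ) :
    Matrix (Fin p) (Fin p) ℝ :=
  (A.card : ℝ)⁻¹ • ∑ i ∈ A, w i • Matrix.vecMulVec (z i).1 (z i).1

lemma weightedGram_mulVec (A : Finset (Fin n)) (z : Fin n → Obs p) (w : Fin n → ℝ)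
    (v : Fin p → ℝ) (j : Fin p) : (weightedGram A z w *ᵥ v) j =
      (A.card : ℝ)⁻¹ * ∑ i ∈ A, w i * ((z i).1 j * (v ⬝ᵥ (z i).1)) := by
  simp only [weightedGram, Matrix.smul_mulVec, Matrix.sum_mulVec, Matrix.vecMulVec_mulVec,
    Pi.smul_apply, Finset.sum_apply, smul_eq_mul, dotProduct_comm v, MulOpposite.smul_eq_mul_unop,
    MulOpposite.unop_op]

lemma weightedGram_apply (A : Finset (Fin n)) (z : Fin n → Obs p) (w : Fin n → ℝ) (j k : Fin p) :
    weightedGram A z w j k = (A.card : ℝ)⁻¹ * ∑ i ∈ A, w i * ((z i).1 j * (z i).1 k) := by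
  simp [weightedGram, Matrix.sum_apply, Matrix.vecMulVec_apply]

lemma dot_weightedGram (A : Finset (Fin n)) (z : Fin n → Obs p) (w : Fin n → ℝ)
    (u v : Fin p → ℝ) : u ⬝ᵥ (weightedGram A z w *ᵥ v) =
      (A.card : ℝ)⁻¹ * ∑ i ∈ A, w i * ((u ⬝ᵥ (z i).1) * (v ⬝ᵥ (z i).1)) := by
  simp only [dotProduct, weightedGram_mulVec, Finset.mul_sum, Finset.sum_mul]
  rw [Finset.sum_comm]
  refine Finset.sum_congr rfl fun i _ => ?_
  rw [Finset.sum_comm]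
  refine Finset.sum_congr rfl fun j _ => Finset.sum_congr rfl fun k _ => by ring

lemma weightedGram_isSymm (A : Finset (Fin n)) (z : Fin n → Obs p) (w : Fin n → ℝ) :
    (weightedGram A z w).IsSymm := by
  ext j k
  simp only [Matrix.transpose_apply, weightedGram_apply, mul_comm ((z _).1 k)]

lemma quad_weightedGram_mono {A : Finset (Fin n)} {z : Fin n → Obs p} {w w' : Fin n → ℝ}
    (h : ∀ i ∈ A, w i ≤ w' i) (v : Fin p → ℝ) :
    v ⬝ᵥ (weightedGram A z w *ᵥ v) ≤ v ⬝ᵥ (weightedGram A z w' *ᵥ v) := by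
  rw [dot_weightedGram, dot_weightedGram]
  refine mul_le_mul_of_nonneg_left (Finset.sum_le_sum fun i hi => ?_)
    (inv_nonneg.2 (Nat.cast_nonneg _))
  exact mul_le_mul_of_nonneg_right (h i hi) (mul_self_nonneg _)

lemma quad_weightedGram_nonneg {A : Finset (Fin n)} {z : Fin n → Obs p} {w : Fin n → ℝ}
    (h : ∀ i ∈ A, 0 ≤ w i) (v : Fin p → ℝ) : 0 ≤ v ⬝ᵥ (weightedGram A z w *ᵥ v) := by
  rw [dot_weightedGram]
  exact mul_nonneg (inv_nonneg.2 (Nat.cast_nonneg _)) (Finset.sum_nonneg fun i hi =>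
    mul_nonneg (h i hi) (mul_self_nonneg _))

lemma empHess_eq (φ : ℝ → ℝ → ℝ) (A : Finset (Fin n)) (z : Fin n → Obs p) (b : Fin p → ℝ) :
    empHess φ A z b = weightedGram A z fun i => dphi φ 2 (z i).2 ((z i).1 ⬝ᵥ b) := rfl

/-- The truncated weight `(φ₂ - η)₊` at `β`.  It stays below `φ₂` at all parameters that are
uniformly close to `β` on the sample. -/
noncomputable def truncWeight (φ : ℝ → ℝ → ℝ) (β : Fin p → ℝ) (η : ℝ) (z : Obs p) : ℝ :=
  max (dphi φ 2 z.2 (z.1 ⬝ᵥ β) - η) 0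

variable {φ : ℝ → ℝ → ℝ} {P : Measure (Obs p)} {β ξ : Fin p → ℝ}
  {N : (Fin p → ℝ) → ℝ} {K C₆ C₇ σ κ Λ K' v : ℝ}

lemma truncWeight_nonneg (η : ℝ) (z : Obs p) : 0 ≤ truncWeight φ β η z := le_max_right _ _

lemma IsLoss.measurable_truncWeight (h : IsLoss φ) (η : ℝ) : Measurable (truncWeight φ β η) :=
  ((h.measurable_dphi_comp (by norm_num) β).sub_const η).max measurable_const

lemma truncWeight_le {η : ℝ} (hη : 0 ≤ η) {z : Obs p} {C : ℝ} (hC : 0 ≤ C)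
    (h : dphi φ 2 z.2 (z.1 ⬝ᵥ β) ≤ C) : truncWeight φ β η z ≤ C :=
  max_le (by linarith) hC

namespace Regular

variable (hR : Regular φ P β ξ N K C₆ C₇ σ κ Λ K' v)
include hR

lemma weight_subExp {f g : Obs p → ℝ} {a b : ℝ} (hf : SubGauss P f a) (hg : SubGauss P g b)
    (ha : 0 < a) (hb : 0 < b) (mf : Measurable f) {w : Obs p → ℝ}
    (hw : ∀ᵐ z ∂P, 0 ≤ w z ∧ w z ≤ C₆) : SubExp P (fun z => w z * (f z * g z)) (C₆ * (a * b)) := by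
  refine (hf.mul_subExp hg ha hb mf).of_abs_le (by positivity) hR.C₆_pos ?_
  filter_upwards [hw] with z hz
  rw [abs_mul, abs_of_nonneg hz.1]
  exact mul_le_mul_of_nonneg_right hz.2 (abs_nonneg _)

lemma hess_weight : ∀ᵐ z ∂P, 0 ≤ dphi φ 2 z.2 (z.1 ⬝ᵥ β) ∧ dphi φ 2 z.2 (z.1 ⬝ᵥ β) ≤ C₆ := by
  filter_upwards [hR.deriv] with z hz using ⟨hR.loss.dphi_two_nonneg _ _, hz.1⟩

lemma trunc_weight {η : ℝ} (hη : 0 ≤ η) :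
    ∀ᵐ z ∂P, 0 ≤ truncWeight φ β η z ∧ truncWeight φ β η z ≤ C₆ := by
  filter_upwards [hR.deriv] with z hz
    using ⟨truncWeight_nonneg _ _, truncWeight_le hη hR.C₆_pos.le hz.1⟩

lemma integrable_weight {w : Obs p → ℝ} (mw : Measurable w)
    (hw : ∀ᵐ z ∂P, 0 ≤ w z ∧ w z ≤ C₆) (i j : Fin p) :
    Integrable (fun z : Obs p => w z * (z.1 i * z.1 j)) P :=
  (hR.weight_subExp (hR.coord i) (hR.coord j) hR.K_pos hR.K_pos (measurable_coord i) hw).integrable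
    (mw.mul ((measurable_coord i).mul (measurable_coord j)))
    (mul_pos hR.C₆_pos (mul_pos hR.K_pos hR.K_pos))

/-- Truncation at level `κ / (2 Λ)` costs at most half of the curvature of `H`. -/
lemma trunc_curvature (u : Fin p → ℝ) :
    Integrable (fun z : Obs p => truncWeight φ β (κ / (2 * Λ)) z * ((u ⬝ᵥ z.1) * (u ⬝ᵥ z.1))) P ∧
    κ / 2 * l2 u ^ 2 ≤
      ∫ z, truncWeight φ β (κ / (2 * Λ)) z * ((u ⬝ᵥ z.1) * (u ⬝ᵥ z.1)) ∂P := by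
  have hκ := hR.κ_pos
  have hΛ := hR.Λ_pos
  set η := κ / (2 * Λ) with hη
  have mH := hR.loss.measurable_dphi_comp (by norm_num : 2 ≤ 3) β
  have hT := integral_weighted_quad (hR.integrable_weight
    (hR.loss.measurable_truncWeight (β := β) η) (hR.trunc_weight (by positivity))) u u
  have hH := integral_weighted_quad (hR.integrable_weight mH hR.hess_weight) u u
  have hint : ∀ i j, Integrable (fun z : Obs p => 1 * (z.1 i * z.1 j)) P := fun i j => by
    simp only [one_mul]
    exact (hR.coord i).integrable_mul (hR.coord j) hR.K_pos hR.K_pos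
      (measurable_coord i) (measurable_coord j)
  have hS := integral_weighted_quad (w := fun _ => 1) hint u u
  refine ⟨hT.1, ?_⟩
  have h1 : ∫ z, (dphi φ 2 z.2 (z.1 ⬝ᵥ β) * ((u ⬝ᵥ z.1) * (u ⬝ᵥ z.1)) -
      η * (1 * ((u ⬝ᵥ z.1) * (u ⬝ᵥ z.1)))) ∂P ≤
      ∫ z, truncWeight φ β η z * ((u ⬝ᵥ z.1) * (u ⬝ᵥ z.1)) ∂P := by
    refine integral_mono (hH.1.sub (hS.1.const_mul η)) hT.1 fun z => ?_
    have : dphi φ 2 z.2 (z.1 ⬝ᵥ β) - η ≤ truncWeight φ β η z := le_max_left _ _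
    nlinarith [mul_self_nonneg (u ⬝ᵥ z.1)]
  rw [integral_sub hH.1 (hS.1.const_mul η), integral_const_mul, hH.2, hS.2] at h1
  have h2 := hR.hess_lower u
  have h3 := hR.sig_upper u
  have e : Matrix.of (fun i j => ∫ z : Obs p, 1 * (z.1 i * z.1 j) ∂P) = Sig P := by
    simp only [one_mul]; rfl
  rw [e] at h1
  have h4 : η * (u ⬝ᵥ (Sig P *ᵥ u)) ≤ κ / 2 * l2 u ^ 2 := by
    refine (mul_le_mul_of_nonneg_left h3 (by positivity)).trans (le_of_eq ?_)
    rw [hη]; field_simp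
  refine le_trans ?_ h1
  have h5 : κ * l2 u ^ 2 ≤ u ⬝ᵥ
      (Matrix.of (fun i j => ∫ z, dphi φ 2 z.2 (z.1 ⬝ᵥ β) * (z.1 i * z.1 j) ∂P) *ᵥ u) := h2
  linarith

variable {Ω : Type*} [MeasurableSpace Ω] {μ : Measure Ω} {Z : Fin n → Ω → Obs p}
  [IsProbabilityMeasure P]

/-- Restricted strong convexity with tolerance of order `λ_n`, for sub-gaussian coordinates. -/
lemma restrictedConvex_entrywise (hS : IsSample μ P Z) {A : Finset (Fin n)}
    (hn : 0 < n) {ρ : ℝ} (hρ : 0 < ρ) (hA : ρ * n ≤ A.card) (hlam : logMax p n / n ≤ ρ) :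
    μ {ω | ¬ RestrictedConvex (weightedGram A (fun i => Z i ω)
        fun i => truncWeight φ β (κ / (2 * Λ)) (Z i ω)) (κ / 2)
          (C₆ * (K * K) * (16 / Real.sqrt ρ) * lam p n)} ≤
      ENNReal.ofReal (2 * Real.exp (-(2 * logMax p n))) := by
  have hκ := hR.κ_pos
  have hΛ := hR.Λ_pos
  set η := κ / (2 * Λ) with hη
  have hη0 : 0 ≤ η := by positivity
  have mw := hR.loss.measurable_truncWeight (β := β) η
  have hcard : (Fintype.card (Fin p × Fin p) : ℝ) ≤ Real.exp (2 * logMax p n) := by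
    obtain ⟨h1, -⟩ := natCast_le_exp_logMax (p := p) hn
    rw [Fintype.card_prod, Fintype.card_fin, Nat.cast_mul, two_mul, Real.exp_add]
    exact mul_le_mul h1 h1 (Nat.cast_nonneg _) (Real.exp_pos _).le
  refine (measure_mono fun ω hω => ?_).trans (hS.bernstein_max hn hρ hA hlam hcard
    (f := fun jk z => truncWeight φ β η z * (z.1 jk.1 * z.1 jk.2))
    (fun jk => mw.mul ((measurable_coord _).mul (measurable_coord _)))
    (mul_pos hR.C₆_pos (mul_pos hR.K_pos hR.K_pos))
    (fun jk => hR.weight_subExp (hR.coord _) (hR.coord _) hR.K_pos hR.K_pos (measurable_coord _)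
      (hR.trunc_weight hη0)))
  rw [Set.mem_ofPred_eq] at hω ⊢
  refine fun hgood => hω ?_
  refine RestrictedConvex.of_entrywise (B := Matrix.of fun i j =>
    ∫ z, truncWeight φ β η z * (z.1 i * z.1 j) ∂P) (fun u => ?_) fun j k => ?_
  · rw [← (integral_weighted_quad (hR.integrable_weight mw (hR.trunc_weight hη0)) u u).2]
    exact (hR.trunc_curvature u).2
  · rw [weightedGram_apply]
    exact hgood (j, k)

/-- The lower tail of the truncated quadratic form in a fixed direction. -/
lemma lower_tail (hS : IsSample μ P Z) (A : Finset (Fin n)) {u : Fin p → ℝ}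
    (hu : 0 < l2 u) (hsub : SubGauss P (fun z : Obs p => u ⬝ᵥ z.1) (K * l2 u)) :
    μ {ω | ∑ i ∈ A, truncWeight φ β (κ / (2 * Λ)) (Z i ω) *
        ((u ⬝ᵥ (Z i ω).1) * (u ⬝ᵥ (Z i ω).1)) < A.card * (κ / 4 * l2 u ^ 2)} ≤
      ENNReal.ofReal (Real.exp (-(κ ^ 2 / (128 * C₆ ^ 2 * K ^ 4) * A.card))) := by
  have hκ := hR.κ_pos
  have hΛ := hR.Λ_pos
  have hK := hR.K_pos
  have hC := hR.C₆_pos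
  set η := κ / (2 * Λ) with hη
  have hη0 : 0 ≤ η := by positivity
  have mw := hR.loss.measurable_truncWeight (β := β) η
  have mu := measurable_dot u
  set f : Obs p → ℝ := fun z => truncWeight φ β η z * ((u ⬝ᵥ z.1) * (u ⬝ᵥ z.1)) with hf
  have mf : Measurable f := mw.mul (mu.mul mu)
  obtain ⟨hi, hlow⟩ := hR.trunc_curvature u
  obtain ⟨i4, h4⟩ := hsub.integral_pow_le (by positivity) mu 2
  have pt : ∀ᵐ z ∂P, f z ^ 2 ≤ C₆ ^ 2 * ((u ⬝ᵥ z.1) ^ 2) ^ 2 := by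
    filter_upwards [hR.trunc_weight hη0] with z hz
    have : f z ^ 2 = truncWeight φ β η z ^ 2 * ((u ⬝ᵥ z.1) ^ 2) ^ 2 := by simp only [hf]; ring
    rw [this]
    exact mul_le_mul_of_nonneg_right (pow_le_pow_left₀ hz.1 hz.2 2) (by positivity)
  have hi2 : Integrable (fun z => f z ^ 2) P := by
    refine (i4.const_mul (C₆ ^ 2)).mono' (mf.pow_const 2).aestronglyMeasurable ?_
    filter_upwards [pt] with z hz
    rwa [Real.norm_eq_abs, abs_of_nonneg (sq_nonneg _)]
  have hb : ∫ z, f z ^ 2 ∂P ≤ C₆ ^ 2 * (4 * (K * l2 u) ^ 4) := by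
    refine (integral_mono_ae hi2 (i4.const_mul _) pt).trans ?_
    rw [integral_const_mul]
    refine mul_le_mul_of_nonneg_left (h4.trans (le_of_eq ?_)) (by positivity)
    norm_num [Nat.factorial]; ring
  -- The exponential parameter balances the linear and the quadratic term of the exponent.
  set θ := κ / (16 * C₆ ^ 2 * K ^ 4 * l2 u ^ 2) with hθ
  have hθ0 : 0 ≤ θ := by positivity
  have hlap := laplace_le (P := P) (f := f) (θ := θ)
    (Eventually.of_forall fun z => mul_nonneg (truncWeight_nonneg _ _) (mul_self_nonneg _))
    hθ0 hi hi2 hlow hb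
  have hc := hS.chernoff A (f := fun z => -(θ * f z)) ((mf.const_mul θ).neg) hlap
    (-(θ * (A.card * (κ / 4 * l2 u ^ 2))))
  refine (measure_mono fun ω hω => ?_).trans (hc.trans (ENNReal.ofReal_le_ofReal
    (Real.exp_le_exp.2 (le_of_eq ?_))))
  · rw [Set.mem_ofPred_eq] at hω ⊢
    rw [Finset.sum_neg_distrib, ← Finset.mul_sum]
    exact neg_le_neg (mul_le_mul_of_nonneg_left hω.le hθ0)
  · rw [hθ]
    field_simp
    ring

omit [IsProbabilityMeasure P] in
lemma diag_weightedGram_le {A : Finset (Fin n)} {z : Fin n → Obs p} {w : Fin n → ℝ}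
    (hw : ∀ i, w i ≤ C₆) (j : Fin p)
    (h4 : ∑ i ∈ A, (z i).1 j ^ 4 ≤ A.card * (773 * K ^ 4)) (hA : 0 < A.card) :
    weightedGram A z w j j ≤ 774 * (C₆ * K ^ 2) := by
  have hK := hR.K_pos
  have hC := hR.C₆_pos
  have hA' : (0 : ℝ) < A.card := by exact_mod_cast hA
  rw [weightedGram_apply, inv_mul_le_iff₀ hA']
  calc ∑ i ∈ A, w i * ((z i).1 j * (z i).1 j)
      ≤ ∑ i ∈ A, C₆ * (K ^ 2 + (z i).1 j ^ 4 / K ^ 2) := by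
        refine Finset.sum_le_sum fun i _ => ?_
        refine mul_le_mul (hw i) ?_ (mul_self_nonneg _) hC.le
        rw [← sub_le_iff_le_add', le_div_iff₀ (by positivity)]
        nlinarith [sq_nonneg ((z i).1 j ^ 2 - K ^ 2), sq_nonneg ((z i).1 j), sq_nonneg K]
    _ = C₆ * (A.card * K ^ 2 + (∑ i ∈ A, (z i).1 j ^ 4) / K ^ 2) := by
        rw [← Finset.mul_sum, Finset.sum_add_distrib, Finset.sum_const, nsmul_eq_mul,
          Finset.sum_div]
    _ ≤ C₆ * (A.card * K ^ 2 + (A.card * (773 * K ^ 4)) / K ^ 2) := by gcongr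
    _ = A.card * (774 * (C₆ * K ^ 2)) := by field_simp; ring

/-- Restricted strong convexity with tolerance of order `1 / k`, for a sub-gaussian vector:
a union bound over the signed sums of `k` coordinate vectors suffices. -/
lemma restrictedConvex_sparse (hS : IsSample μ P Z) {A : Finset (Fin n)} (hA : 0 < A.card)
    (hn : 0 < n) (hL : 1 ≤ logMax p n)
    (hsub : ∀ u : Fin p → ℝ, 0 < l2 u → SubGauss P (fun z : Obs p => u ⬝ᵥ z.1) (K * l2 u))
    {k : ℕ} (hk : 2 ≤ k) :
    μ {ω | (∀ i, truncWeight φ β (κ / (2 * Λ)) (Z i ω) ≤ C₆) ∧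
        (∀ j, ∑ i ∈ A, (Z i ω).1 j ^ 4 ≤ A.card * (773 * K ^ 4)) ∧
        ¬ RestrictedConvex (weightedGram A (fun i => Z i ω)
          fun i => truncWeight φ β (κ / (2 * Λ)) (Z i ω)) (κ / 4)
            (774 * (C₆ * K ^ 2) / (k - 1))} ≤
      ENNReal.ofReal (Real.exp (2 * logMax p n * k -
        κ ^ 2 / (128 * C₆ ^ 2 * K ^ 4) * A.card)) := by
  have hκ := hR.κ_pos
  set η := κ / (2 * Λ) with hη
  set c := κ ^ 2 / (128 * C₆ ^ 2 * K ^ 4) * A.card with hc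
  set L := logMax p n with hLdef
  have hA' : (0 : ℝ) < A.card := by exact_mod_cast hA
  have hcard : (Fintype.card (Fin k → Fin p × Bool) : ℝ) ≤ Real.exp (2 * L * k) := by
    have h1 := (natCast_le_exp_logMax (p := p) hn).1
    have h2 : (2 : ℝ) ≤ Real.exp L := by linarith [Real.add_one_le_exp L]
    rw [Fintype.card_fun, Fintype.card_prod, Fintype.card_fin, Fintype.card_fin, Fintype.card_bool]
    push_cast
    rw [mul_comm (2 * L) (k : ℝ), Real.exp_nat_mul]
    refine pow_le_pow_left₀ (by positivity) ?_ k
    rw [two_mul, Real.exp_add]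
    exact mul_le_mul h1 h2 (by norm_num) (Real.exp_pos _).le
  have one : ∀ t : Fin k → Fin p × Bool, μ {ω | ∑ i ∈ A, truncWeight φ β η (Z i ω) *
      ((signedSum t ⬝ᵥ (Z i ω).1) * (signedSum t ⬝ᵥ (Z i ω).1)) <
        A.card * (κ / 4 * l2 (signedSum t) ^ 2)} ≤ ENNReal.ofReal (1 * Real.exp (-c)) := fun t => by
    rw [one_mul]
    rcases (l2_nonneg (signedSum t)).eq_or_lt with h0 | h0
    · refine le_trans (le_of_eq ?_) zero_le
      convert measure_empty (μ := μ)
      ext ω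
      simp only [Set.mem_ofPred_eq, Set.mem_empty_iff_false, iff_false, not_lt, ← h0]
      norm_num
      exact Finset.sum_nonneg fun i _ => mul_nonneg (truncWeight_nonneg _ _) (mul_self_nonneg _)
    · exact hR.lower_tail hS A h0 (hsub _ h0)
  refine (measure_mono fun ω hω => ?_).trans ((measure_exists_le one).trans
    (ENNReal.ofReal_le_ofReal ((card_mul_exp_le hcard zero_le_one).trans (le_of_eq ?_))))
  · obtain ⟨hw, h4, hnot⟩ := hω
    by_contra hcon
    rw [Set.mem_ofPred_eq] at hcon
    push Not at hcon
    refine hnot fun u => ?_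
    set G := weightedGram A (fun i => Z i ω) fun i => truncWeight φ β η (Z i ω) with hG
    have hsymm : (G - (κ / 4) • (1 : Matrix (Fin p) (Fin p) ℝ)).IsSymm := by
      rw [Matrix.IsSymm, Matrix.transpose_sub, (weightedGram_isSymm _ _ _).eq,
        Matrix.transpose_smul, Matrix.transpose_one]
    have hq : ∀ x : Fin p → ℝ, x ⬝ᵥ ((G - (κ / 4) • (1 : Matrix (Fin p) (Fin p) ℝ)) *ᵥ x) =
        x ⬝ᵥ (G *ᵥ x) - κ / 4 * l2 x ^ 2 := fun x => by
      rw [Matrix.sub_mulVec, dotProduct_sub, Matrix.smul_mulVec, Matrix.one_mulVec,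
        dotProduct_smul, l2_sq_eq_dot, smul_eq_mul]
    have := quad_ge_of_signedSum hsymm hk (fun t => by
      rw [hq, sub_nonneg, hG, dot_weightedGram, le_inv_mul_iff₀ hA']
      exact hcon t) (d := 774 * (C₆ * K ^ 2)) (fun j => by
        have h1 := hR.diag_weightedGram_le (A := A) (z := fun i => Z i ω) hw j (h4 j) hA
        rw [Matrix.sub_apply, Matrix.smul_apply, Matrix.one_apply_eq, smul_eq_mul, mul_one]
        linarith) u
    rw [hq] at this
    linarith
  · rw [one_mul, neg_sub]

end Regular

end Gram

/-! ### The matrix estimator on a good subsample -/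

section Design

variable {n p : ℕ} {φ : ℝ → ℝ → ℝ} {P : Measure (Obs p)} {β ξ : Fin p → ℝ}
  {N : (Fin p → ℝ) → ℝ} {K C₆ C₇ σ κ Λ K' v : ℝ}

lemma tau_eq (hn : 0 < n) : Real.sqrt (logMax p n) * lam p n = tau p n := by
  rw [lam, Real.sqrt_div (logMax_nonneg hn), ← mul_div_assoc,
    Real.mul_self_sqrt (logMax_nonneg hn), tau]

lemma abs_weighted_sum_le {ι : Type*} (A : Finset ι) (a c : ι → ℝ) :
    ∑ i ∈ A, |a i| * |c i| ≤ Real.sqrt (∑ i ∈ A, a i ^ 2) * Real.sqrt (∑ i ∈ A, c i ^ 2) := by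
  have := Finset.sum_mul_sq_le_sq_mul_sq A (fun i => |a i|) (fun i => |c i|)
  simp only [sq_abs] at this
  rw [← Real.sqrt_mul (Finset.sum_nonneg fun _ _ => sq_nonneg _)]
  exact Real.le_sqrt_of_sq_le this

/-- The event on which the matrix estimator computed from the subsample `A` behaves well:
`M*` is nearly feasible for the Hessian at the target, empirical fourth moments and entries are
controlled, and the truncated Hessian is restricted strongly convex with tolerance `γ`. -/
structure GoodDesign (φ : ℝ → ℝ → ℝ) (P : Measure (Obs p)) (β : Fin p → ℝ)
    (K C₆ C₇ κ Λ ρ γ : ℝ) (A : Finset (Fin n)) (z : Fin n → Obs p) : Prop where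
  dev : ∀ j k, |(A.card : ℝ)⁻¹ * ∑ i ∈ A, dphi φ 2 (z i).2 ((z i).1 ⬝ᵥ β) *
    ((z i).1 j * (MStar φ P β *ᵥ (z i).1) k) - (1 : Matrix (Fin p) (Fin p) ℝ) j k| ≤
      C₆ * (K * K) * (16 / Real.sqrt ρ) * lam p n
  fourth : ∀ j, ∑ i ∈ A, (z i).1 j ^ 4 ≤ A.card * (773 * K ^ 4)
  mfourth : ∀ j, ∑ i ∈ A, (MStar φ P β *ᵥ (z i).1) j ^ 4 ≤ A.card * (773 * K ^ 4)
  entry : ∀ i j, (z i).1 j ^ 2 / K ^ 2 ≤ 4 * logMax p n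
  rsc : RestrictedConvex (weightedGram A z fun i => truncWeight φ β (κ / (2 * Λ)) (z i)) (κ / 4) γ
  deriv : ∀ i, dphi φ 2 (z i).2 ((z i).1 ⬝ᵥ β) ≤ C₆ ∧ ∀ b, |dphi φ 3 (z i).2 b| ≤ C₇

lemma Regular.integral_hess_mStar (hR : Regular φ P β ξ N K C₆ C₇ σ κ Λ K' v) (j k : Fin p) :
    ∫ z, dphi φ 2 z.2 (z.1 ⬝ᵥ β) * (z.1 j * (MStar φ P β *ᵥ z.1) k) ∂P =
      (1 : Matrix (Fin p) (Fin p) ℝ) j k := by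
  have mH := hR.loss.measurable_dphi_comp (by norm_num : 2 ≤ 3) β
  have h := (integral_weighted_quad (hR.integrable_weight mH hR.hess_weight) (Pi.single j 1)
    (MStar φ P β k)).2
  simp only [single_one_dotProduct] at h
  rw [show (fun i j => ∫ z : Obs p, dphi φ 2 z.2 (z.1 ⬝ᵥ β) * (z.1 i * z.1 j) ∂P) =
    Matrix.of.symm (Hess φ P β) from rfl, Equiv.apply_symm_apply] at h
  refine Eq.trans h ?_
  rw [← hR.hess_mul, Matrix.mul_apply,
    show (Hess φ P β *ᵥ MStar φ P β k) j = ∑ i, Hess φ P β j i * MStar φ P β k i from rfl]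
  refine Finset.sum_congr rfl fun i _ => ?_
  rw [mStar_isSymm.apply i k]

lemma abs_dot_le_of_entry {A : Finset (Fin n)} {ρ γ : ℝ} {z : Fin n → Obs p} (hK : 0 < K)
    (hn : 0 < n) (hG : GoodDesign φ P β K C₆ C₇ κ Λ ρ γ A z) {C s : ℝ} {d : Fin p → ℝ}
    (hd : l1 d ≤ C * s * lam p n) (i : Fin n) :
    |(z i).1 ⬝ᵥ d| ≤ 2 * K * C * (s * tau p n) := by
  have h1 : ∀ j, |(z i).1 j| ≤ 2 * K * Real.sqrt (logMax p n) := fun j => by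
    refine abs_le_of_sq_le_sq ?_ (by positivity)
    have := hG.entry i j
    rw [div_le_iff₀ (by positivity)] at this
    rw [mul_pow, Real.sq_sqrt (logMax_nonneg hn)]
    nlinarith
  refine (abs_dot_le_l1 h1 d).trans ((mul_le_mul_of_nonneg_left hd (by positivity)).trans
    (le_of_eq ?_))
  rw [← tau_eq hn]; ring

/-- On a good subsample the two minimization problems have solutions, and every output of the
algorithm is close to `M*`. -/
theorem GoodDesign.twoStage (hR : Regular φ P β ξ N K C₆ C₇ σ κ Λ K' v) (hn : 0 < n)
    {A : Finset (Fin n)} (hA : 0 < A.card) {ρ γ : ℝ} {z : Fin n → Obs p}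
    (hG : GoodDesign φ P β K C₆ C₇ κ Λ ρ γ A z) {C₈ A₀ : ℝ} (hC₈ : 0 < C₈) {b : Fin p → ℝ}
    (hb : GoodEstimate C₈ β A z b) (hs0 : 1 ≤ l0 β)
    (hη : C₇ * (2 * K * C₈ * (l0 β * tau p n)) ≤ κ / (2 * Λ))
    (hA₀ : 2 * (C₆ * (K * K) * (16 / Real.sqrt ρ) + C₇ * (K ^ 2 * Real.sqrt (773 * C₈))) ≤ A₀)
    (hr : 0 < Real.sqrt (l0 β) * A₀ * lam p n) (hγ : 0 ≤ γ)
    (hγs : 32 * (γ * s1max φ P β) ≤ κ / 4) :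
    (∃ M', IsTwoStageOutput (empHess φ A z b) (Real.sqrt (l0 β) * A₀ * lam p n) M') ∧
    ∀ M', IsTwoStageOutput (empHess φ A z b) (Real.sqrt (l0 β) * A₀ * lam p n) M' →
      (M' - MStar φ P β).IsSymm ∧
      (∀ j, ∑ i, |(M' - MStar φ P β) i j| ≤
        48 / (κ / 4) * (Real.sqrt (l0 β) * A₀ * lam p n * s1max φ P β)) ∧
      ∀ j, l2 (fun i => (M' - MStar φ P β) i j) ≤
        12 / (κ / 4) * (Real.sqrt (l0 β) * A₀ * lam p n * Real.sqrt (s1max φ P β)) := by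
  have hκ := hR.κ_pos
  have hK := hR.K_pos
  have hC7 := hR.C₇_pos
  have hC6 := hR.C₆_pos
  have hA' : (0 : ℝ) < A.card := by exact_mod_cast hA
  have hp : NeZero p := ⟨by
    rintro rfl
    have h0 := hR.ξ_pos
    simp [l2] at h0⟩
  set r := Real.sqrt (l0 β) * A₀ * lam p n with hrdef
  set H := empHess φ A z b with hH
  have dot : ∀ i, (z i).1 ⬝ᵥ b = (z i).1 ⬝ᵥ β + (z i).1 ⬝ᵥ (b - β) := fun i => by
    rw [dotProduct_sub]; ring
  have hdiff : ∀ i, |dphi φ 2 (z i).2 ((z i).1 ⬝ᵥ b) - dphi φ 2 (z i).2 ((z i).1 ⬝ᵥ β)| ≤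
      C₇ * |(z i).1 ⬝ᵥ (b - β)| := fun i => by
    rw [dot]; exact hR.loss.abs_dphi_two_sub_le (hG.deriv i).2 _ _
  have hsymm : H.IsSymm := weightedGram_isSymm _ _ _
  have h0 : ∀ v, 0 ≤ v ⬝ᵥ (H *ᵥ v) :=
    quad_weightedGram_nonneg fun i _ => hR.loss.dphi_two_nonneg _ _
  have hRSC : RestrictedConvex H (κ / 4) γ := fun u => by
    refine (hG.rsc u).trans (quad_weightedGram_mono (fun i _ => ?_) u)
    refine max_le ?_ (hR.loss.dphi_two_nonneg _ _)
    have h1 := abs_dot_le_of_entry hK hn hG hb.1 i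
    have h2 := (abs_le.1 (hdiff i)).1
    have h3 := mul_le_mul_of_nonneg_left h1 hC7.le
    linarith
  have hHM : ∀ j k, |(H * MStar φ P β - 1) j k| ≤ r / 2 := fun j k => by
    have e1 : (H * MStar φ P β) j k = (A.card : ℝ)⁻¹ * ∑ i ∈ A,
        dphi φ 2 (z i).2 ((z i).1 ⬝ᵥ b) * ((z i).1 j * (MStar φ P β *ᵥ (z i).1) k) := by
      have : (H * MStar φ P β) j k = (H *ᵥ fun i => MStar φ P β i k) j := rfl
      rw [this, hH, empHess_eq, weightedGram_mulVec]
      refine congrArg _ (Finset.sum_congr rfl fun i _ => ?_)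
      simp only [Matrix.mulVec, dotProduct, mStar_isSymm.apply k]
    set c : Fin n → ℝ := fun i => (z i).1 j * (MStar φ P β *ᵥ (z i).1) k with hc
    set a : Fin n → ℝ := fun i => (z i).1 ⬝ᵥ (b - β) with ha
    have e2 : (H * MStar φ P β - 1) j k =
        ((A.card : ℝ)⁻¹ * ∑ i ∈ A, dphi φ 2 (z i).2 ((z i).1 ⬝ᵥ β) * c i -
          (1 : Matrix (Fin p) (Fin p) ℝ) j k) +
        (A.card : ℝ)⁻¹ * ∑ i ∈ A, (dphi φ 2 (z i).2 ((z i).1 ⬝ᵥ b) -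
          dphi φ 2 (z i).2 ((z i).1 ⬝ᵥ β)) * c i := by
      rw [Matrix.sub_apply, e1]
      simp only [sub_mul, Finset.sum_sub_distrib, mul_sub]
      ring
    have h2 : |∑ i ∈ A, (dphi φ 2 (z i).2 ((z i).1 ⬝ᵥ b) -
          dphi φ 2 (z i).2 ((z i).1 ⬝ᵥ β)) * c i| ≤ C₇ * ∑ i ∈ A, |a i| * |c i| := by
      refine (Finset.abs_sum_le_sum_abs _ _).trans ?_
      rw [Finset.mul_sum]
      refine Finset.sum_le_sum fun i _ => ?_
      rw [abs_mul, ← mul_assoc]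
      exact mul_le_mul_of_nonneg_right (hdiff i) (abs_nonneg _)
    have ha2 : ∑ i ∈ A, a i ^ 2 ≤ A.card * (C₈ * l0 β * lam p n ^ 2) := by
      have := hb.2
      rw [inv_mul_le_iff₀ hA'] at this
      rw [lam_sq hn]
      refine le_trans (le_of_eq (Finset.sum_congr rfl fun i _ => ?_)) this
      simp only [ha, dotProduct_sub]
    have hc2 : ∑ i ∈ A, c i ^ 2 ≤ A.card * (773 * K ^ 4) := by
      have h1 := hG.fourth j
      have h2 := hG.mfourth k
      have h3 : ∑ i ∈ A, c i ^ 2 ≤ ∑ i ∈ A, (1 / 2 * (z i).1 j ^ 4 +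
          1 / 2 * (MStar φ P β *ᵥ (z i).1) k ^ 4) := by
        refine Finset.sum_le_sum fun i _ => ?_
        rw [hc]
        nlinarith [sq_nonneg ((z i).1 j ^ 2 - (MStar φ P β *ᵥ (z i).1) k ^ 2)]
      rw [Finset.sum_add_distrib, ← Finset.mul_sum, ← Finset.mul_sum] at h3
      linarith
    have h3 : ∑ i ∈ A, |a i| * |c i| ≤
        A.card * (Real.sqrt (l0 β) * lam p n * (K ^ 2 * Real.sqrt (773 * C₈))) := by
      refine (abs_weighted_sum_le A a c).trans ?_
      rw [← Real.sqrt_mul (Finset.sum_nonneg fun _ _ => sq_nonneg _)]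
      refine Real.sqrt_le_iff.2 ⟨by have := lam_nonneg (p := p) (n := n); positivity, ?_⟩
      refine (mul_le_mul ha2 hc2 (Finset.sum_nonneg fun _ _ => sq_nonneg _) (by positivity)).trans
        (le_of_eq ?_)
      simp only [mul_pow, Real.sq_sqrt (Nat.cast_nonneg _),
        Real.sq_sqrt (by positivity : 0 ≤ 773 * C₈)]
      ring
    have h4 : |(A.card : ℝ)⁻¹ * ∑ i ∈ A, (dphi φ 2 (z i).2 ((z i).1 ⬝ᵥ b) -
          dphi φ 2 (z i).2 ((z i).1 ⬝ᵥ β)) * c i| ≤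
        C₇ * (Real.sqrt (l0 β) * lam p n * (K ^ 2 * Real.sqrt (773 * C₈))) := by
      rw [abs_mul, abs_of_pos (inv_pos.2 hA'), inv_mul_le_iff₀ hA']
      refine h2.trans ((mul_le_mul_of_nonneg_left h3 hC7.le).trans (le_of_eq ?_))
      ring
    rw [e2]
    refine (abs_add_le _ _).trans ((add_le_add (hG.dev j k) h4).trans ?_)
    have hs1 : 1 ≤ Real.sqrt (l0 β) := Real.one_le_sqrt.2 (by exact_mod_cast hs0)
    have hlam := lam_nonneg (p := p) (n := n)
    set X := C₆ * (K * K) * (16 / Real.sqrt ρ) with hX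
    have hX0 : 0 ≤ X := by positivity
    have h5 : X * lam p n ≤ Real.sqrt (l0 β) * (X * lam p n) :=
      le_mul_of_one_le_left (by positivity) hs1
    have h6 : Real.sqrt (l0 β) * lam p n * (2 * (X + C₇ * (K ^ 2 * Real.sqrt (773 * C₈)))) ≤
        Real.sqrt (l0 β) * lam p n * A₀ := mul_le_mul_of_nonneg_left hA₀ (by positivity)
    rw [hrdef]
    linarith
  refine ⟨exists_isTwoStageOutput hsymm h0 hr mStar_isSymm hHM, fun M' hM' => ?_⟩
  exact hM'.error hsymm h0 (by positivity) hγ hr hRSC mStar_isSymm hHM (Nat.cast_nonneg _)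
    (fun j => by exact_mod_cast Finset.le_sup (f := s1col φ P β) (Finset.mem_univ j)) hγs

end Design

/-! ### Deterministic expansions of the debiased estimator and of the variance estimator -/

section Expansion

variable {n p : ℕ} {φ : ℝ → ℝ → ℝ} {P : Measure (Obs p)} {β ξ : Fin p → ℝ}
  {N : (Fin p → ℝ) → ℝ} {K C₆ C₇ σ κ Λ K' v : ℝ}

lemma lam_sq_eq_tau (hn : 0 < n) : lam p n ^ 2 = tau p n / Real.sqrt n := by
  rw [lam_sq hn, tau, div_div, Real.mul_self_sqrt (Nat.cast_nonneg _)]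

lemma tau_nonneg (hn : 0 < n) : 0 ≤ tau p n := div_nonneg (logMax_nonneg hn) (Real.sqrt_nonneg _)

/-- The event on which the subsample `A` behaves well relative to a direction `m` (in the
application, an estimate of `M* ξ` from the complementary subsample). -/
structure FreshGood (φ : ℝ → ℝ → ℝ) (P : Measure (Obs p)) (β ξ : Fin p → ℝ)
    (K C₆ K'' ρ ε : ℝ) (A : Finset (Fin n)) (m : Fin p → ℝ) (z : Fin n → Obs p) : Prop where
  score : |∑ i ∈ A, ((m - MStar φ P β *ᵥ ξ) ⬝ᵥ (z i).1) * dphi φ 1 (z i).2 ((z i).1 ⬝ᵥ β)| ≤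
    ε * (l2 ξ * Real.sqrt n)
  cross : ∀ k, |(A.card : ℝ)⁻¹ * ∑ i ∈ A, dphi φ 2 (z i).2 ((z i).1 ⬝ᵥ β) *
    ((z i).1 k * (m ⬝ᵥ (z i).1)) - (Hess φ P β *ᵥ m) k| ≤
      C₆ * (K * (K'' * l2 ξ)) * (16 / Real.sqrt ρ) * lam p n
  lin : ∀ i ∈ A, (m ⬝ᵥ (z i).1) ^ 2 / (K'' * l2 ξ) ^ 2 ≤ 2 * Real.log n
  sq : ∑ i ∈ A, ((m - MStar φ P β *ᵥ ξ) ⬝ᵥ (z i).1) ^ 2 *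
    dphi φ 1 (z i).2 ((z i).1 ⬝ᵥ β) ^ 2 ≤ ε * (n * l2 ξ ^ 2)

namespace Regular

variable (hR : Regular φ P β ξ N K C₆ C₇ σ κ Λ K' v)
include hR

lemma hess_mulVec_mStar : Hess φ P β *ᵥ (MStar φ P β *ᵥ ξ) = ξ := by
  rw [Matrix.mulVec_mulVec, hR.hess_mul, Matrix.one_mulVec]

/-- Restricted strong convexity turns the prediction error of an estimate into an `ℓ₂`-error. -/
lemma l2_error_le {z : Fin n → Obs p} (hn : 0 < n) {γ C₁ : ℝ} (hC₁ : 0 < C₁)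
    (hrsc : RestrictedConvex (weightedGram Finset.univ z
      fun i => truncWeight φ β (κ / (2 * Λ)) (z i)) (κ / 4) γ)
    (hderiv : ∀ i, dphi φ 2 (z i).2 ((z i).1 ⬝ᵥ β) ≤ C₆) {b : Fin p → ℝ}
    (hb : GoodEstimate C₁ β Finset.univ z b) (hγ0 : 0 ≤ γ) (hγ : γ * l0 β ≤ 1) :
    l2 (b - β) ≤ Real.sqrt (4 / κ * (C₆ * C₁ + C₁ ^ 2)) * (Real.sqrt (l0 β) * lam p n) := by
  have hκ := hR.κ_pos
  have hC6 := hR.C₆_pos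
  have hΛ := hR.Λ_pos
  have hlam := lam_nonneg (p := p) (n := n)
  set Δ := b - β with hΔ
  have h1 := hrsc Δ
  have h2 : Δ ⬝ᵥ (weightedGram Finset.univ z (fun i => truncWeight φ β (κ / (2 * Λ)) (z i)) *ᵥ Δ) ≤
      C₆ * (C₁ * l0 β * lam p n ^ 2) := by
    refine (quad_weightedGram_mono (w' := fun _ => C₆)
      (fun i _ => truncWeight_le (by positivity) hC6.le (hderiv i)) Δ).trans ?_
    rw [dot_weightedGram, ← Finset.mul_sum, mul_left_comm]
    refine mul_le_mul_of_nonneg_left (le_trans (le_of_eq ?_) (hb.2.trans (le_of_eq ?_))) hC6.le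
    · refine congrArg _ (Finset.sum_congr rfl fun i _ => ?_)
      rw [hΔ, dotProduct_comm, dotProduct_sub]; ring
    · rw [lam_sq hn]
  have h3 : γ * l1 Δ ^ 2 ≤ C₁ ^ 2 * (l0 β * lam p n ^ 2) := by
    have h4 : l1 Δ ^ 2 ≤ (C₁ * l0 β * lam p n) ^ 2 := pow_le_pow_left₀ (l1_nonneg _) hb.1 2
    calc γ * l1 Δ ^ 2 ≤ γ * (C₁ * l0 β * lam p n) ^ 2 := mul_le_mul_of_nonneg_left h4 hγ0
      _ = (γ * l0 β) * (C₁ ^ 2 * (l0 β * lam p n ^ 2)) := by ring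
      _ ≤ 1 * (C₁ ^ 2 * (l0 β * lam p n ^ 2)) := mul_le_mul_of_nonneg_right hγ (by positivity)
      _ = _ := one_mul _
  refine (sq_le_sq₀ (l2_nonneg _) (by positivity)).1 ?_
  rw [mul_pow, mul_pow, Real.sq_sqrt (by positivity), Real.sq_sqrt (Nat.cast_nonneg _)]
  have e : 4 / κ * (C₆ * C₁ + C₁ ^ 2) * (l0 β * lam p n ^ 2) =
      (C₆ * (C₁ * l0 β * lam p n ^ 2) + C₁ ^ 2 * (l0 β * lam p n ^ 2)) / (κ / 4) := by
    field_simp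
  rw [e, le_div_iff₀ (by positivity)]
  linarith

variable {K'' ρ ε e C₁ D : ℝ} {A : Finset (Fin n)} {m b : Fin p → ℝ} {z : Fin n → Obs p}

/-- The expansion of one half of the debiasing correction. -/
lemma correction_expansion (hn : 0 < n) (hA : 0 < A.card) (hρ : 0 < ρ) (hK'' : 0 < K'')
    (hD : 0 ≤ D)
    (hderiv : ∀ i, dphi φ 2 (z i).2 ((z i).1 ⬝ᵥ β) ≤ C₆ ∧ ∀ b, |dphi φ 3 (z i).2 b| ≤ C₇)
    (hF : FreshGood φ P β ξ K C₆ K'' ρ ε A m z) (hb : GoodEstimate C₁ β Finset.univ z b)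
    (hΔ : l2 (b - β) ≤ D * (Real.sqrt (l0 β) * lam p n))
    (hu : Real.sqrt (l0 β * logMax p n) * l2 (m - MStar φ P β *ᵥ ξ) ≤ e * l2 ξ) :
    |(n : ℝ)⁻¹ * ∑ i ∈ A, (m ⬝ᵥ (z i).1) * dphi φ 1 (z i).2 ((z i).1 ⬝ᵥ b) -
      (n : ℝ)⁻¹ * ∑ i ∈ A, ((MStar φ P β *ᵥ ξ) ⬝ᵥ (z i).1) * dphi φ 1 (z i).2 ((z i).1 ⬝ᵥ β) -
      A.card / n * (ξ ⬝ᵥ (b - β))| ≤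
    l2 ξ / Real.sqrt n * (ε + Λ * D * e +
      C₆ * K * K'' * (16 / Real.sqrt ρ) * C₁ * (l0 β * tau p n) +
      2 * K'' * C₇ * C₁ * (l0 β * Real.sqrt (Real.log n) * tau p n)) := by
  have hC6 := hR.C₆_pos
  have hC7 := hR.C₇_pos
  have hK := hR.K_pos
  have hΛ := hR.Λ_pos
  have hξ := hR.ξ_pos
  have hn' : (0 : ℝ) < n := by exact_mod_cast hn
  have hsn : 0 < Real.sqrt n := Real.sqrt_pos.2 hn'
  have hnn : Real.sqrt n * Real.sqrt n = n := Real.mul_self_sqrt hn'.le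
  have hA' : (0 : ℝ) < A.card := by exact_mod_cast hA
  have hAn : (A.card : ℝ) / n ≤ 1 := by
    rw [div_le_one hn']
    exact_mod_cast (Finset.card_le_univ A).trans (by simp)
  have hAn0 : 0 ≤ (A.card : ℝ) / n := by positivity
  have hlam := lam_nonneg (p := p) (n := n)
  have hlog : 0 ≤ Real.log n := Real.log_nonneg (by exact_mod_cast hn)
  set Δ := b - β with hΔdef
  set m₀ := MStar φ P β *ᵥ ξ with hm₀
  set u := m - m₀ with hu'
  set a : Fin n → ℝ := fun i => (z i).1 ⬝ᵥ Δ with ha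
  set f₁ : Fin n → ℝ := fun i => dphi φ 1 (z i).2 ((z i).1 ⬝ᵥ β) with hf₁
  set f₂ : Fin n → ℝ := fun i => dphi φ 2 (z i).2 ((z i).1 ⬝ᵥ β) with hf₂
  set R : Fin n → ℝ := fun i => dphi φ 1 (z i).2 ((z i).1 ⬝ᵥ b) - f₁ i - f₂ i * a i with hRdef
  have hRle : ∀ i, |R i| ≤ C₇ * a i ^ 2 := fun i => by
    have h1 := hR.loss.abs_dphi_one_sub_sub_le (hderiv i).2 ((z i).1 ⬝ᵥ β) (a i)
    have e1 : (z i).1 ⬝ᵥ β + a i = (z i).1 ⬝ᵥ b := by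
      simp only [ha, hΔdef, dotProduct_sub]; ring
    rwa [e1] at h1
  set W := weightedGram A z f₂ with hW
  have hWm : ∀ k, |(W *ᵥ m - Hess φ P β *ᵥ m) k| ≤
      C₆ * (K * (K'' * l2 ξ)) * (16 / Real.sqrt ρ) * lam p n := fun k => by
    rw [Pi.sub_apply, hW, weightedGram_mulVec]; exact hF.cross k
  have hsum2 : ∑ i ∈ A, f₂ i * ((m ⬝ᵥ (z i).1) * a i) = A.card * (Δ ⬝ᵥ (W *ᵥ m)) := by
    rw [hW, dot_weightedGram, ← mul_assoc, mul_inv_cancel₀ hA'.ne', one_mul]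
    refine Finset.sum_congr rfl fun i _ => ?_
    rw [ha, dotProduct_comm Δ]; ring
  have hHm : Δ ⬝ᵥ (Hess φ P β *ᵥ m) = ξ ⬝ᵥ Δ + Δ ⬝ᵥ (Hess φ P β *ᵥ u) := by
    have : m = m₀ + u := by rw [hu']; abel
    rw [this, Matrix.mulVec_add, hm₀, hR.hess_mulVec_mStar, dotProduct_add, dotProduct_comm Δ ξ]
  have ident : (n : ℝ)⁻¹ * ∑ i ∈ A, (m ⬝ᵥ (z i).1) * dphi φ 1 (z i).2 ((z i).1 ⬝ᵥ b) -
      (n : ℝ)⁻¹ * ∑ i ∈ A, (m₀ ⬝ᵥ (z i).1) * f₁ i - A.card / n * (ξ ⬝ᵥ Δ) =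
      (n : ℝ)⁻¹ * ∑ i ∈ A, (u ⬝ᵥ (z i).1) * f₁ i +
      A.card / n * (Δ ⬝ᵥ (Hess φ P β *ᵥ u)) +
      A.card / n * ((W *ᵥ m - Hess φ P β *ᵥ m) ⬝ᵥ Δ) +
      (n : ℝ)⁻¹ * ∑ i ∈ A, (m ⬝ᵥ (z i).1) * R i := by
    have e1 : ∑ i ∈ A, (m ⬝ᵥ (z i).1) * dphi φ 1 (z i).2 ((z i).1 ⬝ᵥ b) =
        ∑ i ∈ A, (m₀ ⬝ᵥ (z i).1) * f₁ i + ∑ i ∈ A, (u ⬝ᵥ (z i).1) * f₁ i +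
        ∑ i ∈ A, f₂ i * ((m ⬝ᵥ (z i).1) * a i) + ∑ i ∈ A, (m ⬝ᵥ (z i).1) * R i := by
      rw [← Finset.sum_add_distrib, ← Finset.sum_add_distrib, ← Finset.sum_add_distrib]
      refine Finset.sum_congr rfl fun i _ => ?_
      rw [hRdef, hu', sub_dotProduct]; ring
    rw [e1, hsum2, dotProduct_comm (W *ᵥ m - Hess φ P β *ᵥ m) Δ, dotProduct_sub Δ (W *ᵥ m), hHm]
    ring
  rw [ident]
  -- the score term
  have T1 : |(n : ℝ)⁻¹ * ∑ i ∈ A, (u ⬝ᵥ (z i).1) * f₁ i| ≤ l2 ξ / Real.sqrt n * ε := by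
    rw [abs_mul, abs_of_pos (inv_pos.2 hn'), inv_mul_le_iff₀ hn']
    refine hF.score.trans (le_of_eq ?_)
    have e : (n : ℝ) * (l2 ξ / Real.sqrt n * ε) = Real.sqrt n * Real.sqrt n *
        (l2 ξ / Real.sqrt n * ε) := by rw [hnn]
    rw [e]; field_simp
  -- the bias caused by the error of the estimated direction
  have T2 : |A.card / n * (Δ ⬝ᵥ (Hess φ P β *ᵥ u))| ≤ l2 ξ / Real.sqrt n * (Λ * D * e) := by
    rw [abs_mul, abs_of_nonneg hAn0]
    have h1 := abs_dot_mulVec_le (hess_isSymm (φ := φ) (P := P) (β := β))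
      (fun x => (mul_nonneg hR.κ_pos.le (sq_nonneg _)).trans (hR.hess_lower x)) hΛ.le
      hR.hess_upper Δ u
    refine (mul_le_of_le_one_left (abs_nonneg _) hAn).trans (h1.trans ?_)
    have h2 : Real.sqrt (l0 β) * lam p n = Real.sqrt (l0 β * logMax p n) / Real.sqrt n := by
      rw [lam, Real.sqrt_div (logMax_nonneg hn), Real.sqrt_mul (Nat.cast_nonneg _), mul_div_assoc]
    rw [h2] at hΔ
    have h3 := mul_le_mul_of_nonneg_right hΔ (l2_nonneg u)
    have h4 : D * (Real.sqrt (l0 β * logMax p n) / Real.sqrt n) * l2 u ≤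
        D * (e * l2 ξ) / Real.sqrt n := by
      have := mul_le_mul_of_nonneg_left hu hD
      rw [le_div_iff₀ hsn]
      refine le_trans (le_of_eq ?_) this
      field_simp
    refine (mul_le_mul_of_nonneg_left (h3.trans h4) hΛ.le).trans (le_of_eq ?_)
    ring
  -- the fluctuation of the Hessian in the estimated direction
  have T3 : |A.card / n * ((W *ᵥ m - Hess φ P β *ᵥ m) ⬝ᵥ Δ)| ≤ l2 ξ / Real.sqrt n *
      (C₆ * K * K'' * (16 / Real.sqrt ρ) * C₁ * (l0 β * tau p n)) := by
    rw [abs_mul, abs_of_nonneg hAn0]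
    refine (mul_le_of_le_one_left (abs_nonneg _) hAn).trans ((abs_dot_le_l1 hWm Δ).trans ?_)
    refine (mul_le_mul_of_nonneg_left hb.1 (by positivity)).trans (le_of_eq ?_)
    have := lam_sq_eq_tau (p := p) hn
    calc _ = C₆ * K * K'' * (16 / Real.sqrt ρ) * C₁ * l0 β * l2 ξ * lam p n ^ 2 := by ring
      _ = _ := by rw [this]; ring
  have ha2 : (n : ℝ)⁻¹ * ∑ i ∈ A, a i ^ 2 ≤ C₁ * l0 β * lam p n ^ 2 := by
    have h1 := hb.2
    rw [Finset.card_univ, Fintype.card_fin, ← lam_sq hn] at h1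
    refine le_trans (mul_le_mul_of_nonneg_left ?_ (by positivity)) h1
    refine (Finset.sum_le_sum_of_subset_of_nonneg (Finset.subset_univ A)
      fun _ _ _ => sq_nonneg _).trans (le_of_eq (Finset.sum_congr rfl fun i _ => ?_))
    simp only [ha, hΔdef, dotProduct_sub]
  -- the quadratic remainder
  have T4 : |(n : ℝ)⁻¹ * ∑ i ∈ A, (m ⬝ᵥ (z i).1) * R i| ≤ l2 ξ / Real.sqrt n *
      (2 * K'' * C₇ * C₁ * (l0 β * Real.sqrt (Real.log n) * tau p n)) := by
    have hlin : ∀ i ∈ A, |m ⬝ᵥ (z i).1| ≤ 2 * K'' * l2 ξ * Real.sqrt (Real.log n) := fun i hi => by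
      refine abs_le_of_sq_le_sq ?_ (by positivity)
      have := hF.lin i hi
      rw [div_le_iff₀ (by positivity)] at this
      rw [mul_pow, Real.sq_sqrt hlog]
      nlinarith [mul_nonneg hlog (sq_nonneg (K'' * l2 ξ))]
    have h1 : |∑ i ∈ A, (m ⬝ᵥ (z i).1) * R i| ≤
        2 * K'' * l2 ξ * Real.sqrt (Real.log n) * C₇ * ∑ i ∈ A, a i ^ 2 := by
      refine (Finset.abs_sum_le_sum_abs _ _).trans ?_
      rw [Finset.mul_sum]
      refine Finset.sum_le_sum fun i hi => ?_
      rw [abs_mul, mul_assoc _ C₇]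
      exact mul_le_mul (hlin i hi) (hRle i) (abs_nonneg _) (by positivity)
    rw [abs_mul, abs_of_pos (inv_pos.2 hn')]
    refine (mul_le_mul_of_nonneg_left h1 (inv_pos.2 hn').le).trans ?_
    rw [mul_left_comm]
    refine (mul_le_mul_of_nonneg_left ha2 (by positivity)).trans (le_of_eq ?_)
    rw [lam_sq_eq_tau hn]; ring
  refine (abs_add_le _ _).trans ((add_le_add ((abs_add_le _ _).trans (add_le_add
    ((abs_add_le _ _).trans (add_le_add T1 T2)) T3)) T4).trans (le_of_eq ?_))
  ring

/-- The expansion of one half of the variance estimator; `t` is a free parameter. -/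
lemma variance_expansion (hn : 0 < n) (hK'' : 0 < K'')
    (hderiv : ∀ i, dphi φ 2 (z i).2 ((z i).1 ⬝ᵥ β) ≤ C₆ ∧ ∀ b, |dphi φ 3 (z i).2 b| ≤ C₇)
    (hF : FreshGood φ P β ξ K C₆ K'' ρ ε A m z) (hb : GoodEstimate C₁ β Finset.univ z b)
    (hmax : ∀ i, |(z i).1 ⬝ᵥ (b - β)| ≤ 1) {t : ℝ} (ht : 0 < t) :
    |(n : ℝ)⁻¹ * ∑ i ∈ A, (m ⬝ᵥ (z i).1) ^ 2 * dphi φ 1 (z i).2 ((z i).1 ⬝ᵥ b) ^ 2 -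
      (n : ℝ)⁻¹ * ∑ i ∈ A, ((MStar φ P β *ᵥ ξ) ⬝ᵥ (z i).1) ^ 2 *
        dphi φ 1 (z i).2 ((z i).1 ⬝ᵥ β) ^ 2| ≤
    (1 + 1 / t) * (l2 ξ ^ 2 * (2 * ε +
      4 * K'' ^ 2 * (C₆ + C₇) ^ 2 * C₁ * (Real.log n * l0 β * lam p n ^ 2))) +
    t * ((n : ℝ)⁻¹ * ∑ i ∈ A, ((MStar φ P β *ᵥ ξ) ⬝ᵥ (z i).1) ^ 2 *
        dphi φ 1 (z i).2 ((z i).1 ⬝ᵥ β) ^ 2) := by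
  have hC6 := hR.C₆_pos
  have hC7 := hR.C₇_pos
  have hξ := hR.ξ_pos
  have hn' : (0 : ℝ) < n := by exact_mod_cast hn
  have hlog : 0 ≤ Real.log n := Real.log_nonneg (by exact_mod_cast hn)
  set Δ := b - β with hΔdef
  set m₀ := MStar φ P β *ᵥ ξ with hm₀
  set x : Fin n → ℝ := fun i => (m ⬝ᵥ (z i).1) * dphi φ 1 (z i).2 ((z i).1 ⬝ᵥ b) with hx
  set y : Fin n → ℝ := fun i => (m₀ ⬝ᵥ (z i).1) * dphi φ 1 (z i).2 ((z i).1 ⬝ᵥ β) with hy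
  have hdphi : ∀ i, |dphi φ 1 (z i).2 ((z i).1 ⬝ᵥ b) - dphi φ 1 (z i).2 ((z i).1 ⬝ᵥ β)| ≤
      (C₆ + C₇) * |(z i).1 ⬝ᵥ Δ| := fun i => by
    have h1 := hR.loss.abs_dphi_one_sub_le (hderiv i).2 (hderiv i).1 ((z i).1 ⬝ᵥ Δ)
    have e1 : (z i).1 ⬝ᵥ β + (z i).1 ⬝ᵥ Δ = (z i).1 ⬝ᵥ b := by rw [hΔdef, dotProduct_sub]; ring
    rw [e1] at h1
    refine h1.trans (mul_le_mul_of_nonneg_right ?_ (abs_nonneg _))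
    nlinarith [hmax i]
  have ha2 : ∑ i ∈ A, ((z i).1 ⬝ᵥ Δ) ^ 2 ≤ n * (C₁ * l0 β * lam p n ^ 2) := by
    have h1 := hb.2
    rw [Finset.card_univ, Fintype.card_fin, ← lam_sq hn, inv_mul_le_iff₀ hn'] at h1
    refine le_trans ?_ h1
    refine (Finset.sum_le_sum_of_subset_of_nonneg (Finset.subset_univ A)
      fun _ _ _ => sq_nonneg _).trans (le_of_eq (Finset.sum_congr rfl fun i _ => ?_))
    simp only [hΔdef, dotProduct_sub]
  have hD : ∑ i ∈ A, (x i - y i) ^ 2 ≤ n * (l2 ξ ^ 2 * (2 * ε +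
      4 * K'' ^ 2 * (C₆ + C₇) ^ 2 * C₁ * (Real.log n * l0 β * lam p n ^ 2))) := by
    have pt : ∀ i ∈ A, (x i - y i) ^ 2 ≤
        4 * Real.log n * (K'' * l2 ξ) ^ 2 * (C₆ + C₇) ^ 2 * ((z i).1 ⬝ᵥ Δ) ^ 2 +
        2 * (((m - m₀) ⬝ᵥ (z i).1) ^ 2 * dphi φ 1 (z i).2 ((z i).1 ⬝ᵥ β) ^ 2) := fun i hi => by
      have h1 := hF.lin i hi
      rw [div_le_iff₀ (by positivity)] at h1
      have h2 : (dphi φ 1 (z i).2 ((z i).1 ⬝ᵥ b) - dphi φ 1 (z i).2 ((z i).1 ⬝ᵥ β)) ^ 2 ≤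
          (C₆ + C₇) ^ 2 * ((z i).1 ⬝ᵥ Δ) ^ 2 := by
        rw [← sq_abs, ← sq_abs ((z i).1 ⬝ᵥ Δ), ← mul_pow]
        exact pow_le_pow_left₀ (abs_nonneg _) (hdphi i) 2
      have e1 : x i - y i = (m ⬝ᵥ (z i).1) * (dphi φ 1 (z i).2 ((z i).1 ⬝ᵥ b) -
          dphi φ 1 (z i).2 ((z i).1 ⬝ᵥ β)) +
          ((m - m₀) ⬝ᵥ (z i).1) * dphi φ 1 (z i).2 ((z i).1 ⬝ᵥ β) := by
        rw [hx, hy, sub_dotProduct]; ring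
      rw [e1]
      refine (add_sq_le).trans ?_
      rw [mul_pow, mul_pow]
      have h3 := mul_le_mul h1 h2 (sq_nonneg _) (by positivity)
      linarith
    refine (Finset.sum_le_sum pt).trans ?_
    rw [Finset.sum_add_distrib, ← Finset.mul_sum, ← Finset.mul_sum]
    have h4 := mul_le_mul_of_nonneg_left ha2
      (by positivity : 0 ≤ 4 * Real.log n * (K'' * l2 ξ) ^ 2 * (C₆ + C₇) ^ 2)
    have h5 := hF.sq
    have e2 : (n : ℝ) * (l2 ξ ^ 2 * (2 * ε +
        4 * K'' ^ 2 * (C₆ + C₇) ^ 2 * C₁ * (Real.log n * l0 β * lam p n ^ 2))) =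
        4 * Real.log n * (K'' * l2 ξ) ^ 2 * (C₆ + C₇) ^ 2 * (n * (C₁ * l0 β * lam p n ^ 2)) +
        2 * (ε * (n * l2 ξ ^ 2)) := by ring
    rw [e2]
    linarith
  have pt2 : ∀ i, |x i ^ 2 - y i ^ 2| ≤ (1 + 1 / t) * (x i - y i) ^ 2 + t * y i ^ 2 := fun i => by
    have e1 : x i ^ 2 - y i ^ 2 = (x i - y i) ^ 2 + 2 * (y i * (x i - y i)) := by ring
    have h1 : |2 * (y i * (x i - y i))| ≤ 1 / t * (x i - y i) ^ 2 + t * y i ^ 2 := by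
      have e2 : 1 / t * (x i - y i) ^ 2 = t * ((x i - y i) / t) ^ 2 := by field_simp
      have e3 : y i * (x i - y i) = t * (y i * ((x i - y i) / t)) := by field_simp
      rw [e2, e3, abs_le]
      constructor
      · nlinarith [mul_nonneg ht.le (sq_nonneg (y i + (x i - y i) / t))]
      · nlinarith [mul_nonneg ht.le (sq_nonneg (y i - (x i - y i) / t))]
    rw [e1]
    refine (abs_add_le _ _).trans ?_
    rw [abs_of_nonneg (sq_nonneg (x i - y i))]
    linarith
  have e3 : ∀ i, (m ⬝ᵥ (z i).1) ^ 2 * dphi φ 1 (z i).2 ((z i).1 ⬝ᵥ b) ^ 2 = x i ^ 2 :=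
    fun i => by rw [hx, mul_pow]
  have e4 : ∀ i, (m₀ ⬝ᵥ (z i).1) ^ 2 * dphi φ 1 (z i).2 ((z i).1 ⬝ᵥ β) ^ 2 = y i ^ 2 :=
    fun i => by rw [hy, mul_pow]
  simp only [e3, e4]
  rw [← mul_sub, ← Finset.sum_sub_distrib, abs_mul, abs_of_pos (inv_pos.2 hn')]
  calc (n : ℝ)⁻¹ * |∑ i ∈ A, (x i ^ 2 - y i ^ 2)|
      ≤ (n : ℝ)⁻¹ * ∑ i ∈ A, ((1 + 1 / t) * (x i - y i) ^ 2 + t * y i ^ 2) := by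
        refine mul_le_mul_of_nonneg_left ((Finset.abs_sum_le_sum_abs _ _).trans
          (Finset.sum_le_sum fun i _ => pt2 i)) (inv_pos.2 hn').le
    _ = (1 + 1 / t) * ((n : ℝ)⁻¹ * ∑ i ∈ A, (x i - y i) ^ 2) +
        t * ((n : ℝ)⁻¹ * ∑ i ∈ A, y i ^ 2) := by
        rw [Finset.sum_add_distrib, ← Finset.mul_sum, ← Finset.mul_sum]; ring
    _ ≤ _ := by
        refine add_le_add_left (mul_le_mul_of_nonneg_left ?_ (by positivity)) _
        rwa [inv_mul_le_iff₀ hn']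

end Regular

end Expansion

/-! ### Probabilities of the good events -/

lemma SubGauss.add {α : Type*} [MeasurableSpace α] {P : Measure α} {f g : α → ℝ} {K : ℝ}
    (hf : SubGauss P f K) (hg : SubGauss P g K) (hK : 0 < K) (mf : Measurable f) :
    SubGauss P (fun x => f x + g x) (2 * K) := by
  have pt : ∀ x, Real.exp ((f x + g x) ^ 2 / (2 * K) ^ 2) ≤
      1 / 2 * Real.exp (f x ^ 2 / K ^ 2) + 1 / 2 * Real.exp (g x ^ 2 / K ^ 2) := fun x => by
    have hcx := convexOn_exp.2 (Set.mem_univ (f x ^ 2 / K ^ 2)) (Set.mem_univ (g x ^ 2 / K ^ 2))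
      (by norm_num : (0 : ℝ) ≤ 1 / 2) (by norm_num : (0 : ℝ) ≤ 1 / 2) (by norm_num)
    simp only [smul_eq_mul] at hcx
    refine le_trans (Real.exp_le_exp.2 ?_) hcx
    rw [← mul_add, ← add_div, ← mul_div_assoc, div_le_div_iff₀ (by positivity) (by positivity)]
    nlinarith [mul_nonneg (sq_nonneg K) (sq_nonneg (f x - g x)), sq_nonneg (f x), sq_nonneg (g x),
      mul_nonneg (sq_nonneg K) (sq_nonneg (f x)), mul_nonneg (sq_nonneg K) (sq_nonneg (g x))]
  have half : ∀ h : α → ℝ, SubGauss P h K →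
      ∫⁻ x, ENNReal.ofReal (1 / 2 * Real.exp (h x ^ 2 / K ^ 2)) ∂P ≤ 1 := fun h hh => by
    simp only [ENNReal.ofReal_mul (by norm_num : (0 : ℝ) ≤ 1 / 2)]
    rw [lintegral_const_mul' _ _ ENNReal.ofReal_ne_top]
    refine (mul_le_mul_right (show _ ≤ (2 : ℝ≥0∞) from hh) _).trans (le_of_eq ?_)
    rw [show (2 : ℝ≥0∞) = ENNReal.ofReal 2 by simp, ← ENNReal.ofReal_mul (by norm_num)]
    norm_num
  calc ∫⁻ x, ENNReal.ofReal (Real.exp ((f x + g x) ^ 2 / (2 * K) ^ 2)) ∂P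
      ≤ ∫⁻ x, (ENNReal.ofReal (1 / 2 * Real.exp (f x ^ 2 / K ^ 2)) +
          ENNReal.ofReal (1 / 2 * Real.exp (g x ^ 2 / K ^ 2))) ∂P := by
        refine lintegral_mono fun x => ?_
        rw [← ENNReal.ofReal_add (by positivity) (by positivity)]
        exact ENNReal.ofReal_le_ofReal (pt x)
    _ ≤ 1 + 1 := by
        rw [lintegral_add_left (by fun_prop)]
        exact add_le_add (half f hf) (half g hg)
    _ = 2 := one_add_one_eq_two

section Events

variable {n p : ℕ} {Ω : Type*} [MeasurableSpace Ω] {μ : Measure Ω} {P : Measure (Obs p)}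
  {Z : Fin n → Ω → Obs p} {φ : ℝ → ℝ → ℝ} {β ξ : Fin p → ℝ}
  {N : (Fin p → ℝ) → ℝ} {K C₆ C₇ σ κ Λ K' v : ℝ} [IsProbabilityMeasure P]

lemma IsSample.bernstein_hess (hR : Regular φ P β ξ N K C₆ C₇ σ κ Λ K' v) (hS : IsSample μ P Z)
    {A : Finset (Fin n)} (hn : 0 < n) {ρ : ℝ} (hρ : 0 < ρ) (hA : ρ * n ≤ A.card)
    (hlam : logMax p n / n ≤ ρ) :
    μ {ω | ¬ ∀ jk : Fin p × Fin p, |(A.card : ℝ)⁻¹ * ∑ i ∈ A,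
      dphi φ 2 (Z i ω).2 ((Z i ω).1 ⬝ᵥ β) *
      ((Z i ω).1 jk.1 * (MStar φ P β *ᵥ (Z i ω).1) jk.2) -
        (1 : Matrix (Fin p) (Fin p) ℝ) jk.1 jk.2| ≤
      C₆ * (K * K) * (16 / Real.sqrt ρ) * lam p n} ≤
      ENNReal.ofReal (2 * Real.exp (-(2 * logMax p n))) := by
  have hK := hR.K_pos
  have hC := hR.C₆_pos
  have m2 := hR.loss.measurable_dphi_comp (by norm_num : 2 ≤ 3) β
  have hcard : (Fintype.card (Fin p × Fin p) : ℝ) ≤ Real.exp (2 * logMax p n) := by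
    obtain ⟨h1, -⟩ := natCast_le_exp_logMax (p := p) hn
    rw [Fintype.card_prod, Fintype.card_fin, Nat.cast_mul, two_mul, Real.exp_add]
    exact mul_le_mul h1 h1 (Nat.cast_nonneg _) (Real.exp_pos _).le
  have := hS.bernstein_max hn hρ hA hlam hcard
    (f := fun jk z => dphi φ 2 z.2 (z.1 ⬝ᵥ β) * (z.1 jk.1 * (MStar φ P β *ᵥ z.1) jk.2))
    (fun jk => m2.mul ((measurable_coord _).mul (measurable_mulVec _ _)))
    (K := C₆ * (K * K)) (by positivity)
    (fun jk => hR.weight_subExp (hR.coord _) (hR.mcoord _) hK hK (measurable_coord _)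
      hR.hess_weight)
  simpa only [hR.integral_hess_mStar] using this

/-- A good design is likely; the hypothesis `hrsc` is the only part that depends on the tail
assumption on the covariates. -/
lemma IsSample.measure_not_goodDesign_le (hR : Regular φ P β ξ N K C₆ C₇ σ κ Λ K' v)
    (hS : IsSample μ P Z) {A : Finset (Fin n)} (hn : 0 < n) {ρ : ℝ} (hρ : 0 < ρ)
    (hA : ρ * n ≤ A.card) (hlam : logMax p n / n ≤ ρ) (hL1 : 1 ≤ logMax p n)
    (hL2 : 24 * logMax p n ^ 2 ≤ ρ * n) {γ : ℝ} {δ : ℝ≥0∞}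
    (hrsc : μ {ω | (∀ i, truncWeight φ β (κ / (2 * Λ)) (Z i ω) ≤ C₆) ∧
        (∀ j, ∑ i ∈ A, (Z i ω).1 j ^ 4 ≤ A.card * (773 * K ^ 4)) ∧
        ¬ RestrictedConvex (weightedGram A (fun i => Z i ω)
          fun i => truncWeight φ β (κ / (2 * Λ)) (Z i ω)) (κ / 4) γ} ≤ δ) :
    μ {ω | ¬ GoodDesign φ P β K C₆ C₇ κ Λ ρ γ A (fun i => Z i ω)} ≤
      ENNReal.ofReal (10 * Real.exp (-(2 * logMax p n))) + δ := by
  have hK := hR.K_pos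
  have hκ := hR.κ_pos
  have hΛ := hR.Λ_pos
  have h1 := hS.bernstein_hess hR hn hρ hA hlam
  have h2 := hS.fourth_max hn hA hL1 hL2 measurable_coord hK hR.coord
  have h3 := hS.fourth_max hn hA hL1 hL2 (measurable_mulVec (MStar φ P β)) hK hR.mcoord
  have h4 := hS.tail_max hn measurable_coord hR.coord
  have h5 : μ {ω | ¬ ∀ i, dphi φ 2 (Z i ω).2 ((Z i ω).1 ⬝ᵥ β) ≤ C₆ ∧
      ∀ b, |dphi φ 3 (Z i ω).2 b| ≤ C₇} = 0 := hS.ae_all hR.deriv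
  set E := Real.exp (-(2 * logMax p n)) with hE
  have hE0 : 0 < E := Real.exp_pos _
  have e10 : ENNReal.ofReal (10 * E) = ENNReal.ofReal (2 * E) + ENNReal.ofReal (3 * E) +
      ENNReal.ofReal (3 * E) + ENNReal.ofReal (2 * E) + 0 := by
    rw [← ENNReal.ofReal_add, ← ENNReal.ofReal_add, ← ENNReal.ofReal_add, add_zero]
    · ring_nf
    all_goals positivity
  rw [e10]
  refine le_trans ?_ (add_le_add (add_le_add (add_le_add (add_le_add (add_le_add h1 h2) h3) h4)
    h5.le) hrsc)
  refine le_trans (measure_mono fun ω hω => ?_) ((measure_union_le _ _).trans (add_le_add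
    ((measure_union_le _ _).trans (add_le_add ((measure_union_le _ _).trans (add_le_add
    ((measure_union_le _ _).trans (add_le_add (measure_union_le _ _) le_rfl)) le_rfl)) le_rfl))
    le_rfl))
  rw [Set.mem_ofPred_eq] at hω
  simp only [Set.mem_union, Set.mem_ofPred_eq]
  by_contra hcon
  simp only [not_or, not_not] at hcon
  obtain ⟨⟨⟨⟨⟨g1, g2⟩, g3⟩, g4⟩, g5⟩, g6⟩ := hcon
  have gw : ∀ i, truncWeight φ β (κ / (2 * Λ)) (Z i ω) ≤ C₆ := fun i =>
    truncWeight_le (by positivity) hR.C₆_pos.le (g5 i).1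
  refine hω ⟨fun j k => g1 (j, k), g2, g3, g4, ?_, g5⟩
  by_contra hc
  exact g6 ⟨gw, g2, hc⟩

variable {K'' ρ ε e : ℝ}

omit [IsProbabilityMeasure P] in
lemma measurableSet_freshGood (hφ : IsLoss φ) (A : Finset (Fin n)) :
    MeasurableSet {q : (Fin p → ℝ) × (Fin n → Obs p) |
      FreshGood φ P β ξ K C₆ K'' ρ ε A q.1 q.2} := by
  have mz : ∀ i, Measurable fun q : (Fin p → ℝ) × (Fin n → Obs p) => q.2 i := fun i => by fun_prop
  have m1 : ∀ i, Measurable fun q : (Fin p → ℝ) × (Fin n → Obs p) =>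
      dphi φ 1 (q.2 i).2 ((q.2 i).1 ⬝ᵥ β) := fun i =>
    (hφ.measurable_dphi_comp (by norm_num) β).comp (mz i)
  have m2 : ∀ i, Measurable fun q : (Fin p → ℝ) × (Fin n → Obs p) =>
      dphi φ 2 (q.2 i).2 ((q.2 i).1 ⬝ᵥ β) := fun i =>
    (hφ.measurable_dphi_comp (by norm_num) β).comp (mz i)
  have md : ∀ i, Measurable fun q : (Fin p → ℝ) × (Fin n → Obs p) => q.1 ⬝ᵥ (q.2 i).1 :=
    fun i => by unfold dotProduct; fun_prop
  have mu : ∀ i, Measurable fun q : (Fin p → ℝ) × (Fin n → Obs p) =>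
      (q.1 - MStar φ P β *ᵥ ξ) ⬝ᵥ (q.2 i).1 := fun i => by
    simp only [sub_dotProduct]
    exact (md i).sub ((measurable_dot _).comp (mz i))
  have mH : ∀ k, Measurable fun q : (Fin p → ℝ) × (Fin n → Obs p) =>
      (Hess φ P β *ᵥ q.1) k := fun k => by unfold Matrix.mulVec dotProduct; fun_prop
  have mc : ∀ i k, Measurable fun q : (Fin p → ℝ) × (Fin n → Obs p) => (q.2 i).1 k :=
    fun i k => by fun_prop
  have e : {q : (Fin p → ℝ) × (Fin n → Obs p) | FreshGood φ P β ξ K C₆ K'' ρ ε A q.1 q.2} =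
      (({q | |∑ i ∈ A, ((q.1 - MStar φ P β *ᵥ ξ) ⬝ᵥ (q.2 i).1) *
          dphi φ 1 (q.2 i).2 ((q.2 i).1 ⬝ᵥ β)| ≤ ε * (l2 ξ * Real.sqrt n)} ∩
        ⋂ k, {q | |(A.card : ℝ)⁻¹ * ∑ i ∈ A, dphi φ 2 (q.2 i).2 ((q.2 i).1 ⬝ᵥ β) *
          ((q.2 i).1 k * (q.1 ⬝ᵥ (q.2 i).1)) - (Hess φ P β *ᵥ q.1) k| ≤
          C₆ * (K * (K'' * l2 ξ)) * (16 / Real.sqrt ρ) * lam p n}) ∩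
        ⋂ i ∈ A, {q | (q.1 ⬝ᵥ (q.2 i).1) ^ 2 / (K'' * l2 ξ) ^ 2 ≤ 2 * Real.log n}) ∩
        {q | ∑ i ∈ A, ((q.1 - MStar φ P β *ᵥ ξ) ⬝ᵥ (q.2 i).1) ^ 2 *
          dphi φ 1 (q.2 i).2 ((q.2 i).1 ⬝ᵥ β) ^ 2 ≤ ε * (n * l2 ξ ^ 2)} := by
    ext q
    simp only [Set.mem_inter_iff, Set.mem_iInter, Set.mem_ofPred_eq]
    exact ⟨fun h => ⟨⟨⟨h.score, h.cross⟩, h.lin⟩, h.sq⟩, fun h => ⟨h.1.1.1, h.1.1.2, h.1.2, h.2⟩⟩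
  rw [e]
  refine (((measurableSet_le ?_ measurable_const).inter (MeasurableSet.iInter fun k =>
    measurableSet_le ?_ measurable_const)).inter (MeasurableSet.iInter fun i =>
    MeasurableSet.iInter fun _ => measurableSet_le ?_ measurable_const)).inter
    (measurableSet_le ?_ measurable_const)
  · exact (Finset.measurable_fun_sum _ fun i _ => (mu i).mul (m1 i)).abs
  · exact (((Finset.measurable_fun_sum _ fun i _ =>
      (m2 i).mul ((mc i k).mul (md i))).const_mul _).sub (mH k)).abs
  · exact ((md i).pow_const 2).div_const _
  · exact Finset.measurable_fun_sum _ fun i _ => ((mu i).pow_const 2).mul ((m1 i).pow_const 2)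

omit [IsProbabilityMeasure P] in
lemma FreshGood.congr {A : Finset (Fin n)} {m : Fin p → ℝ} {z z' : Fin n → Obs p}
    (h : ∀ i ∈ A, z i = z' i) (hF : FreshGood φ P β ξ K C₆ K'' ρ ε A m z) :
    FreshGood φ P β ξ K C₆ K'' ρ ε A m z' := by
  refine ⟨?_, fun k => ?_, fun i hi => ?_, ?_⟩
  · refine le_trans (le_of_eq ?_) hF.score
    exact congrArg _ (Finset.sum_congr rfl fun i hi => by rw [h i hi])
  · refine le_trans (le_of_eq ?_) (hF.cross k)
    have : ∑ i ∈ A, dphi φ 2 (z' i).2 ((z' i).1 ⬝ᵥ β) * ((z' i).1 k * (m ⬝ᵥ (z' i).1)) =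
        ∑ i ∈ A, dphi φ 2 (z i).2 ((z i).1 ⬝ᵥ β) * ((z i).1 k * (m ⬝ᵥ (z i).1)) :=
      Finset.sum_congr rfl fun i hi => by rw [h i hi]
    rw [this]
  · rw [← h i hi]; exact hF.lin i hi
  · refine le_trans (le_of_eq ?_) hF.sq
    exact Finset.sum_congr rfl fun i hi => by rw [h i hi]

variable [IsProbabilityMeasure μ]

/-- For a fixed direction close to `M* ξ` the subsample behaves well with high probability. -/
lemma IsSample.measure_not_freshGood_le (hR : Regular φ P β ξ N K C₆ C₇ σ κ Λ K' v)
    (hS : IsSample μ P Z) {A : Finset (Fin n)} (hn : 0 < n) (hρ : 0 < ρ)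
    (hA : ρ * n ≤ A.card) (hlam : logMax p n / n ≤ ρ) (he : 0 < e) (he1 : e ≤ 1) (hε : 0 < ε)
    {m : Fin p → ℝ} (hm : N (m - MStar φ P β *ᵥ ξ) ≤ e * l2 ξ) :
    μ {ω | ¬ FreshGood φ P β ξ K C₆ (2 * (K' + 1)) ρ ε A m (fun i => Z i ω)} ≤
      ENNReal.ofReal (4 * e ^ 2 * σ ^ 2 / ε ^ 2 + 4 * e ^ 2 * σ ^ 2 / ε +
        2 * Real.exp (-(2 * logMax p n)) + 2 / n) := by
  have hK := hR.K_pos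
  have hK' := hR.K'_pos
  have hC := hR.C₆_pos
  have hσ := hR.σ_pos
  have hξ := hR.ξ_pos
  have hn' : (0 : ℝ) < n := by exact_mod_cast hn
  have hsn : Real.sqrt n ^ 2 = n := Real.sq_sqrt hn'.le
  have hAn : (A.card : ℝ) ≤ n := by
    exact_mod_cast (Finset.card_le_univ A).trans (by simp)
  set m₀ := MStar φ P β *ᵥ ξ with hm₀
  set u := m - m₀ with hu
  have m1 := hR.loss.measurable_dphi_comp (by norm_num : 1 ≤ 3) β
  have m2 := hR.loss.measurable_dphi_comp (by norm_num : 2 ≤ 3) β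
  have su : SubGauss P (fun z : Obs p => u ⬝ᵥ z.1) (e * l2 ξ) := hR.N_sub u _ (by positivity) hm
  have sm : SubGauss P (fun z : Obs p => m ⬝ᵥ z.1) (2 * (K' + 1) * l2 ξ) := by
    have h1 := hR.loading.mono (K' := (K' + 1) * l2 ξ) (by positivity) (by nlinarith)
    have h2 := su.mono (K' := (K' + 1) * l2 ξ) (by positivity) (by nlinarith)
    have h3 := h1.add h2 (by positivity) (measurable_dot _)
    have e1 : ∀ z : Obs p, m₀ ⬝ᵥ z.1 + u ⬝ᵥ z.1 = m ⬝ᵥ z.1 := fun z => by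
      rw [hu, sub_dotProduct]; ring
    simp only [← hm₀, e1] at h3
    rwa [mul_assoc]
  obtain ⟨i2, b2⟩ := su.integral_mul_pow_le hR.score (by positivity) hσ (measurable_dot _) m1 1
  simp only [pow_one, mul_one, Nat.factorial_two, Nat.cast_ofNat] at i2 b2
  have hb2 : ∫ z, (u ⬝ᵥ z.1) ^ 2 * dphi φ 1 z.2 (z.1 ⬝ᵥ β) ^ 2 ∂P ≤
      4 * e ^ 2 * σ ^ 2 * l2 ξ ^ 2 := b2.trans (le_of_eq (by ring))
  have hb0 : 0 ≤ ∫ z, (u ⬝ᵥ z.1) ^ 2 * dphi φ 1 z.2 (z.1 ⬝ᵥ β) ^ 2 ∂P :=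
    integral_nonneg fun z => mul_nonneg (sq_nonneg _) (sq_nonneg _)
  have B1 := hS.chebyshev A (f := fun z => (u ⬝ᵥ z.1) * dphi φ 1 z.2 (z.1 ⬝ᵥ β))
    ((measurable_dot _).mul m1) (by simpa only [mul_pow] using i2)
    (t := ε * (l2 ξ * Real.sqrt n)) (by positivity)
  rw [hR.score_mean, mul_zero] at B1
  simp only [sub_zero, mul_pow, hsn] at B1
  have B4 := hS.markov A (f := fun z => (u ⬝ᵥ z.1) ^ 2 * dphi φ 1 z.2 (z.1 ⬝ᵥ β) ^ 2)
    (((measurable_dot _).pow_const 2).mul (m1.pow_const 2))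
    (fun z => mul_nonneg (sq_nonneg _) (sq_nonneg _)) i2 (t := ε * (n * l2 ξ ^ 2)) (by positivity)
  have hcardp : (Fintype.card (Fin p) : ℝ) ≤ Real.exp (2 * logMax p n) := by
    rw [Fintype.card_fin]
    exact (natCast_le_exp_logMax hn).1.trans (Real.exp_le_exp.2 (by
      linarith [logMax_nonneg (p := p) hn]))
  have B2 := hS.bernstein_max hn hρ hA hlam hcardp
    (f := fun k z => dphi φ 2 z.2 (z.1 ⬝ᵥ β) * (z.1 k * (m ⬝ᵥ z.1)))
    (fun k => m2.mul ((measurable_coord _).mul (measurable_dot _)))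
    (K := C₆ * (K * (2 * (K' + 1) * l2 ξ))) (by positivity)
    (fun k => hR.weight_subExp (hR.coord _) sm hK (by positivity) (measurable_coord _)
      hR.hess_weight)
  have mean : ∀ k, ∫ z, dphi φ 2 z.2 (z.1 ⬝ᵥ β) * (z.1 k * (m ⬝ᵥ z.1)) ∂P =
      (Hess φ P β *ᵥ m) k := fun k => by
    have h := (integral_weighted_quad (hR.integrable_weight m2 hR.hess_weight)
      (Pi.single k 1) m).2
    simp only [single_one_dotProduct] at h
    exact h
  simp only [mean] at B2
  have B3 := measure_exists_le (μ := μ) (ι := Fin n)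
    (fun i => hS.tail (x := 2 * Real.log n) i (measurable_dot m) sm)
  have c3 : Fintype.card (Fin n) * (2 * Real.exp (-(2 * Real.log n))) = 2 / n := by
    rw [Fintype.card_fin, Real.exp_neg, two_mul (Real.log n), Real.exp_add, Real.exp_log hn']
    field_simp
  rw [c3] at B3
  have c1 : (A.card : ℝ) * (∫ z, (u ⬝ᵥ z.1) ^ 2 * dphi φ 1 z.2 (z.1 ⬝ᵥ β) ^ 2 ∂P) /
      (ε ^ 2 * (l2 ξ ^ 2 * n)) ≤ 4 * e ^ 2 * σ ^ 2 / ε ^ 2 := by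
    refine (div_le_div_of_nonneg_right (mul_le_mul hAn hb2 hb0 hn'.le) (by positivity)).trans
      (le_of_eq ?_)
    field_simp
  have c4 : (A.card : ℝ) * (∫ z, (u ⬝ᵥ z.1) ^ 2 * dphi φ 1 z.2 (z.1 ⬝ᵥ β) ^ 2 ∂P) /
      (ε * (n * l2 ξ ^ 2)) ≤ 4 * e ^ 2 * σ ^ 2 / ε := by
    refine (div_le_div_of_nonneg_right (mul_le_mul hAn hb2 hb0 hn'.le) (by positivity)).trans
      (le_of_eq ?_)
    field_simp
  rw [ENNReal.ofReal_add (by positivity) (by positivity),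
    ENNReal.ofReal_add (by positivity) (by positivity),
    ENNReal.ofReal_add (by positivity) (by positivity)]
  refine le_trans ?_ (add_le_add (add_le_add (add_le_add (B1.trans (ENNReal.ofReal_le_ofReal c1))
    (B4.trans (ENNReal.ofReal_le_ofReal c4))) B2) B3)
  refine le_trans (measure_mono fun ω hω => ?_) ((measure_union_le _ _).trans (add_le_add
    ((measure_union_le _ _).trans (add_le_add (measure_union_le _ _) le_rfl)) le_rfl))
  rw [Set.mem_ofPred_eq] at hω
  simp only [Set.mem_union, Set.mem_ofPred_eq]
  by_contra hcon
  simp only [not_or, not_not, not_le, not_exists, not_lt] at hcon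
  obtain ⟨⟨⟨g1, g4⟩, g2⟩, g3⟩ := hcon
  exact hω ⟨g1.le, g2, fun i _ => g3 i, g4.le⟩

/-- The same for a direction estimated from the complementary subsample. -/
lemma IsSample.measure_not_freshGood_random_le (hR : Regular φ P β ξ N K C₆ C₇ σ κ Λ K' v)
    (hS : IsSample μ P Z) {A : Finset (Fin n)} (hn : 0 < n) (hρ : 0 < ρ)
    (hA : ρ * n ≤ A.card) (hlam : logMax p n / n ≤ ρ) (he : 0 < e) (he1 : e ≤ 1) (hε : 0 < ε)
    {m : Ω → Fin p → ℝ} (hm : ∀ j, Measurable[subsample Z Aᶜ] fun ω => m ω j) :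
    μ {ω | N (m ω - MStar φ P β *ᵥ ξ) ≤ e * l2 ξ ∧
        ¬ FreshGood φ P β ξ K C₆ (2 * (K' + 1)) ρ ε A (m ω) (fun i => Z i ω)} ≤
      ENNReal.ofReal (4 * e ^ 2 * σ ^ 2 / ε ^ 2 + 4 * e ^ 2 * σ ^ 2 / ε +
        2 * Real.exp (-(2 * logMax p n)) + 2 / n) :=
  hS.fresh A hm (G := {m | N (m - MStar φ P β *ᵥ ξ) ≤ e * l2 ξ})
    (measurableSet_le (hR.N_measurable.comp (measurable_id.sub_const _)) measurable_const)
    (S := {q | FreshGood φ P β ξ K C₆ (2 * (K' + 1)) ρ ε A q.1 q.2}ᶜ)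
    (measurableSet_freshGood hR.loss A).compl
    (fun _ _ _ h hv hF => hv (FreshGood.congr (fun i hi => (h i hi).symm) hF))
    fun _ hv => hS.measure_not_freshGood_le hR hn hρ hA hlam he he1 hε hv

/-- The law of large numbers for the oracle variance estimator. -/
lemma IsSample.measure_variance_le (hR : Regular φ P β ξ N K C₆ C₇ σ κ Λ K' v)
    (hS : IsSample μ P Z) (hn : 0 < n) (hε : 0 < ε) :
    μ {ω | ε * l2 ξ ^ 2 ≤ |(n : ℝ)⁻¹ * ∑ i, ((MStar φ P β *ᵥ ξ) ⬝ᵥ (Z i ω).1) ^ 2 *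
      dphi φ 1 (Z i ω).2 ((Z i ω).1 ⬝ᵥ β) ^ 2 - asympVar φ P β ξ|} ≤
      ENNReal.ofReal (48 * K' ^ 4 * σ ^ 4 / ε ^ 2 / n) := by
  have hK' := hR.K'_pos
  have hσ := hR.σ_pos
  have hξ := hR.ξ_pos
  have hn' : (0 : ℝ) < n := by exact_mod_cast hn
  have m1 := hR.loss.measurable_dphi_comp (by norm_num : 1 ≤ 3) β
  obtain ⟨i2, b2⟩ := hR.loading.integral_mul_pow_le hR.score (by positivity) hσ
    (measurable_dot _) m1 2
  have B := hS.chebyshev Finset.univ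
    (f := fun z => ((MStar φ P β *ᵥ ξ) ⬝ᵥ z.1) ^ 2 * dphi φ 1 z.2 (z.1 ⬝ᵥ β) ^ 2)
    (((measurable_dot _).pow_const 2).mul (m1.pow_const 2)) (by simpa only [mul_pow] using i2)
    (t := n * (ε * l2 ξ ^ 2)) (by positivity)
  have hV : ∫ z, ((MStar φ P β *ᵥ ξ) ⬝ᵥ z.1) ^ 2 * dphi φ 1 z.2 (z.1 ⬝ᵥ β) ^ 2 ∂P =
      asympVar φ P β ξ := by simp only [asympVar, loading_eq]
  rw [hV, Finset.card_univ, Fintype.card_fin] at B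
  simp only [mul_pow] at B
  refine le_trans (measure_mono fun ω hω => ?_) (B.trans (ENNReal.ofReal_le_ofReal ?_))
  · rw [Set.mem_ofPred_eq] at hω ⊢
    have h1 := mul_le_mul_of_nonneg_left hω hn'.le
    rwa [← abs_of_pos hn', ← abs_mul, abs_of_pos hn', mul_sub, mul_inv_cancel_left₀ hn'.ne'] at h1
  · refine (div_le_div_of_nonneg_right (mul_le_mul_of_nonneg_left b2 hn'.le)
      (by positivity)).trans (le_of_eq ?_)
    have : ((2 * 2).factorial : ℝ) = 24 := by norm_num [Nat.factorial]
    rw [this]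
    field_simp
    ring

end Events

/-! ### Error bounds for the two estimators on the good events -/

section Combination

variable {n p : ℕ} {φ : ℝ → ℝ → ℝ} {P : Measure (Obs p)} {β ξ : Fin p → ℝ}
  {N : (Fin p → ℝ) → ℝ} {K C₆ C₇ σ κ Λ K' v : ℝ}

lemma dot_mulVec_smul_sum (A : Finset (Fin n)) (M : Matrix (Fin p) (Fin p) ℝ) (c : ℝ)
    (w : Fin n → ℝ) (x : Fin n → Fin p → ℝ) :
    ξ ⬝ᵥ (M *ᵥ (c • ∑ i ∈ A, w i • x i)) = c * ∑ i ∈ A, ((ξ ᵥ* M) ⬝ᵥ x i) * w i := by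
  rw [Matrix.dotProduct_mulVec, dotProduct_smul, smul_eq_mul, dotProduct_sum]
  refine congrArg _ (Finset.sum_congr rfl fun i _ => ?_)
  rw [dotProduct_smul, smul_eq_mul, mul_comm]

variable (hR : Regular φ P β ξ N K C₆ C₇ σ κ Λ K' v)
include hR

lemma Regular.sqrt_var_lower : Real.sqrt v * l2 ξ ≤ Real.sqrt (asympVar φ P β ξ) := by
  refine Real.le_sqrt_of_sq_le ?_
  rw [mul_pow, Real.sq_sqrt hR.v_pos.le]
  exact hR.var_lower

variable {K'' ρ ε e C₁ D : ℝ} {J : Finset (Fin n)} {b : Fin p → ℝ} {z : Fin n → Obs p}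
  {MJ MJc : Matrix (Fin p) (Fin p) ℝ}

lemma Regular.debiased_error_le (hn : 0 < n) (hJ : 0 < J.card) (hJc : 0 < Jᶜ.card) (hρ : 0 < ρ)
    (hK'' : 0 < K'') (hD : 0 ≤ D)
    (hderiv : ∀ i, dphi φ 2 (z i).2 ((z i).1 ⬝ᵥ β) ≤ C₆ ∧ ∀ b, |dphi φ 3 (z i).2 b| ≤ C₇)
    (hFJ : FreshGood φ P β ξ K C₆ K'' ρ ε J (ξ ᵥ* MJc) z)
    (hFJc : FreshGood φ P β ξ K C₆ K'' ρ ε Jᶜ (ξ ᵥ* MJ) z)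
    (hb : GoodEstimate C₁ β Finset.univ z b)
    (hΔ : l2 (b - β) ≤ D * (Real.sqrt (l0 β) * lam p n))
    (huJ : Real.sqrt (l0 β * logMax p n) * l2 (ξ ᵥ* MJc - MStar φ P β *ᵥ ξ) ≤ e * l2 ξ)
    (huJc : Real.sqrt (l0 β * logMax p n) * l2 (ξ ᵥ* MJ - MStar φ P β *ᵥ ξ) ≤ e * l2 ξ) :
    |(debiased φ J z ξ b MJ MJc - ξ ⬝ᵥ β) / Real.sqrt (asympVar φ P β ξ) -
      leadingTerm φ P z β ξ| ≤ 2 / Real.sqrt v * (ε + Λ * D * e +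
        C₆ * K * K'' * (16 / Real.sqrt ρ) * C₁ * (l0 β * tau p n) +
        2 * K'' * C₇ * C₁ * (l0 β * Real.sqrt (Real.log n) * tau p n)) / Real.sqrt n := by
  have hn' : (0 : ℝ) < n := by exact_mod_cast hn
  have hξ := hR.ξ_pos
  have hv := Real.sqrt_pos.2 hR.v_pos
  have hsn : 0 < Real.sqrt n := Real.sqrt_pos.2 hn'
  have hV := hR.sqrt_var_lower
  have hV0 : 0 < Real.sqrt (asympVar φ P β ξ) := lt_of_lt_of_le (by positivity) hV
  have h1 := hR.correction_expansion hn hJ hρ hK'' hD hderiv hFJ hb hΔ huJ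
  have h2 := hR.correction_expansion hn hJc hρ hK'' hD hderiv hFJc hb hΔ huJc
  set q := ε + Λ * D * e + C₆ * K * K'' * (16 / Real.sqrt ρ) * C₁ * (l0 β * tau p n) +
        2 * K'' * C₇ * C₁ * (l0 β * Real.sqrt (Real.log n) * tau p n) with hq
  have hcard : (J.card : ℝ) / n + (Jᶜ.card : ℝ) / n = 1 := by
    rw [← add_div, ← Nat.cast_add, Finset.card_add_card_compl, Fintype.card_fin, div_self hn'.ne']
  have hlead : leadingTerm φ P z β ξ = -((n : ℝ)⁻¹ * ∑ i ∈ J, ((MStar φ P β *ᵥ ξ) ⬝ᵥ (z i).1) *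
      dphi φ 1 (z i).2 ((z i).1 ⬝ᵥ β) + (n : ℝ)⁻¹ * ∑ i ∈ Jᶜ, ((MStar φ P β *ᵥ ξ) ⬝ᵥ (z i).1) *
      dphi φ 1 (z i).2 ((z i).1 ⬝ᵥ β)) / Real.sqrt (asympVar φ P β ξ) := by
    rw [← mul_add, Finset.sum_add_sum_compl, leadingTerm, ← Finset.sum_div, mul_div_assoc', neg_div]
    simp only [loading_eq]
  have hΔe : ξ ⬝ᵥ (b - β) = ξ ⬝ᵥ b - ξ ⬝ᵥ β := dotProduct_sub _ _ _
  rw [hlead, debiased, dot_mulVec_smul_sum, dot_mulVec_smul_sum, ← sub_div, abs_div,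
    abs_of_pos hV0, div_le_iff₀ hV0]
  set TJ := (n : ℝ)⁻¹ * ∑ i ∈ J, ((ξ ᵥ* MJc) ⬝ᵥ (z i).1) * dphi φ 1 (z i).2 ((z i).1 ⬝ᵥ b)
  set TJc := (n : ℝ)⁻¹ * ∑ i ∈ Jᶜ, ((ξ ᵥ* MJ) ⬝ᵥ (z i).1) * dphi φ 1 (z i).2 ((z i).1 ⬝ᵥ b)
  set SJ := (n : ℝ)⁻¹ * ∑ i ∈ J, ((MStar φ P β *ᵥ ξ) ⬝ᵥ (z i).1) *
      dphi φ 1 (z i).2 ((z i).1 ⬝ᵥ β)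
  set SJc := (n : ℝ)⁻¹ * ∑ i ∈ Jᶜ, ((MStar φ P β *ᵥ ξ) ⬝ᵥ (z i).1) *
      dphi φ 1 (z i).2 ((z i).1 ⬝ᵥ β)
  have e1 : ξ ⬝ᵥ b - TJ - TJc - ξ ⬝ᵥ β - -(SJ + SJc) =
      -((TJ - SJ - J.card / n * (ξ ⬝ᵥ (b - β))) + (TJc - SJc - Jᶜ.card / n * (ξ ⬝ᵥ (b - β)))) := by
    have : ξ ⬝ᵥ b - ξ ⬝ᵥ β = ((J.card : ℝ) / n + (Jᶜ.card : ℝ) / n) * (ξ ⬝ᵥ (b - β)) := by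
      rw [hcard, one_mul, hΔe]
    linear_combination this
  rw [e1, abs_neg]
  have hq0 : 0 ≤ q := by
    have := (abs_nonneg _).trans h1
    exact nonneg_of_mul_nonneg_right this (by positivity)
  calc _ ≤ l2 ξ / Real.sqrt n * q + l2 ξ / Real.sqrt n * q :=
        (abs_add_le _ _).trans (add_le_add h1 h2)
    _ = 2 / Real.sqrt v * q / Real.sqrt n * (Real.sqrt v * l2 ξ) := by field_simp; ring
    _ ≤ _ := mul_le_mul_of_nonneg_left hV (by positivity)

lemma Regular.varEst_error_le (hn : 0 < n) (hK'' : 0 < K'')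
    (hderiv : ∀ i, dphi φ 2 (z i).2 ((z i).1 ⬝ᵥ β) ≤ C₆ ∧ ∀ b, |dphi φ 3 (z i).2 b| ≤ C₇)
    (hFJ : FreshGood φ P β ξ K C₆ K'' ρ ε J (ξ ᵥ* MJc) z)
    (hFJc : FreshGood φ P β ξ K C₆ K'' ρ ε Jᶜ (ξ ᵥ* MJ) z)
    (hb : GoodEstimate C₁ β Finset.univ z b)
    (hmax : ∀ i, |(z i).1 ⬝ᵥ (b - β)| ≤ 1)
    (hvar : |(n : ℝ)⁻¹ * ∑ i, ((MStar φ P β *ᵥ ξ) ⬝ᵥ (z i).1) ^ 2 *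
      dphi φ 1 (z i).2 ((z i).1 ⬝ᵥ β) ^ 2 - asympVar φ P β ξ| ≤ ε * l2 ξ ^ 2)
    {t : ℝ} (ht : 0 < t) (ht1 : t ≤ 1) :
    |varEst φ J z ξ b MJ MJc / asympVar φ P β ξ - 1| ≤
      ((1 + 1 / t) * (4 * ε +
        8 * K'' ^ 2 * (C₆ + C₇) ^ 2 * C₁ * (Real.log n * l0 β * lam p n ^ 2)) + 2 * ε) / v + t := by
  have hv := hR.v_pos
  have hξ := hR.ξ_pos
  have hV := hR.var_lower
  have hV0 : 0 < asympVar φ P β ξ := lt_of_lt_of_le (by positivity) hV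
  have h1 := hR.variance_expansion hn hK'' hderiv hFJ hb hmax ht
  have h2 := hR.variance_expansion hn hK'' hderiv hFJc hb hmax ht
  rw [← Finset.sum_add_sum_compl J, mul_add] at hvar
  simp only [varEst, Matrix.dotProduct_mulVec]
  set X := 4 * K'' ^ 2 * (C₆ + C₇) ^ 2 * C₁ * (Real.log n * l0 β * lam p n ^ 2)
  have eX : 8 * K'' ^ 2 * (C₆ + C₇) ^ 2 * C₁ * (Real.log n * l0 β * lam p n ^ 2) = 2 * X := by ring
  rw [eX]
  set V := asympVar φ P β ξ
  set SJ := (n : ℝ)⁻¹ * ∑ i ∈ J, ((MStar φ P β *ᵥ ξ) ⬝ᵥ (z i).1) ^ 2 *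
      dphi φ 1 (z i).2 ((z i).1 ⬝ᵥ β) ^ 2
  set SJc := (n : ℝ)⁻¹ * ∑ i ∈ Jᶜ, ((MStar φ P β *ᵥ ξ) ⬝ᵥ (z i).1) ^ 2 *
      dphi φ 1 (z i).2 ((z i).1 ⬝ᵥ β) ^ 2
  set TJ := (n : ℝ)⁻¹ * ∑ i ∈ J, ((ξ ᵥ* MJc) ⬝ᵥ (z i).1) ^ 2 * dphi φ 1 (z i).2 ((z i).1 ⬝ᵥ b) ^ 2
  set TJc := (n : ℝ)⁻¹ * ∑ i ∈ Jᶜ, ((ξ ᵥ* MJ) ⬝ᵥ (z i).1) ^ 2 *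
    dphi φ 1 (z i).2 ((z i).1 ⬝ᵥ b) ^ 2
  have hε : 0 ≤ ε := nonneg_of_mul_nonneg_left ((abs_nonneg _).trans hvar) (by positivity)
  set B := (1 + 1 / t) * (2 * ε + X) with hB
  have hB0 : 0 ≤ B := by
    have hX : 0 ≤ 2 * ε + X := by
      have : 0 ≤ C₁ * l0 β * (logMax p n / n) := le_trans (mul_nonneg (by positivity)
        (Finset.sum_nonneg fun _ _ => sq_nonneg _)) hb.2
      have hlog : 0 ≤ Real.log n := Real.log_nonneg (by exact_mod_cast hn)
      rw [← lam_sq hn] at this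
      have eX2 : X = 4 * K'' ^ 2 * (C₆ + C₇) ^ 2 * Real.log n * (C₁ * l0 β * lam p n ^ 2) := by ring
      rw [eX2]
      positivity
    positivity
  have key : |TJ + TJc - V| ≤ 2 * (B * l2 ξ ^ 2) + t * V + 2 * (ε * l2 ξ ^ 2) := by
    have h3 := (abs_le.1 hvar).2
    have e1 : TJ + TJc - V = (TJ - SJ) + (TJc - SJc) + (SJ + SJc - V) := by ring
    rw [e1]
    refine (abs_add_le _ _).trans ((add_le_add ((abs_add_le _ _).trans (add_le_add h1 h2))
      hvar).trans ?_)
    have h4 : t * (SJ + SJc) ≤ t * V + ε * l2 ξ ^ 2 := by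
      have h5 := mul_le_mul_of_nonneg_left h3 ht.le
      have h6 : t * (ε * l2 ξ ^ 2) ≤ 1 * (ε * l2 ξ ^ 2) :=
        mul_le_mul_of_nonneg_right ht1 (by positivity)
      linarith
    have e2 : (1 + 1 / t) * (l2 ξ ^ 2 * (2 * ε + X)) = B * l2 ξ ^ 2 := by rw [hB]; ring
    rw [e2]
    linarith
  have e3 : (TJ + TJc) / V - 1 = (TJ + TJc - V) / V := by field_simp
  have e4 : (1 + 1 / t) * (4 * ε + 2 * X) = 2 * B := by rw [hB]; ring
  rw [e3, abs_div, abs_of_pos hV0, div_le_iff₀ hV0, e4]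
  refine key.trans ?_
  have h7 : (2 * B + 2 * ε) / v * (v * l2 ξ ^ 2) ≤ (2 * B + 2 * ε) / v * V :=
    mul_le_mul_of_nonneg_left hV (by positivity)
  have e5 : (2 * B + 2 * ε) / v * (v * l2 ξ ^ 2) = 2 * (B * l2 ξ ^ 2) + 2 * (ε * l2 ξ ^ 2) := by
    field_simp
  rw [e5] at h7
  linarith

end Combination

/-! ### Events of probability tending to one -/

section WHP

variable {Ω : ℕ → Type*} [∀ n, MeasurableSpace (Ω n)] {μ : ∀ n, Measure (Ω n)}
  {E F : ∀ n, Ω n → Prop}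

/-- The outer probabilities of the complements of `E_n` tend to zero. -/
def WHP (μ : ∀ n, Measure (Ω n)) (E : ∀ n, Ω n → Prop) : Prop :=
  Tendsto (fun n => μ n {ω | ¬ E n ω}) atTop (𝓝 0)

lemma WHP.mono (hE : WHP μ E) (h : ∀ᶠ n in atTop, ∀ ω, E n ω → F n ω) : WHP μ F := by
  refine tendsto_of_tendsto_of_tendsto_of_le_of_le' tendsto_const_nhds hE
    (Eventually.of_forall fun _ => zero_le) ?_
  filter_upwards [h] with n hn
  exact measure_mono fun ω hω hEω => hω (hn ω hEω)

lemma WHP.and (hE : WHP μ E) (hF : WHP μ F) : WHP μ fun n ω => E n ω ∧ F n ω := by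
  have hsum := hE.add hF
  rw [add_zero] at hsum
  refine tendsto_of_tendsto_of_tendsto_of_le_of_le tendsto_const_nhds hsum
    (fun _ => zero_le) fun n => ?_
  refine (measure_mono fun ω hω => ?_).trans (measure_union_le _ _)
  rw [Set.mem_ofPred_eq] at hω
  simp only [Set.mem_union, Set.mem_ofPred_eq]
  tauto

lemma WHP.of_le {a : ℕ → ℝ} (ha : Tendsto a atTop (𝓝 0))
    (h : ∀ᶠ n in atTop, μ n {ω | ¬ E n ω} ≤ ENNReal.ofReal (a n)) : WHP μ E := by
  have h0 := ENNReal.tendsto_ofReal ha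
  rw [ENNReal.ofReal_zero] at h0
  exact tendsto_of_tendsto_of_tendsto_of_le_of_le' tendsto_const_nhds h0
    (Eventually.of_forall fun _ => zero_le) h

lemma HoldsWHP.whp [∀ n, IsProbabilityMeasure (μ n)] (h : HoldsWHP μ E)
    (hm : ∀ᶠ n in atTop, MeasurableSet {ω | E n ω}) : WHP μ E := by
  obtain ⟨δ, hδ, hE⟩ := h
  refine WHP.of_le hδ ?_
  filter_upwards [hm] with n hn
  have e : {ω | ¬ E n ω} = {ω | E n ω}ᶜ := rfl
  rw [e, ← ENNReal.ofReal_toReal (measure_ne_top (μ n) _)]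
  refine ENNReal.ofReal_le_ofReal ?_
  have := probReal_compl_eq_one_sub (μ := μ n) hn
  rw [Measure.real] at this
  rw [this]
  linarith [hE n]

lemma measurableSet_goodEstimate {n p : ℕ} {Ω' : Type*} [MeasurableSpace Ω'] {C : ℝ}
    {β : Fin p → ℝ} {A : Finset (Fin n)} {Z : Fin n → Ω' → Obs p} (hZ : ∀ i, Measurable (Z i))
    {b : Ω' → Fin p → ℝ} (hb : Measurable b) :
    MeasurableSet {ω | GoodEstimate C β A (fun i => Z i ω) (b ω)} := by
  have e : {ω | GoodEstimate C β A (fun i => Z i ω) (b ω)} =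
      {ω | l1 (b ω - β) ≤ C * l0 β * lam p n} ∩ {ω | (A.card : ℝ)⁻¹ *
        ∑ i ∈ A, ((Z i ω).1 ⬝ᵥ b ω - (Z i ω).1 ⬝ᵥ β) ^ 2 ≤ C * l0 β * (logMax p n / n)} := rfl
  rw [e]
  have hd : ∀ i, Measurable fun ω => (Z i ω).1 ⬝ᵥ b ω := fun i => by
    unfold dotProduct; fun_prop
  have hd' : ∀ i, Measurable fun ω => (Z i ω).1 ⬝ᵥ β := fun i => by
    unfold dotProduct; fun_prop
  refine (measurableSet_le (measurable_l1.comp (hb.sub_const _)) measurable_const).inter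
    (measurableSet_le ?_ measurable_const)
  exact (Finset.measurable_fun_sum _ fun i _ => ((hd i).sub (hd' i)).pow_const 2).const_mul _

end WHP

/-! ### Asymptotics under abstract rate conditions -/

lemma rate_consequences {p s₀ : ℕ → ℕ} (hs : ∀ᶠ n in atTop, 1 ≤ s₀ n)
    (h : Tendsto (fun n : ℕ => s₀ n * Real.sqrt (Real.log n) * tau (p n) n) atTop (𝓝 0)) :
    (∀ᶠ n in atTop, 1 ≤ logMax (p n) n) ∧
    Tendsto (fun n : ℕ => tau (p n) n) atTop (𝓝 0) ∧
    Tendsto (fun n : ℕ => s₀ n * tau (p n) n) atTop (𝓝 0) ∧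
    Tendsto (fun n : ℕ => logMax (p n) n / n) atTop (𝓝 0) ∧
    Tendsto (fun n : ℕ => Real.log n * s₀ n * lam (p n) n ^ 2) atTop (𝓝 0) := by
  have hlog : ∀ᶠ n : ℕ in atTop, 1 ≤ Real.log n :=
    (Real.tendsto_log_atTop.comp tendsto_natCast_atTop_atTop).eventually_ge_atTop 1
  have hL : ∀ᶠ n in atTop, 1 ≤ logMax (p n) n := by
    filter_upwards [hlog, eventually_gt_atTop 0] with n h1 hn
    exact h1.trans (Real.log_le_log (by exact_mod_cast hn) (le_max_right _ _))
  have hs0 : Tendsto (fun n : ℕ => s₀ n * tau (p n) n) atTop (𝓝 0) := by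
    refine squeeze_zero' ?_ ?_ h
    · filter_upwards [eventually_gt_atTop 0] with n hn
      exact mul_nonneg (Nat.cast_nonneg _) (tau_nonneg hn)
    · filter_upwards [hlog, eventually_gt_atTop 0] with n h1 hn
      refine mul_le_mul_of_nonneg_right ?_ (tau_nonneg hn)
      exact le_mul_of_one_le_right (Nat.cast_nonneg _) (Real.one_le_sqrt.2 h1)
  have ht : Tendsto (fun n : ℕ => tau (p n) n) atTop (𝓝 0) := by
    refine squeeze_zero' ?_ ?_ hs0
    · filter_upwards [eventually_gt_atTop 0] with n hn using tau_nonneg hn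
    · filter_upwards [hs, eventually_gt_atTop 0] with n h1 hn
      exact le_mul_of_one_le_left (tau_nonneg hn) (by exact_mod_cast h1)
  have tsq : ∀ n : ℕ, 0 < n → tau (p n) n ^ 2 = logMax (p n) n * (logMax (p n) n / n) := fun n hn => by
    rw [tau, div_pow, Real.sq_sqrt (Nat.cast_nonneg _)]; ring
  refine ⟨hL, ht, hs0, ?_, ?_⟩
  · have h2 := ht.pow 2
    rw [zero_pow two_ne_zero] at h2
    refine squeeze_zero' ?_ ?_ h2
    · filter_upwards [eventually_gt_atTop 0] with n hn
      exact div_nonneg (logMax_nonneg hn) (Nat.cast_nonneg _)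
    · filter_upwards [hL, eventually_gt_atTop 0] with n h1 hn
      rw [tsq n hn]
      exact le_mul_of_one_le_left (div_nonneg (logMax_nonneg hn) (Nat.cast_nonneg _)) h1
  · have h2 := h.pow 2
    rw [zero_pow two_ne_zero] at h2
    refine squeeze_zero' ?_ ?_ h2
    · filter_upwards [hlog] with n h1
      positivity
    · filter_upwards [hL, hlog, hs, eventually_gt_atTop 0] with n h1 h2 h3 hn
      rw [mul_pow, mul_pow, Real.sq_sqrt (by linarith), tsq n hn, lam_sq hn]
      have h4 : (1 : ℝ) ≤ s₀ n := by exact_mod_cast h3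
      have h5 : 0 ≤ logMax (p n) n / n := div_nonneg (logMax_nonneg hn) (Nat.cast_nonneg _)
      calc Real.log n * s₀ n * (logMax (p n) n / n)
          = Real.log n * (logMax (p n) n / n) * s₀ n * 1 * 1 := by ring
        _ ≤ Real.log n * (logMax (p n) n / n) * s₀ n * s₀ n * logMax (p n) n := by gcongr
        _ = _ := by ring

/-- The hypotheses of the asymptotic analysis, in a form common to both sets of tail assumptions:
`γ_n` is the tolerance in the restricted strong convexity of the truncated empirical Hessians,
and `e_n` bounds the effect on `ξ` of symmetric errors of the matrix estimator. -/
structure AsymptoticSetting (φ : ℝ → ℝ → ℝ) {p : ℕ → ℕ} {Ω : ℕ → Type*}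
    [∀ n, MeasurableSpace (Ω n)] (μ : ∀ n, Measure (Ω n)) (P : ∀ n, Measure (Obs (p n)))
    (Z : ∀ n, Fin n → Ω n → Obs (p n)) (β ξ : ∀ n, Fin (p n) → ℝ)
    (N : ∀ n, (Fin (p n) → ℝ) → ℝ) (γ e : ℕ → ℝ) (K C₆ C₇ σ κ Λ K' v ρ A₀ : ℝ) : Prop where
  ρ_pos : 0 < ρ
  regular : ∀ᶠ n in atTop, Regular φ (P n) (β n) (ξ n) (N n) K C₆ C₇ σ κ Λ K' v
  sample : ∀ᶠ n in atTop, IsSample (μ n) (P n) (Z n)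
  target_ne : ∀ᶠ n in atTop, β n ≠ 0
  rate : Tendsto (fun n => l0 (β n) * Real.sqrt (Real.log n) * tau (p n) n) atTop (𝓝 0)
  γ_nonneg : ∀ᶠ n in atTop, 0 ≤ γ n
  γ_s0 : Tendsto (fun n => γ n * l0 (β n)) atTop (𝓝 0)
  γ_s1 : Tendsto (fun n => γ n * s1max φ (P n) (β n)) atTop (𝓝 0)
  rsc : ∀ A : ∀ n, Finset (Fin n), (∀ᶠ n in atTop, ρ * n ≤ (A n).card) →
    Tendsto (fun n => μ n {ω | (∀ i, truncWeight φ (β n) (κ / (2 * Λ)) (Z n i ω) ≤ C₆) ∧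
        (∀ j, ∑ i ∈ A n, (Z n i ω).1 j ^ 4 ≤ (A n).card * (773 * K ^ 4)) ∧
        ¬ RestrictedConvex (weightedGram (A n) (fun i => Z n i ω)
          fun i => truncWeight φ (β n) (κ / (2 * Λ)) (Z n i ω)) (κ / 4) (γ n)}) atTop (𝓝 0)
  e_zero : Tendsto e atTop (𝓝 0)
  stable : ∀ᶠ n in atTop, 0 < e n ∧ ∀ D : Matrix (Fin (p n)) (Fin (p n)) ℝ, D.IsSymm →
    (∀ j, ∑ i, |D i j| ≤ 48 / (κ / 4) *
      (Real.sqrt (l0 (β n)) * A₀ * lam (p n) n * s1max φ (P n) (β n))) →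
    (∀ j, l2 (fun i => D i j) ≤ 12 / (κ / 4) *
      (Real.sqrt (l0 (β n)) * A₀ * lam (p n) n * Real.sqrt (s1max φ (P n) (β n)))) →
    N n (D *ᵥ ξ n) ≤ e n * l2 (ξ n) ∧
      Real.sqrt (l0 (β n) * logMax (p n) n) * l2 (D *ᵥ ξ n) ≤ e n * l2 (ξ n)

namespace AsymptoticSetting

variable {φ : ℝ → ℝ → ℝ} {p : ℕ → ℕ} {Ω : ℕ → Type*}
  [∀ n, MeasurableSpace (Ω n)] {μ : ∀ n, Measure (Ω n)} {P : ∀ n, Measure (Obs (p n))}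
  {Z : ∀ n, Fin n → Ω n → Obs (p n)} {β ξ : ∀ n, Fin (p n) → ℝ}
  {N : ∀ n, (Fin (p n) → ℝ) → ℝ} {γ e : ℕ → ℝ} {K C₆ C₇ σ κ Λ K' v ρ A₀ : ℝ}
  (hS : AsymptoticSetting φ μ P Z β ξ N γ e K C₆ C₇ σ κ Λ K' v ρ A₀)
include hS

lemma one_le_l0 : ∀ᶠ n in atTop, 1 ≤ l0 (β n) :=
  hS.target_ne.mono fun _ hn => DebiasedGLM.one_le_l0 hn

omit hS in
lemma exp_logMax_tendsto :
    Tendsto (fun n => Real.exp (-(2 * logMax (p n) n))) atTop (𝓝 0) := by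
  refine squeeze_zero' (Eventually.of_forall fun _ => (Real.exp_pos _).le) ?_
    (tendsto_inv_atTop_zero.comp tendsto_natCast_atTop_atTop)
  filter_upwards [eventually_gt_atTop 0] with n hn
  rw [Real.exp_neg, Function.comp_apply]
  have hn' : (0 : ℝ) < n := by exact_mod_cast hn
  refine inv_anti₀ hn' ((natCast_le_exp_logMax (p := p n) hn).2.trans (Real.exp_le_exp.2 ?_))
  linarith [logMax_nonneg (p := p n) hn]

lemma eventually_small : ∀ᶠ n in atTop, 0 < n ∧ logMax (p n) n / n ≤ ρ ∧ 1 ≤ logMax (p n) n ∧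
    24 * logMax (p n) n ^ 2 ≤ ρ * n := by
  obtain ⟨hL, ht, -, hLn, -⟩ := rate_consequences hS.one_le_l0 hS.rate
  have ht2 := (ht.pow 2).const_mul 24
  rw [zero_pow two_ne_zero, mul_zero] at ht2
  filter_upwards [hL, hLn.eventually_le_const hS.ρ_pos, ht2.eventually_le_const hS.ρ_pos,
    eventually_gt_atTop 0] with n h1 h2 h3 hn
  have hn' : (0 : ℝ) < n := by exact_mod_cast hn
  refine ⟨hn, h2, h1, ?_⟩
  rwa [tau, div_pow, Real.sq_sqrt hn'.le, ← mul_div_assoc, div_le_iff₀ hn'] at h3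

variable [∀ n, IsProbabilityMeasure (P n)]

lemma whp_goodDesign {A : ∀ n, Finset (Fin n)} (hA : ∀ᶠ n in atTop, ρ * n ≤ (A n).card) :
    WHP μ fun n ω => GoodDesign φ (P n) (β n) K C₆ C₇ κ Λ ρ (γ n) (A n) (fun i => Z n i ω) := by
  have h1 := (ENNReal.tendsto_ofReal (exp_logMax_tendsto (p := p).const_mul 10)).add (hS.rsc A hA)
  rw [mul_zero, ENNReal.ofReal_zero, add_zero] at h1
  refine tendsto_of_tendsto_of_tendsto_of_le_of_le' tendsto_const_nhds h1
    (Eventually.of_forall fun _ => zero_le) ?_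
  filter_upwards [hS.regular, hS.sample, hS.eventually_small, hA] with n hR hSa hn hAn
  exact hSa.measure_not_goodDesign_le hR hn.1 hS.ρ_pos hAn hn.2.1 hn.2.2.1 hn.2.2.2 le_rfl

variable [∀ n, IsProbabilityMeasure (μ n)]

/-- The matrix estimator from one subsample: its action on `ξ` is close to that of `M*`. -/
lemma whp_direction {A : ∀ n, Finset (Fin n)} (hA : ∀ᶠ n in atTop, ρ * n ≤ (A n).card)
    {C₈ : ℝ} (hC₈ : 0 < C₈) (hA₀0 : 0 < A₀)
    (hA₀ : 2 * (C₆ * (K * K) * (16 / Real.sqrt ρ) + C₇ * (K ^ 2 * Real.sqrt (773 * C₈))) ≤ A₀)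
    {b : ∀ n, Ω n → Fin (p n) → ℝ} {M : ∀ n, Ω n → Matrix (Fin (p n)) (Fin (p n)) ℝ}
    (hb : HoldsWHP μ fun n ω => GoodEstimate C₈ (β n) (A n) (fun i => Z n i ω) (b n ω))
    (hM : ∀ᶠ n in atTop, IsTwoStageEstimator φ (Z n) (A n)
      (Real.sqrt (l0 (β n)) * A₀ * lam (p n) n) (b n) (M n)) :
    WHP μ fun n ω =>
      N n (ξ n ᵥ* M n ω - MStar φ (P n) (β n) *ᵥ ξ n) ≤ e n * l2 (ξ n) ∧
      Real.sqrt (l0 (β n) * logMax (p n) n) *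
        l2 (ξ n ᵥ* M n ω - MStar φ (P n) (β n) *ᵥ ξ n) ≤ e n * l2 (ξ n) := by
  have hbm : WHP μ fun n ω => GoodEstimate C₈ (β n) (A n) (fun i => Z n i ω) (b n ω) := by
    refine hb.whp ?_
    filter_upwards [hS.sample, hM] with n hSa hMn
    refine measurableSet_goodEstimate hSa.measurable (measurable_pi_iff.2 fun j => ?_)
    exact (hMn.initial_measurable j).mono
      (iSup₂_le fun i _ => (hSa.measurable i).comap_le) le_rfl
  refine (hbm.and (hS.whp_goodDesign hA)).mono ?_
  obtain ⟨-, -, hs0τ, -, -⟩ := rate_consequences hS.one_le_l0 hS.rate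
  obtain ⟨_, hR₀⟩ := hS.regular.exists
  have hκ := hR₀.κ_pos
  have hΛ := hR₀.Λ_pos
  have hη := (hs0τ.const_mul (2 * K * C₈)).const_mul C₇
  rw [mul_zero, mul_zero] at hη
  have hγs := hS.γ_s1.const_mul 32
  rw [mul_zero] at hγs
  filter_upwards [hS.regular, hS.sample, hS.eventually_small, hA, hM,
    hη.eventually_le_const (by positivity : 0 < κ / (2 * Λ)),
    hγs.eventually_le_const (by positivity : 0 < κ / 4), hS.γ_nonneg,
    hS.stable, hS.one_le_l0] with n hR hSa hn hAn hMn h1 h2 h3 h4 h5 ω ⟨hbω, hGω⟩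
  have hn' : (0 : ℝ) < n := by exact_mod_cast hn.1
  have hA0 : 0 < (A n).card := by
    have := (mul_pos hS.ρ_pos hn').trans_le hAn
    exact_mod_cast this
  have hs : (0 : ℝ) < l0 (β n) := by exact_mod_cast h5
  have hlam : 0 < lam (p n) n := Real.sqrt_pos.2 (div_pos (by linarith [hn.2.2.1]) hn')
  obtain ⟨hex, hout⟩ := hGω.twoStage hR hn.1 hA0 hC₈ hbω h5 h1 hA₀
    (mul_pos (mul_pos (Real.sqrt_pos.2 hs) hA₀0) hlam) h3 h2
  obtain ⟨hsy, hc1, hc2⟩ := hout _ (hMn.output ω hex)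
  have key := h4.2 _ hsy hc1 hc2
  have e1 : ξ n ᵥ* M n ω - MStar φ (P n) (β n) *ᵥ ξ n =
      (M n ω - MStar φ (P n) (β n)) *ᵥ ξ n := by
    rw [← Matrix.vecMul_transpose (M n ω - _), hsy.eq, Matrix.vecMul_sub,
      ← Matrix.vecMul_transpose (MStar φ (P n) (β n)), mStar_isSymm.eq]
  rw [e1]
  exact key

/-- The subsample `A` behaves well relative to the direction estimated from its complement. -/
lemma whp_fresh {A : ∀ n, Finset (Fin n)} (hA : ∀ᶠ n in atTop, ρ * n ≤ (A n).card)
    {M : ∀ n, Ω n → Matrix (Fin (p n)) (Fin (p n)) ℝ}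
    (hM : ∀ᶠ n in atTop, ∀ i j, Measurable[subsample (Z n) (A n)ᶜ] fun ω => M n ω i j)
    (hdir : WHP μ fun n ω =>
      N n (ξ n ᵥ* M n ω - MStar φ (P n) (β n) *ᵥ ξ n) ≤ e n * l2 (ξ n))
    {ε : ℝ} (hε : 0 < ε) :
    WHP μ fun n ω => FreshGood φ (P n) (β n) (ξ n) K C₆ (2 * (K' + 1)) ρ ε (A n) (ξ n ᵥ* M n ω)
      (fun i => Z n i ω) := by
  have hW : WHP μ fun n ω => ¬ (N n (ξ n ᵥ* M n ω - MStar φ (P n) (β n) *ᵥ ξ n) ≤ e n * l2 (ξ n) ∧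
      ¬ FreshGood φ (P n) (β n) (ξ n) K C₆ (2 * (K' + 1)) ρ ε (A n) (ξ n ᵥ* M n ω)
        (fun i => Z n i ω)) := by
    refine WHP.of_le (a := fun n => 4 * e n ^ 2 * σ ^ 2 / ε ^ 2 + 4 * e n ^ 2 * σ ^ 2 / ε +
        2 * Real.exp (-(2 * logMax (p n) n)) + 2 / n) ?_ ?_
    · have h1 := ((hS.e_zero.pow 2).const_mul 4).mul_const (σ ^ 2)
      have h2 := ((h1.div_const (ε ^ 2)).add (h1.div_const ε)).add
        (exp_logMax_tendsto (p := p).const_mul 2)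
      have h3 := h2.add (tendsto_const_div_atTop_nhds_zero_nat (2 : ℝ))
      simpa using h3
    · filter_upwards [hS.regular, hS.sample, hS.eventually_small, hA, hM, hS.stable,
        hS.e_zero.eventually_le_const one_pos] with n hR hSa hn hAn hMn h4 h5
      simp only [not_not]
      refine hSa.measure_not_freshGood_random_le hR hn.1 hS.ρ_pos hAn hn.2.1 h4.1 h5 hε
        (fun j => ?_)
      have : (fun ω => (ξ n ᵥ* M n ω) j) = fun ω => ∑ i, ξ n i * M n ω i j := rfl
      rw [this]
      exact Finset.measurable_fun_sum _ fun i _ => (hMn i j).const_mul _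
  refine (hW.and hdir).mono (Eventually.of_forall fun n ω h => ?_)
  by_contra hc
  exact h.1 ⟨h.2, hc⟩

lemma whp_variance {ε : ℝ} (hε : 0 < ε) :
    WHP μ fun n ω => |(n : ℝ)⁻¹ * ∑ i, ((MStar φ (P n) (β n) *ᵥ ξ n) ⬝ᵥ (Z n i ω).1) ^ 2 *
      dphi φ 1 (Z n i ω).2 ((Z n i ω).1 ⬝ᵥ β n) ^ 2 - asympVar φ (P n) (β n) (ξ n)| ≤
        ε * l2 (ξ n) ^ 2 := by
  refine WHP.of_le (tendsto_const_div_atTop_nhds_zero_nat (48 * K' ^ 4 * σ ^ 4 / ε ^ 2)) ?_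
  filter_upwards [hS.regular, hS.sample, hS.eventually_small] with n hR hSa hn
  refine (measure_mono fun ω hω => ?_).trans (hSa.measure_variance_le hR hn.1 hε)
  rw [Set.mem_ofPred_eq] at hω ⊢
  exact (not_le.1 hω).le

end AsymptoticSetting

lemma IsLittleOP.of_whp {Ω : ℕ → Type*} [∀ n, MeasurableSpace (Ω n)] {μ : ∀ n, Measure (Ω n)}
    {R : ∀ n, Ω n → ℝ} {a : ℕ → ℝ}
    (h : ∀ ε : ℝ, 0 < ε → WHP μ fun n ω => |R n ω| ≤ ε * |a n|) : IsLittleOP μ R a := by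
  intro ε hε
  simpa only [WHP, not_le] using h ε hε

namespace AsymptoticSetting

variable {φ : ℝ → ℝ → ℝ} {p : ℕ → ℕ} {Ω : ℕ → Type*}
  [∀ n, MeasurableSpace (Ω n)] {μ : ∀ n, Measure (Ω n)} {P : ∀ n, Measure (Obs (p n))}
  {Z : ∀ n, Fin n → Ω n → Obs (p n)} {β ξ : ∀ n, Fin (p n) → ℝ}
  {N : ∀ n, (Fin (p n) → ℝ) → ℝ} {γ e : ℕ → ℝ} {K C₆ C₇ σ κ Λ K' v ρ A₀ : ℝ}
  (hS : AsymptoticSetting φ μ P Z β ξ N γ e K C₆ C₇ σ κ Λ K' v ρ A₀)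
  [∀ n, IsProbabilityMeasure (P n)] [∀ n, IsProbabilityMeasure (μ n)]
include hS

/-- The asymptotic expansion of the debiased estimator and the consistency of the variance
estimator, under the abstract rate conditions. -/
theorem main (hρ1 : ρ < 1) {C₁ C₈ : ℝ} (hC₁ : 0 < C₁) (hC₈ : 0 < C₈) (hA₀0 : 0 < A₀)
    (hA₀ : 2 * (C₆ * (K * K) * (16 / Real.sqrt ρ) + C₇ * (K ^ 2 * Real.sqrt (773 * C₈))) ≤ A₀)
    {J : ∀ n, Finset (Fin n)} {βhat βJ βJc : ∀ n, Ω n → Fin (p n) → ℝ}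
    {MJ MJc : ∀ n, Ω n → Matrix (Fin (p n)) (Fin (p n)) ℝ}
    (hJ : ∀ᶠ n in atTop, IsSplit ρ (J n)) (hmeas : ∀ᶠ n in atTop, Measurable (βhat n))
    (hb : HoldsWHP μ fun n ω =>
      GoodEstimate C₁ (β n) Finset.univ (fun i => Z n i ω) (βhat n ω))
    (hbJ : HoldsWHP μ fun n ω => GoodEstimate C₈ (β n) (J n) (fun i => Z n i ω) (βJ n ω))
    (hbJc : HoldsWHP μ fun n ω => GoodEstimate C₈ (β n) (J n)ᶜ (fun i => Z n i ω) (βJc n ω))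
    (hMJ : ∀ᶠ n in atTop, IsTwoStageEstimator φ (Z n) (J n)
      (Real.sqrt (l0 (β n)) * A₀ * lam (p n) n) (βJ n) (MJ n))
    (hMJc : ∀ᶠ n in atTop, IsTwoStageEstimator φ (Z n) (J n)ᶜ
      (Real.sqrt (l0 (β n)) * A₀ * lam (p n) n) (βJc n) (MJc n)) :
    IsLittleOP μ (fun n ω =>
        (debiased φ (J n) (fun i => Z n i ω) (ξ n) (βhat n ω) (MJ n ω) (MJc n ω)
            - ξ n ⬝ᵥ β n) / Real.sqrt (asympVar φ (P n) (β n) (ξ n))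
          - leadingTerm φ (P n) (fun i => Z n i ω) (β n) (ξ n))
        (fun n => (n : ℝ) ^ (-(1 / 2) : ℝ)) ∧
      IsLittleOP μ (fun n ω =>
        varEst φ (J n) (fun i => Z n i ω) (ξ n) (βhat n ω) (MJ n ω) (MJc n ω)
          / asympVar φ (P n) (β n) (ξ n) - 1) (fun _ => 1) := by
  obtain ⟨_, hR₀⟩ := hS.regular.exists
  have hv := hR₀.v_pos
  have hK' := hR₀.K'_pos
  have hρ := hS.ρ_pos
  obtain ⟨-, -, hs0τ, -, hlogl⟩ := rate_consequences hS.one_le_l0 hS.rate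
  have hAJ : ∀ᶠ n in atTop, ρ * n ≤ (J n).card := hJ.mono fun n h => h.1.le
  have hAJc : ∀ᶠ n in atTop, ρ * n ≤ (J n)ᶜ.card := hJ.mono fun n h => h.2.le
  have hAu : ∀ᶠ n : ℕ in atTop, ρ * n ≤ (Finset.univ : Finset (Fin n)).card :=
    Eventually.of_forall fun n => by
      rw [Finset.card_univ, Fintype.card_fin]
      exact mul_le_of_le_one_left (Nat.cast_nonneg _) hρ1.le
  have dJ := hS.whp_direction hAJ hC₈ hA₀0 hA₀ hbJ hMJ
  have dJc := hS.whp_direction hAJc hC₈ hA₀0 hA₀ hbJc hMJc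
  have hmMJ : ∀ᶠ n in atTop, ∀ i j, Measurable[subsample (Z n) (J n)ᶜᶜ] fun ω => MJ n ω i j := by
    filter_upwards [hMJ] with n hn
    rw [compl_compl]
    exact hn.output_measurable
  have hbm : WHP μ fun n ω => GoodEstimate C₁ (β n) Finset.univ (fun i => Z n i ω) (βhat n ω) := by
    refine hb.whp ?_
    filter_upwards [hS.sample, hmeas] with n hSa hMn
    exact measurableSet_goodEstimate hSa.measurable hMn
  have base := ((hS.whp_goodDesign hAu).and hbm).and (dJ.and dJc)
  have fresh : ∀ {ε : ℝ}, 0 < ε → _ := fun {ε} hε =>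
    (hS.whp_fresh hAJ (hMJc.mono fun n h => h.output_measurable)
      (dJc.mono (Eventually.of_forall fun n ω h => h.1)) hε).and
    (hS.whp_fresh hAJc hmMJ (dJ.mono (Eventually.of_forall fun n ω h => h.1)) hε)
  have hpos : ∀ n : ℕ, 0 < n → ∀ A : Finset (Fin n), ρ * n ≤ A.card → 0 < A.card :=
    fun n hn A hA => by
      have := (mul_pos hρ (by exact_mod_cast hn : (0 : ℝ) < n)).trans_le hA
      exact_mod_cast this
  refine ⟨IsLittleOP.of_whp fun ε₀ hε₀ => ?_, IsLittleOP.of_whp fun ε₀ hε₀ => ?_⟩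
  · set D := Real.sqrt (4 / κ * (C₆ * C₁ + C₁ ^ 2)) with hD
    -- The random remainder and the deterministic one `hrest` each take half of `ε₀`, after division by
    -- `√v / 2`.
    set ε := ε₀ * Real.sqrt v / 4 with hε
    have hsv := Real.sqrt_pos.2 hv
    have hε0 : 0 < ε := by positivity
    have hrest : Tendsto (fun n => Λ * D * e n +
        C₆ * K * (2 * (K' + 1)) * (16 / Real.sqrt ρ) * C₁ * (l0 (β n) * tau (p n) n) +
        2 * (2 * (K' + 1)) * C₇ * C₁ * (l0 (β n) * Real.sqrt (Real.log n) * tau (p n) n))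
        atTop (𝓝 0) := by
      simpa using ((hS.e_zero.const_mul (Λ * D)).add (hs0τ.const_mul
        (C₆ * K * (2 * (K' + 1)) * (16 / Real.sqrt ρ) * C₁))).add
        (hS.rate.const_mul (2 * (2 * (K' + 1)) * C₇ * C₁))
    refine (base.and (fresh hε0)).mono ?_
    filter_upwards [hS.regular, hS.eventually_small, hAJ, hAJc, hS.γ_nonneg,
      hS.γ_s0.eventually_le_const one_pos, hrest.eventually_le_const hε0]
      with n hR hn h1 h2 h3 h4 h5 ω ⟨⟨⟨hG, hbω⟩, hdJ, hdJc⟩, hFJ, hFJc⟩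
    have hΔ := hR.l2_error_le hn.1 hC₁ hG.rsc (fun i => (hG.deriv i).1) hbω h3 h4
    refine (hR.debiased_error_le hn.1 (hpos n hn.1 _ h1) (hpos n hn.1 _ h2) hρ (by positivity)
      (Real.sqrt_nonneg _) hG.deriv hFJ hFJc hbω hΔ hdJc.2 hdJ.2).trans ?_
    have hn' : (0 : ℝ) < n := by exact_mod_cast hn.1
    rw [Real.rpow_neg hn'.le, ← Real.sqrt_eq_rpow, abs_of_pos (inv_pos.2 (Real.sqrt_pos.2 hn')),
      ← div_eq_mul_inv]
    refine div_le_div_of_nonneg_right ?_ (Real.sqrt_nonneg _)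
    calc _ ≤ 2 / Real.sqrt v * (ε + ε) := by
          refine mul_le_mul_of_nonneg_left ?_ (by positivity)
          linarith
      _ = ε₀ := by rw [hε]; field_simp; ring
  -- `t` weighs the cross term; the choice of `t` and `ε` keeps the sum of all contributions below `ε₀`.
  · set t := min (ε₀ / 4) 1 with ht
    have ht0 : 0 < t := lt_min (by positivity) one_pos
    have ht1 : t ≤ ε₀ / 4 := min_le_left _ _
    set c := (1 + 1 / t) * 4 + 2 with hc
    have hc0 : 0 < c := by positivity
    set ε := ε₀ / 4 * v / c with hε
    have hε0 : 0 < ε := by positivity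
    have hrest : Tendsto (fun n : ℕ => (1 + 1 / t) * (8 * (2 * (K' + 1)) ^ 2 * (C₆ + C₇) ^ 2 * C₁ *
        (Real.log n * l0 (β n) * lam (p n) n ^ 2)) / v) atTop (𝓝 0) := by
      simpa using ((hlogl.const_mul (8 * (2 * (K' + 1)) ^ 2 * (C₆ + C₇) ^ 2 * C₁)).const_mul
        (1 + 1 / t)).div_const v
    have hx := hs0τ.const_mul (2 * K * C₁)
    rw [mul_zero] at hx
    refine ((base.and (fresh hε0)).and (hS.whp_variance hε0)).mono ?_
    filter_upwards [hS.regular, hS.eventually_small, hx.eventually_le_const one_pos,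
      hrest.eventually_le_const (by positivity : 0 < ε₀ / 4)]
      with n hR hn h1 h2 ω ⟨⟨⟨⟨hG, hbω⟩, hdJ, hdJc⟩, hFJ, hFJc⟩, hvar⟩
    refine (hR.varEst_error_le hn.1 (by positivity) hG.deriv hFJ hFJc hbω
      (fun i => (abs_dot_le_of_entry hR.K_pos hn.1 hG hbω.1 i).trans h1) hvar ht0
      (min_le_right _ _)).trans ?_
    rw [abs_one, mul_one]
    have e1 : ((1 + 1 / t) * (4 * ε + 8 * (2 * (K' + 1)) ^ 2 * (C₆ + C₇) ^ 2 * C₁ *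
        (Real.log n * l0 (β n) * lam (p n) n ^ 2)) + 2 * ε) / v = c * ε / v +
        (1 + 1 / t) * (8 * (2 * (K' + 1)) ^ 2 * (C₆ + C₇) ^ 2 * C₁ *
        (Real.log n * l0 (β n) * lam (p n) n ^ 2)) / v := by rw [hc]; ring
    have e2 : c * ε / v = ε₀ / 4 := by rw [hε]; field_simp
    rw [e1, e2]
    linarith

end AsymptoticSetting

/-! ### The two sets of tail assumptions -/

section Cases

/-- A symmetric matrix whose columns are small in both norms acts on `ξ` with an error governed by
the smaller of two bounds: through the support of `ξ`, or through the `ℓ₁` column norm. -/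
lemma l2_symm_error_le {n p : ℕ} (hn : 0 < n) {D : Matrix (Fin p) (Fin p) ℝ} (hD : D.IsSymm)
    {s₀ s₁ : ℕ} {A₀ κ : ℝ} (hκ : 0 < κ) (hA₀ : 0 ≤ A₀)
    (h1 : ∀ j, ∑ i, |D i j| ≤ 48 / (κ / 4) * (Real.sqrt s₀ * A₀ * lam p n * s₁))
    (h2 : ∀ j, l2 (fun i => D i j) ≤ 12 / (κ / 4) * (Real.sqrt s₀ * A₀ * lam p n * Real.sqrt s₁))
    (ξ : Fin p → ℝ) :
    Real.sqrt (s₀ * logMax p n) * l2 (D *ᵥ ξ) ≤ 48 / (κ / 4) * A₀ *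
      (min (Real.sqrt (((supp ξ).card : ℝ) * s₁)) s₁ * s₀ * tau p n) * l2 ξ := by
  have hlam := lam_nonneg (p := p) (n := n)
  have hξ := l2_nonneg ξ
  have e : Real.sqrt (s₀ * logMax p n) * (Real.sqrt s₀ * lam p n) = s₀ * tau p n := by
    rw [Real.sqrt_mul (Nat.cast_nonneg _), ← tau_eq hn]
    have := Real.mul_self_sqrt (Nat.cast_nonneg (α := ℝ) s₀)
    linear_combination (Real.sqrt (logMax p n) * lam p n) * this
  have b1 : l2 (D *ᵥ ξ) ≤ 48 / (κ / 4) * (Real.sqrt s₀ * A₀ * lam p n * s₁) * l2 ξ :=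
    l2_mulVec_le_of_isSymm hD (by positivity) h1 ξ
  have b2 : l2 (D *ᵥ ξ) ≤ 48 / (κ / 4) *
      (Real.sqrt s₀ * A₀ * lam p n * Real.sqrt (((supp ξ).card : ℝ) * s₁)) * l2 ξ := by
    refine (l2_mulVec_le_sqrt_card (by positivity) h2 ξ).trans ?_
    rw [Real.sqrt_mul (Nat.cast_nonneg _)]
    have : 12 / (κ / 4) ≤ 48 / (κ / 4) := div_le_div_of_nonneg_right (by norm_num) (by positivity)
    calc _ = 12 / (κ / 4) * (Real.sqrt s₀ * A₀ * lam p n *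
          (Real.sqrt (supp ξ).card * Real.sqrt s₁) * l2 ξ) := by ring
      _ ≤ 48 / (κ / 4) * (Real.sqrt s₀ * A₀ * lam p n *
          (Real.sqrt (supp ξ).card * Real.sqrt s₁) * l2 ξ) :=
        mul_le_mul_of_nonneg_right this (by positivity)
      _ = _ := by ring
  have b : l2 (D *ᵥ ξ) ≤ 48 / (κ / 4) * (Real.sqrt s₀ * A₀ * lam p n *
      min (Real.sqrt (((supp ξ).card : ℝ) * s₁)) s₁) * l2 ξ := by
    rcases min_choice (Real.sqrt (((supp ξ).card : ℝ) * s₁)) (s₁ : ℝ) with h | h <;> rw [h]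
    · exact b2
    · exact b1
  refine (mul_le_mul_of_nonneg_left b (Real.sqrt_nonneg _)).trans (le_of_eq ?_)
  linear_combination (48 / (κ / 4) * A₀ * min (Real.sqrt (((supp ξ).card : ℝ) * s₁)) s₁ * l2 ξ) * e

lemma tendsto_mul_tau {p : ℕ → ℕ} {f g : ℕ → ℝ}
    (h : Tendsto (fun n => f n * tau (p n) n) atTop (𝓝 0))
    (h0 : ∀ᶠ n in atTop, 0 ≤ g n) (hg : ∀ᶠ n in atTop, g n ≤ f n) :
    Tendsto (fun n => g n * tau (p n) n) atTop (𝓝 0) := by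
  refine squeeze_zero' ?_ ?_ h
  · filter_upwards [h0, eventually_gt_atTop 0] with n h1 hn using mul_nonneg h1 (tau_nonneg hn)
  · filter_upwards [hg, eventually_gt_atTop 0] with n h1 hn
    exact mul_le_mul_of_nonneg_right h1 (tau_nonneg hn)

lemma lam_le_tau {n p : ℕ} (hn : 0 < n) (hL : 1 ≤ logMax p n) : lam p n ≤ tau p n := by
  rw [← tau_eq hn]
  exact le_mul_of_one_le_left lam_nonneg (Real.one_le_sqrt.2 hL)

/-- The columns of `M*` do not vanish. -/
lemma Regular.s1xiCount_eq {p : ℕ} {φ : ℝ → ℝ → ℝ} {P : Measure (Obs p)} {β ξ : Fin p → ℝ}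
    {N : (Fin p → ℝ) → ℝ} {K C₆ C₇ σ κ Λ K' v : ℝ}
    (hR : Regular φ P β ξ N K C₆ C₇ σ κ Λ K' v) : s1xiCount φ P β ξ = (supp ξ).card := by
  unfold s1xiCount
  rw [Finset.filter_true_of_mem]
  intro j _ h0
  have hz : ∀ i, MStar φ P β i j = 0 := fun i => by
    by_contra hne
    have : i ∈ supp fun i => MStar φ P β i j := by simpa [supp] using hne
    exact (Finset.card_pos.2 ⟨i, this⟩).ne' h0
  have h1 := congrFun (congrFun hR.hess_mul j) j
  rw [Matrix.mul_apply] at h1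
  simp [hz] at h1

variable {φ : ℝ → ℝ → ℝ} {p : ℕ → ℕ} {Ω : ℕ → Type*}
  [∀ n, MeasurableSpace (Ω n)] {μ : ∀ n, Measure (Ω n)} {P : ∀ n, Measure (Obs (p n))}
  {Z : ∀ n, Fin n → Ω n → Obs (p n)} {β ξ : ∀ n, Fin (p n) → ℝ}
  {K C₆ C₇ σ κ Λ K' v ρ A₀ : ℝ} [∀ n, IsProbabilityMeasure (P n)]

/-- The setting of sub-gaussian coordinates. -/
lemma AsymptoticSetting.of_l1 (hρ : 0 < ρ) (hA₀ : 0 < A₀)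
    (hR : ∀ᶠ n in atTop, Regular φ (P n) (β n) (ξ n) (fun u => K * l1 u) K C₆ C₇ σ κ Λ K' v)
    (hsample : ∀ᶠ n in atTop, IsSample (μ n) (P n) (Z n)) (hβ : ∀ᶠ n in atTop, β n ≠ 0)
    (h : Tendsto (fun n =>
        max (max (l0 (β n) * Real.sqrt (Real.log n))
            (s1max φ (P n) (β n) * Real.sqrt (l0 (β n)) * (l1 (ξ n) / l2 (ξ n))))
          (min (Real.sqrt ((s1xiCount φ (P n) (β n) (ξ n) : ℝ) * s1max φ (P n) (β n)))
            (s1max φ (P n) (β n)) * l0 (β n)) * tau (p n) n) atTop (𝓝 0)) :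
    AsymptoticSetting φ μ P Z β ξ (fun _ u => K * l1 u)
      (fun n => C₆ * (K * K) * (16 / Real.sqrt ρ) * lam (p n) n)
      (fun n => K * (48 / (κ / 4) * A₀) * (s1max φ (P n) (β n) * Real.sqrt (l0 (β n)) *
          (l1 (ξ n) / l2 (ξ n)) * tau (p n) n) + 48 / (κ / 4) * A₀ *
        (min (Real.sqrt (((supp (ξ n)).card : ℝ) * s1max φ (P n) (β n)))
            (s1max φ (P n) (β n)) * l0 (β n) * tau (p n) n) + 1 / ((n : ℝ) + 1))
      K C₆ C₇ σ κ Λ K' v ρ A₀ := by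
  obtain ⟨_, hR₀⟩ := hR.exists
  have hK := hR₀.K_pos
  have hC := hR₀.C₆_pos
  have hκ := hR₀.κ_pos
  have hl0 : ∀ᶠ n in atTop, 1 ≤ l0 (β n) := hβ.mono fun n hn => DebiasedGLM.one_le_l0 hn
  have hrate : Tendsto (fun n => l0 (β n) * Real.sqrt (Real.log n) * tau (p n) n) atTop (𝓝 0) :=
    tendsto_mul_tau h (Eventually.of_forall fun n => by positivity)
      (Eventually.of_forall fun n => (le_max_left _ _).trans (le_max_left _ _))
  have hratio : ∀ n, 0 ≤ l1 (ξ n) / l2 (ξ n) := fun n => div_nonneg (l1_nonneg _) (l2_nonneg _)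
  have ha : Tendsto (fun n => s1max φ (P n) (β n) * Real.sqrt (l0 (β n)) *
      (l1 (ξ n) / l2 (ξ n)) * tau (p n) n) atTop (𝓝 0) :=
    tendsto_mul_tau h (Eventually.of_forall fun n => mul_nonneg (by positivity) (hratio n))
      (Eventually.of_forall fun n => (le_max_right _ _).trans (le_max_left _ _))
  have hb : Tendsto (fun n => min (Real.sqrt (((supp (ξ n)).card : ℝ) * s1max φ (P n) (β n)))
            (s1max φ (P n) (β n)) * l0 (β n) * tau (p n) n) atTop (𝓝 0) := by
    refine tendsto_mul_tau h (Eventually.of_forall fun n => by positivity) ?_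
    filter_upwards [hR] with n hRn
    rw [← hRn.s1xiCount_eq]
    exact le_max_right _ _
  obtain ⟨hL, -, hs0τ, hLn, -⟩ := rate_consequences hl0 hrate
  have hs1 : Tendsto (fun n => s1max φ (P n) (β n) * tau (p n) n) atTop (𝓝 0) := by
    refine tendsto_mul_tau ha (Eventually.of_forall fun n => Nat.cast_nonneg _) ?_
    filter_upwards [hl0, hR] with n h1 hRn
    have h2 : 1 ≤ Real.sqrt (l0 (β n)) := Real.one_le_sqrt.2 (by exact_mod_cast h1)
    have h3 : 1 ≤ l1 (ξ n) / l2 (ξ n) := (one_le_div hRn.ξ_pos).2 (l2_le_l1 _)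
    rw [mul_assoc]
    exact le_mul_of_one_le_right (Nat.cast_nonneg _) (one_le_mul_of_one_le_of_one_le h2 h3)
  -- a tolerance of order `λ_n` is negligible against sparsity levels that are `o(1 / τ_n)`
  have hγ : ∀ s : ℕ → ℕ, Tendsto (fun n => s n * tau (p n) n) atTop (𝓝 0) →
      Tendsto (fun n => C₆ * (K * K) * (16 / Real.sqrt ρ) * lam (p n) n * s n) atTop (𝓝 0) := by
    intro s hs
    have h1 := hs.const_mul (C₆ * (K * K) * (16 / Real.sqrt ρ))
    rw [mul_zero] at h1
    refine squeeze_zero' (Eventually.of_forall fun n => ?_) ?_ h1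
    · have := lam_nonneg (p := p n) (n := n)
      positivity
    · filter_upwards [hL, eventually_gt_atTop 0] with n h2 hn
      rw [mul_assoc, mul_comm (lam _ _)]
      gcongr
      exact lam_le_tau hn h2
  refine ⟨hρ, hR, hsample, hβ, hrate, Eventually.of_forall fun n => ?_, hγ _ hs0τ, hγ _ hs1,
    fun A hA => ?_, ?_, ?_⟩
  · have := lam_nonneg (p := p n) (n := n)
    positivity
  · have h1 := ENNReal.tendsto_ofReal ((AsymptoticSetting.exp_logMax_tendsto (p := p)).const_mul 2)
    rw [mul_zero, ENNReal.ofReal_zero] at h1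
    refine tendsto_of_tendsto_of_tendsto_of_le_of_le' tendsto_const_nhds h1
      (Eventually.of_forall fun _ => zero_le) ?_
    filter_upwards [hR, hsample, hA, hLn.eventually_le_const hρ, eventually_gt_atTop 0]
      with n hRn hSa hAn h2 hn
    refine (measure_mono fun ω hω hrc => hω.2.2 fun u => le_trans ?_ (hrc u)).trans
      (hRn.restrictedConvex_entrywise hSa hn hρ hAn h2)
    have := mul_nonneg hκ.le (sq_nonneg (l2 u))
    linarith
  · simpa using ((ha.const_mul (K * (48 / (κ / 4) * A₀))).add (hb.const_mul
      (48 / (κ / 4) * A₀))).add tendsto_one_div_add_atTop_nhds_zero_nat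
  · filter_upwards [hR, hL, eventually_gt_atTop 0] with n hRn h1 hn
    have hτ := tau_nonneg (p := p n) hn
    have hξ := hRn.ξ_pos
    have hpos : (0 : ℝ) < 1 / ((n : ℝ) + 1) := by positivity
    have hr := hratio n
    refine ⟨by positivity, fun D hD h2 h3 => ⟨?_, ?_⟩⟩
    · have h4 := mul_le_mul_of_nonneg_left (l1_mulVec_le h2 (ξ n)) hK.le
      refine h4.trans (le_trans ?_ (mul_le_mul_of_nonneg_right (le_trans (le_add_of_nonneg_right
        (by positivity)) (le_add_of_nonneg_right hpos.le)) hξ.le))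
      have h5 : l1 (ξ n) = l1 (ξ n) / l2 (ξ n) * l2 (ξ n) := by field_simp
      calc K * (48 / (κ / 4) * (Real.sqrt (l0 (β n)) * A₀ * lam (p n) n *
            s1max φ (P n) (β n)) * l1 (ξ n))
          = K * (48 / (κ / 4) * A₀) * (s1max φ (P n) (β n) * Real.sqrt (l0 (β n)) *
            l1 (ξ n) * lam (p n) n) := by ring
        _ ≤ K * (48 / (κ / 4) * A₀) * (s1max φ (P n) (β n) * Real.sqrt (l0 (β n)) *
            l1 (ξ n) * tau (p n) n) := by
          have := l1_nonneg (ξ n)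
          have := lam_le_tau hn h1
          gcongr
        _ = _ := by rw [h5]; field_simp
    · refine (l2_symm_error_le hn hD hκ hA₀.le h2 h3 (ξ n)).trans
        (mul_le_mul_of_nonneg_right ?_ hξ.le)
      have : 0 ≤ K * (48 / (κ / 4) * A₀) * (s1max φ (P n) (β n) * Real.sqrt (l0 (β n)) *
          (l1 (ξ n) / l2 (ξ n)) * tau (p n) n) := by positivity
      linarith

/-- The setting of a sub-gaussian random vector.  The number `k` of atoms in the sparsification is
as large as the union bound permits, which makes the tolerance of order `log (p ∨ n) / n`. -/
lemma AsymptoticSetting.of_l2 (hρ : 0 < ρ) (hA₀ : 0 < A₀)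
    (hR : ∀ᶠ n in atTop, Regular φ (P n) (β n) (ξ n) (fun u => K * l2 u) K C₆ C₇ σ κ Λ K' v)
    (hsample : ∀ᶠ n in atTop, IsSample (μ n) (P n) (Z n)) (hβ : ∀ᶠ n in atTop, β n ≠ 0)
    (h : Tendsto (fun n =>
        max (l0 (β n) * Real.sqrt (Real.log n))
          (min (Real.sqrt (((supp (ξ n)).card : ℝ) * s1max φ (P n) (β n)))
            (s1max φ (P n) (β n)) * l0 (β n)) * tau (p n) n) atTop (𝓝 0)) :
    AsymptoticSetting φ μ P Z β ξ (fun _ u => K * l2 u)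
      (fun n => 774 * (C₆ * K ^ 2) / ((⌊κ ^ 2 / (128 * C₆ ^ 2 * K ^ 4) * ρ * n /
        (4 * logMax (p n) n)⌋₊ : ℝ) - 1))
      (fun n => (K + 1) * (48 / (κ / 4) * A₀) *
        (min (Real.sqrt (((supp (ξ n)).card : ℝ) * s1max φ (P n) (β n)))
            (s1max φ (P n) (β n)) * l0 (β n) * tau (p n) n) + 1 / ((n : ℝ) + 1))
      K C₆ C₇ σ κ Λ K' v ρ A₀ := by
  obtain ⟨_, hR₀⟩ := hR.exists
  have hK := hR₀.K_pos
  have hC := hR₀.C₆_pos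
  have hκ := hR₀.κ_pos
  have hl0 : ∀ᶠ n in atTop, 1 ≤ l0 (β n) := hβ.mono fun n hn => DebiasedGLM.one_le_l0 hn
  have hrate : Tendsto (fun n => l0 (β n) * Real.sqrt (Real.log n) * tau (p n) n) atTop (𝓝 0) :=
    tendsto_mul_tau h (Eventually.of_forall fun n => by positivity)
      (Eventually.of_forall fun n => le_max_left _ _)
  have hb : Tendsto (fun n => min (Real.sqrt (((supp (ξ n)).card : ℝ) * s1max φ (P n) (β n)))
            (s1max φ (P n) (β n)) * l0 (β n) * tau (p n) n) atTop (𝓝 0) :=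
    tendsto_mul_tau h (Eventually.of_forall fun n => by positivity)
      (Eventually.of_forall fun n => le_max_right _ _)
  obtain ⟨hL, -, hs0τ, hLn, -⟩ := rate_consequences hl0 hrate
  have hs1 : Tendsto (fun n => Real.sqrt (s1max φ (P n) (β n)) * tau (p n) n) atTop (𝓝 0) := by
    refine tendsto_mul_tau hb (Eventually.of_forall fun n => Real.sqrt_nonneg _) ?_
    filter_upwards [hl0, hR] with n h1 hRn
    have h2 : (1 : ℝ) ≤ l0 (β n) := by exact_mod_cast h1
    have h3 : (1 : ℝ) ≤ (supp (ξ n)).card := by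
      have hne : ξ n ≠ 0 := fun h0 => by
        have := hRn.ξ_pos
        simp [h0, l2] at this
      exact_mod_cast DebiasedGLM.one_le_l0 hne
    refine le_trans (le_min ?_ ?_) (le_mul_of_one_le_right (by positivity) h2)
    · exact Real.sqrt_le_sqrt (le_mul_of_one_le_left (Nat.cast_nonneg _) h3)
    · refine Real.sqrt_le_iff.2 ⟨Nat.cast_nonneg _, ?_⟩
      exact_mod_cast Nat.le_self_pow two_ne_zero _
  -- the two sparsity levels are negligible against `n / log (p ∨ n)`
  have hs0L : Tendsto (fun n => logMax (p n) n / n * l0 (β n)) atTop (𝓝 0) := by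
    refine squeeze_zero' ?_ ?_ hs0τ
    · filter_upwards [hL] with n h1
      positivity
    · filter_upwards [hL, eventually_gt_atTop 0] with n h1 hn
      rw [mul_comm, ← lam_sq hn, lam_sq_eq_tau hn]
      refine mul_le_mul_of_nonneg_left (div_le_self (tau_nonneg hn) (Real.one_le_sqrt.2 ?_))
        (Nat.cast_nonneg _)
      exact_mod_cast hn
  have hs1L : Tendsto (fun n => logMax (p n) n / n * s1max φ (P n) (β n)) atTop (𝓝 0) := by
    have h2 := hs1.pow 2
    rw [zero_pow two_ne_zero] at h2
    refine squeeze_zero' ?_ ?_ h2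
    · filter_upwards [hL] with n h1
      positivity
    · filter_upwards [hL, eventually_gt_atTop 0] with n h1 hn
      rw [mul_pow, Real.sq_sqrt (Nat.cast_nonneg _), mul_comm]
      refine mul_le_mul_of_nonneg_left ?_ (Nat.cast_nonneg _)
      rw [← lam_sq hn]
      exact pow_le_pow_left₀ lam_nonneg (lam_le_tau hn h1) 2
  set c := κ ^ 2 / (128 * C₆ ^ 2 * K ^ 4) with hc
  have hc0 : 0 < c := by positivity
  -- the number of atoms is of order `n / log (p ∨ n)`
  have hk : ∀ᶠ n : ℕ in atTop,
      c * ρ * n / (8 * logMax (p n) n) ≤ (⌊c * ρ * n / (4 * logMax (p n) n)⌋₊ : ℝ) - 1 ∧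
      2 ≤ c * ρ * n / (8 * logMax (p n) n) := by
    filter_upwards [hL, hLn.eventually_le_const (by positivity : 0 < c * ρ / 16),
      eventually_gt_atTop 0] with n h1 h2 hn
    have hn' : (0 : ℝ) < n := by exact_mod_cast hn
    have hLp : 0 < logMax (p n) n := by linarith
    rw [div_le_iff₀ hn'] at h2
    have h3 : 2 ≤ c * ρ * n / (8 * logMax (p n) n) := by
      rw [le_div_iff₀ (by positivity)]
      linarith
    refine ⟨?_, h3⟩
    have h4 := Nat.lt_floor_add_one (c * ρ * n / (4 * logMax (p n) n))
    have h5 : c * ρ * n / (4 * logMax (p n) n) = 2 * (c * ρ * n / (8 * logMax (p n) n)) := by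
      field_simp; ring
    linarith
  have hγ : ∀ s : ℕ → ℕ, Tendsto (fun n => logMax (p n) n / n * s n) atTop (𝓝 0) →
      Tendsto (fun n => 774 * (C₆ * K ^ 2) / ((⌊c * ρ * n / (4 * logMax (p n) n)⌋₊ : ℝ) - 1) *
        s n) atTop (𝓝 0) := by
    intro s hs
    have h1 := hs.const_mul (774 * (C₆ * K ^ 2) * 8 / (c * ρ))
    rw [mul_zero] at h1
    refine squeeze_zero' ?_ ?_ h1
    · filter_upwards [hk] with n h2
      have : 0 ≤ (⌊c * ρ * n / (4 * logMax (p n) n)⌋₊ : ℝ) - 1 := by linarith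
      positivity
    · filter_upwards [hk, hL, eventually_gt_atTop 0] with n h2 h3 hn
      have hn' : (0 : ℝ) < n := by exact_mod_cast hn
      have hLp : 0 < logMax (p n) n := by linarith
      rw [← mul_assoc _ (logMax (p n) n / n)]
      refine mul_le_mul_of_nonneg_right ?_ (Nat.cast_nonneg _)
      refine (div_le_div_of_nonneg_left (by positivity) (by linarith) h2.1).trans (le_of_eq ?_)
      field_simp
  refine ⟨hρ, hR, hsample, hβ, hrate, ?_, hγ _ hs0L, hγ _ hs1L, fun A hA => ?_, ?_, ?_⟩
  · filter_upwards [hk] with n h2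
    have : 0 ≤ (⌊c * ρ * n / (4 * logMax (p n) n)⌋₊ : ℝ) - 1 := by linarith
    positivity
  · have h1 : Tendsto (fun n : ℕ => Real.exp (-(c * ρ / 2 * n))) atTop (𝓝 0) :=
      Real.tendsto_exp_neg_atTop_nhds_zero.comp
        (tendsto_natCast_atTop_atTop.const_mul_atTop (by positivity))
    have h2 := ENNReal.tendsto_ofReal h1
    rw [ENNReal.ofReal_zero] at h2
    refine tendsto_of_tendsto_of_tendsto_of_le_of_le' tendsto_const_nhds h2
      (Eventually.of_forall fun _ => zero_le) ?_
    filter_upwards [hR, hsample, hA, hL, hk, eventually_gt_atTop 0] with n hRn hSa hAn h3 h4 hn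
    have hn' : (0 : ℝ) < n := by exact_mod_cast hn
    have hLp : 0 < logMax (p n) n := by linarith
    have hAc : 0 < (A n).card := by
      have := (mul_pos hρ hn').trans_le hAn
      exact_mod_cast this
    have hk2 : 2 ≤ ⌊c * ρ * n / (4 * logMax (p n) n)⌋₊ := by
      have : (2 : ℝ) ≤ ⌊c * ρ * n / (4 * logMax (p n) n)⌋₊ := by linarith
      exact_mod_cast this
    refine (hRn.restrictedConvex_sparse hSa hAc hn h3
      (fun u hu => hRn.N_sub u _ (by positivity) le_rfl) hk2).trans
      (ENNReal.ofReal_le_ofReal (Real.exp_le_exp.2 ?_))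
    have h5 := Nat.floor_le (by positivity : 0 ≤ c * ρ * n / (4 * logMax (p n) n))
    rw [le_div_iff₀ (by positivity)] at h5
    have h6 := mul_le_mul_of_nonneg_left hAn hc0.le
    rw [← hc]
    linarith
  · simpa using (hb.const_mul ((K + 1) * (48 / (κ / 4) * A₀))).add
      tendsto_one_div_add_atTop_nhds_zero_nat
  · filter_upwards [hR, hL, hl0, eventually_gt_atTop 0] with n hRn h1 hl hn
    have hτ := tau_nonneg (p := p n) hn
    have hξ := hRn.ξ_pos
    have hpos : (0 : ℝ) < 1 / ((n : ℝ) + 1) := by positivity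
    refine ⟨by positivity, fun D hD h2 h3 => ?_⟩
    have h4 := l2_symm_error_le hn hD hκ hA₀.le h2 h3 (ξ n)
    set X := min (Real.sqrt (((supp (ξ n)).card : ℝ) * s1max φ (P n) (β n)))
      (s1max φ (P n) (β n)) * l0 (β n) * tau (p n) n with hX
    have hX0 : 0 ≤ X := by positivity
    have h5 : 1 ≤ Real.sqrt (l0 (β n) * logMax (p n) n) :=
      Real.one_le_sqrt.2 (one_le_mul_of_one_le_of_one_le (by exact_mod_cast hl) h1)
    have h6 : l2 (D *ᵥ ξ n) ≤ 48 / (κ / 4) * A₀ * X * l2 (ξ n) :=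
      (le_mul_of_one_le_left (l2_nonneg _) h5).trans h4
    have h7 : 0 ≤ 48 / (κ / 4) * A₀ * X * l2 (ξ n) := by positivity
    have h8 : 0 ≤ 1 / ((n : ℝ) + 1) * l2 (ξ n) := by positivity
    have e1 : ((K + 1) * (48 / (κ / 4) * A₀) * X + 1 / ((n : ℝ) + 1)) * l2 (ξ n) =
        K * (48 / (κ / 4) * A₀ * X * l2 (ξ n)) + 48 / (κ / 4) * A₀ * X * l2 (ξ n) +
          1 / ((n : ℝ) + 1) * l2 (ξ n) := by ring
    rw [e1]
    have h9 := mul_le_mul_of_nonneg_left h6 hK.le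
    have h10 := mul_nonneg hK.le h7
    exact ⟨by linarith, by linarith⟩

end Cases

end DebiasedGLM

open DebiasedGLM in
theorem theorem6 (σ₁ C₆ C₇ C₈ ρ : ℝ) (hσ₁ : 0 < σ₁) (hC₆ : 0 < C₆) (hC₇ : 0 < C₇)
    (hC₈ : 0 < C₈) (hρ : 0 < ρ) (hρ1 : ρ < 1) :
    ∃ Amin : ℝ, 0 < Amin ∧ ∀ A₀ : ℝ, Amin ≤ A₀ →
    ∀ (σ₂ C₁ C₃ C₄ C₅ : ℝ), 0 < σ₂ → 0 < C₁ → 0 < C₃ → 0 < C₄ → 0 < C₅ →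
    ∀ φ : ℝ → ℝ → ℝ, IsLoss φ →
    ∀ (p : ℕ → ℕ) (Ω : ℕ → Type*) [∀ n, MeasurableSpace (Ω n)]
      (μ : ∀ n, Measure (Ω n)) [∀ n, IsProbabilityMeasure (μ n)]
      (P : ∀ n, Measure (Obs (p n))) [∀ n, IsProbabilityMeasure (P n)]
      (Z : ∀ n, Fin n → Ω n → Obs (p n))
      (βbar ξ : ∀ n, Fin (p n) → ℝ)
      (J : ∀ n, Finset (Fin n))
      (βhat βJ βJc : ∀ n, Ω n → Fin (p n) → ℝ)
      (MJ MJc : ∀ n, Ω n → Matrix (Fin (p n)) (Fin (p n)) ℝ),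
    -- the data, the target, the loading and the sample split
    (∀ᶠ n in atTop, IsSample (μ n) (P n) (Z n)) →
    (∀ᶠ n in atTop, IsTarget φ (P n) (βbar n)) →
    (∀ᶠ n in atTop, βbar n ≠ 0) →
    (∀ᶠ n in atTop, ξ n ≠ 0) →
    (∀ᶠ n in atTop, IsSplit ρ (J n)) →
    -- assumptions on the population
    (∀ᶠ n in atTop, EigenvalueAssumption φ (P n) (βbar n) C₃ C₄) →
    (∀ᶠ n in atTop, ResidualAssumption φ (P n) (βbar n) σ₂ C₅) →
    (∀ᶠ n in atTop, DerivativeAssumption φ (P n) (βbar n) C₆ C₇) →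
    (∀ᶠ n in atTop, MXEntriesAssumption φ (P n) (βbar n) σ₁) →
    -- the initial estimators
    (∀ᶠ n in atTop, Measurable (βhat n)) →
    HoldsWHP μ (fun n ω =>
      GoodEstimate C₁ (βbar n) Finset.univ (fun i => Z n i ω) (βhat n ω)) →
    HoldsWHP μ (fun n ω =>
      GoodEstimate C₈ (βbar n) (J n) (fun i => Z n i ω) (βJ n ω)) →
    HoldsWHP μ (fun n ω =>
      GoodEstimate C₈ (βbar n) (J n)ᶜ (fun i => Z n i ω) (βJc n ω)) →
    -- the extended two-stage estimators with tuning parameter `√s₀ A₀ λ_n`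
    (∀ᶠ n in atTop, IsTwoStageEstimator φ (Z n) (J n)
      (Real.sqrt (l0 (βbar n)) * A₀ * lam (p n) n) (βJ n) (MJ n)) →
    (∀ᶠ n in atTop, IsTwoStageEstimator φ (Z n) (J n)ᶜ
      (Real.sqrt (l0 (βbar n)) * A₀ * lam (p n) n) (βJc n) (MJc n)) →
    -- part (i)
    ((∀ᶠ n in atTop, SubGaussianEntries φ (P n) (βbar n) (ξ n) σ₁) →
      Tendsto (fun n =>
        max (max (l0 (βbar n) * Real.sqrt (Real.log n))
            (s1max φ (P n) (βbar n) * Real.sqrt (l0 (βbar n)) * (l1 (ξ n) / l2 (ξ n))))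
          (min (Real.sqrt ((s1xiCount φ (P n) (βbar n) (ξ n) : ℝ) * s1max φ (P n) (βbar n)))
            (s1max φ (P n) (βbar n)) * l0 (βbar n)) * tau (p n) n) atTop (𝓝 0) →
      IsLittleOP μ (fun n ω =>
        (debiased φ (J n) (fun i => Z n i ω) (ξ n) (βhat n ω) (MJ n ω) (MJc n ω)
            - ξ n ⬝ᵥ βbar n) / Real.sqrt (asympVar φ (P n) (βbar n) (ξ n))
          - leadingTerm φ (P n) (fun i => Z n i ω) (βbar n) (ξ n))
        (fun n => (n : ℝ) ^ (-(1 / 2) : ℝ)) ∧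
      IsLittleOP μ (fun n ω =>
        varEst φ (J n) (fun i => Z n i ω) (ξ n) (βhat n ω) (MJ n ω) (MJc n ω)
          / asympVar φ (P n) (βbar n) (ξ n) - 1) (fun _ => 1)) ∧
    -- part (ii)
    ((∀ᶠ n in atTop, SubGaussianVector (P n) σ₁) →
      Tendsto (fun n =>
        max (l0 (βbar n) * Real.sqrt (Real.log n))
          (min (Real.sqrt (((supp (ξ n)).card : ℝ) * s1max φ (P n) (βbar n)))
            (s1max φ (P n) (βbar n)) * l0 (βbar n)) * tau (p n) n) atTop (𝓝 0) →
      IsLittleOP μ (fun n ω =>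
        (debiased φ (J n) (fun i => Z n i ω) (ξ n) (βhat n ω) (MJ n ω) (MJc n ω)
            - ξ n ⬝ᵥ βbar n) / Real.sqrt (asympVar φ (P n) (βbar n) (ξ n))
          - leadingTerm φ (P n) (fun i => Z n i ω) (βbar n) (ξ n))
        (fun n => (n : ℝ) ^ (-(1 / 2) : ℝ)) ∧
      IsLittleOP μ (fun n ω =>
        varEst φ (J n) (fun i => Z n i ω) (ξ n) (βhat n ω) (MJ n ω) (MJc n ω)
          / asympVar φ (P n) (βbar n) (ξ n) - 1) (fun _ => 1)) := by
  have hAmin : 0 < 2 * (C₆ * (2 * σ₁ * (2 * σ₁)) * (16 / Real.sqrt ρ) +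
      C₇ * ((2 * σ₁) ^ 2 * Real.sqrt (773 * C₈))) := by positivity
  refine ⟨_, hAmin, fun A₀ hA₀ => ?_⟩
  have hA₀0 := hAmin.trans_le hA₀
  intro σ₂ C₁ C₃ C₄ C₅ hσ₂ hC₁ hC₃ hC₄ hC₅ φ hφ p Ω _ μ _ P _ Z βbar ξ J βhat βJ βJc MJ MJc
    hsample htarget hβ hξ hJ hE hRes hDer hM hmeas hb hbJ hbJc hMJ hMJc
  refine ⟨fun hX hrate => ?_, fun hX hrate => ?_⟩
  · have hReg : ∀ᶠ n in atTop, Regular φ (P n) (βbar n) (ξ n) (fun u => 2 * σ₁ * l1 u) (2 * σ₁)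
        C₆ C₇ (2 * σ₂) (1 / C₄) (1 / C₃) (2 * σ₁ * C₄) (C₅ * C₃) := by
      filter_upwards [htarget, hξ, hE, hRes, hDer, hM, hX] with n h1 h2 h3 h4 h5 h6 h7
      exact Regular.of_entries hφ hσ₂ hσ₁ hC₃ hC₄ hC₅ hC₆ hC₇ h1 h2 h3 h4 h5 h6 h7
    exact (AsymptoticSetting.of_l1 hρ hA₀0 hReg hsample hβ hrate).main hρ1 hC₁ hC₈ hA₀0 hA₀ hJ
      hmeas hb hbJ hbJc hMJ hMJc
  · have hReg : ∀ᶠ n in atTop, Regular φ (P n) (βbar n) (ξ n) (fun u => 2 * σ₁ * l2 u) (2 * σ₁)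
        C₆ C₇ (2 * σ₂) (1 / C₄) (1 / C₃) (2 * σ₁ * C₄) (C₅ * C₃) := by
      filter_upwards [htarget, hξ, hE, hRes, hDer, hM, hX] with n h1 h2 h3 h4 h5 h6 h7
      exact Regular.of_vector hφ hσ₂ hσ₁ hC₃ hC₄ hC₅ hC₆ hC₇ h1 h2 h3 h4 h5 h6 h7
    exact (AsymptoticSetting.of_l2 hρ hA₀0 hReg hsample hβ hrate).main hρ1 hC₁ hC₈ hA₀0 hA₀ hJ
      hmeas hb hbJ hbJc hMJ hMJc
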